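/- \textbf{Definitions.} All graphs are finite, simple and undirected. The \emph{claw} is $K_{1,3}$ and the \emph{diamond} is $K_4$ minus an edge; a graph is $\{\text{claw},\text{diamond}\}$-free if neither of them is isomorphic to an induced subgraph of it. An instance of \textsc{$\{$claw,diamond$\}$-free Edge Deletion} is a pair $(G,k)$ of a graph $G$ and an integer $k\ge 0$ (the parameter); it is a yes-instance if there is a set $F\subseteq E(G)$ with $|F|\le k$ such that $G-F$ is $\{\text{claw},\text{diamond}\}$-free. An instance of \textsc{Annotated $\{$claw,diamond$\}$-free Edge Deletion} is a triple $(G,S,k)$ with $S\subseteq V(G)$; it is a yes-instance if there is such a set $F$ all of whose edges have both endpoints in $S$. Instances are written as binary words, with graphs given by their adjacency matrices and numbers in unary; polynomial time is measured in the length of this word, which for an instance $(G,k)$ amounts to time polynomial in $|V(G)|+k$. \textbf{Theorem.} The (unparameterized) problem \textsc{Annotated $\{$claw,diamond$\}$-free Edge Deletion} is in NP, and there is a polynomial-time compression of \textsc{$\{$claw,diamond$\}$-free Edge Deletion} into it of size $O(k^{24})$, with output instances on $O(k^{12})$ vertices. That is, there are an absolute constant $C$ and a polynomial-time algorithm that,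 given an instance $(G,k)$ of \textsc{$\{$claw,diamond$\}$-free Edge Deletion}, outputs an instance $y=(G',S',k')$ of \textsc{Annotated $\{$claw,diamond$\}$-free Edge Deletion} such that $(G,k)$ is a yes-instance if and only if $y$ is a yes-instance, the word encoding $y$ has length at most $C\,(k^{24}+1)$, and $|V(G')|\le C\,(k^{12}+1)$. -/

import Mathlib

namespace EdgeDeletion

/-! ### Graphs -/

/-- The claw: center `0`, leaves `1`, `2`, `3`. -/
def claw : SimpleGraph (Fin 4) :=
  SimpleGraph.fromEdgeSet {s(0, 1), s(0, 2), s(0, 3)}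

/-- The diamond: the complete graph on four vertices with the edge `03` removed. -/
def diamond : SimpleGraph (Fin 4) :=
  SimpleGraph.fromEdgeSet {s(0, 1), s(0, 2), s(1, 2), s(1, 3), s(2, 3)}

/-- A family of finite graphs, each given with its number of vertices. -/
abbrev Family : Type := Set (Σ m : ℕ, SimpleGraph (Fin m))

/-- The family consisting of the claw and the diamond. -/
def clawDiamond : Family := {⟨4, claw⟩, ⟨4, diamond⟩}

/-- `G` is `ℋ`-free: no member of `ℋ` is isomorphic to an induced subgraph of `G`. -/
def IsFree {V : Type*} (ℋ : Family) (G : SimpleGraph V) : Prop :=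
  ∀ H ∈ ℋ, ¬ SimpleGraph.IsIndContained H.2 G

/-- `F` is an `ℋ`-free deletion set (HDS) of `G`: a set of edges of `G` whose deletion makes `G`
an `ℋ`-free graph. -/
def IsHDS {V : Type*} (ℋ : Family) (G : SimpleGraph V) (F : Finset (Sym2 V)) : Prop :=
  (F : Set (Sym2 V)) ⊆ G.edgeSet ∧ IsFree ℋ (G.deleteEdges (F : Set (Sym2 V)))

/-! ### The two problems -/

/-- An instance `(G, k)` of the edge deletion problem. -/
structure Instance where
  /-- the number of vertices -/
  n : ℕ
  /-- the graph -/
  G : SimpleGraph (Fin n)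
  /-- the parameter, that is, the number of deletions allowed -/
  k : ℕ

/-- An instance `(G, S, k)` of the annotated edge deletion problem. -/
structure AnnotatedInstance where
  /-- the number of vertices -/
  n : ℕ
  /-- the graph -/
  G : SimpleGraph (Fin n)
  /-- the annotated vertices -/
  S : Finset (Fin n)
  /-- the number of deletions allowed -/
  k : ℕ

/-- The yes-instances of `ℋ`-free Edge Deletion: `G` has an HDS of size at most `k`. -/
def edgeDeletion (ℋ : Family) : Set Instance :=
  {I | ∃ F : Finset (Sym2 (Fin I.n)), IsHDS ℋ I.G F ∧ F.card ≤ I.k}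

/-- The yes-instances of Annotated `ℋ`-free Edge Deletion: `G` has an HDS of size at most `k` all
of whose edges have both endpoints in `S`. -/
def annotatedEdgeDeletion (ℋ : Family) : Set AnnotatedInstance :=
  {J | ∃ F : Finset (Sym2 (Fin J.n)),
    IsHDS ℋ J.G F ∧ F.card ≤ J.k ∧ ∀ e ∈ F, ∀ v ∈ e, v ∈ J.S}

/-! ### Instances as binary words -/

/-- Numbers in unary, ended by a zero bit. -/
def encodeNat (m : ℕ) : List Bool := List.replicate m true ++ [false]

open Classical in
/-- The number of vertices (in unary) followed by the adjacency matrix, row by row. -/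
noncomputable def encodeGraph {n : ℕ} (G : SimpleGraph (Fin n)) : List Bool :=
  encodeNat n ++ (List.ofFn fun i => List.ofFn fun j => decide (G.Adj i j)).flatten

/-- The characteristic vector of a set of vertices. -/
def encodeVertexSet {n : ℕ} (S : Finset (Fin n)) : List Bool :=
  List.ofFn fun i => decide (i ∈ S)

/-- The word of an instance `(G, k)`: its length is that of the word of `G`, plus `k + 1`. -/
noncomputable def Instance.encode (I : Instance) : List Bool :=
  encodeGraph I.G ++ encodeNat I.k

/-- The word of an instance `(G, S, k)`. -/
noncomputable def AnnotatedInstance.encode (J : AnnotatedInstance) : List Bool :=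
  encodeGraph J.G ++ encodeVertexSet J.S ++ encodeNat J.k

/-- Annotated `ℋ`-free Edge Deletion as a language: the words of its yes-instances. -/
def annotatedLanguage (ℋ : Family) : Language Bool :=
  {w | ∃ J ∈ annotatedEdgeDeletion ℋ, J.encode = w}

/-! ### Complexity -/

/-- The input of a verifier, a word and a certificate, written one after the other over two
disjoint copies of the binary alphabet. -/
def encodePair (p : List Bool × List Bool) : List (Bool ⊕ Bool) :=
  p.1.map Sum.inl ++ p.2.map Sum.inr

/-- The class NP: languages with a polynomial-time verifier for certificates of polynomial
length. -/
def InNP (L : Language Bool) : Prop :=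
  ∃ (p : Polynomial ℕ) (V : List Bool × List Bool → Bool),
    Nonempty (Turing.TM2ComputableInPolyTime encodePair Computability.encodeBool V) ∧
    ∀ w : List Bool, w ∈ L ↔ ∃ c : List Bool, c.length ≤ p.eval w.length ∧ V (w, c) = true

/-- `f` is a polynomial-time compression, of size at most `size`, of the parameterized problem with
yes-instances `Q`, parameter `param` and instances written as words by `enc`, into the
(unparameterized) problem `R`. -/
def IsPolyTimeCompression {α : Type} (enc : α → List Bool) (param : α → ℕ) (Q : Set α)
    (R : Language Bool) (size : ℕ → ℕ) (f : α → List Bool) : Prop :=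
  Nonempty (Turing.TM2ComputableInPolyTime enc (id : List Bool → List Bool) f) ∧
  ∀ a : α, (a ∈ Q ↔ f a ∈ R) ∧ (f a).length ≤ size (param a)

end EdgeDeletion

namespace EdgeDeletion

open Turing

/-! ### Programs acting on a single tape by passes of a transducer -/

/-! Call claws and diamonds obstacles. Greedily collect into a set X the vertices of obstacles that
have no edge inside the current X. A solution deletes an edge of each collected obstacle, and these
edges are distinct. So if some obstacle has no edge in X after k + 1 rounds, then k deletions do not
suffice, not even on X alone (`le_card_of_greedy`). Otherwise |X| ≤ 4(k + 1) and `Meets` holds. Away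
from X the graph then behaves like an obstacle-free one: the common neighbors outside X of two
adjacent vertices not both in X form a clique, and no vertex outside X has three pairwise
nonadjacent neighbors outside X.

An edge not inside X with at least 2k + 2 common neighbors outside X is never deleted by a small
solution: two common neighbors that the solution does not touch would form a diamond with its ends
(`Meets.common_le_of_mem`). Relevant deletions therefore spread from X along light edges only, and a
vertex has O(k) light neighbors outside X. Let S be X together with two such layers, so |S| =
O(k^3). Every solution contains one that lives in S (`Meets.exists_solution_near`): keep the
deletions in cliques attached to X, and those by which a vertex of the first expansion loses a whole
clique. Restoring the others creates no diamond (`Meets.trim_not_diamond`) and no claw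
(`Meets.trim_not_claw`).

Once deletions are confined to S, a remaining obstacle has at least two vertices in S. The other two
matter only through their adjacencies, and through their identity if they lie in S, so for each pair
in S it is enough to keep one pair of vertices of each type (`exists_kept_tuple`,
`Meets.free_of_keptSet`). There are O(|S|^3) types, hence O(k^9) kept vertices and O(k^18) bits,
well within the bounds claimed.

For the complexity part, the compression and the verifier are described by first-order formulas with
arithmetic and counting over the positions of the input word. A fixed formula is evaluated in
polynomial time by moving marks along a tape (`evaluable`, `executable`), and such tape programs
become stack machines (`computableInPolyTime_of_exec`). The classes `Dfn` and `Trm` let instance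
search assemble the formulas, and `Reach` computes the needed sets in turn: core, layers, kept
vertices, output word. For membership in NP the certificate marks the deleted edges in the adjacency
matrix. -/

/-- Programs on a tape with cells in `C` and a finite memory `V`. -/
inductive TapeProg (V C : Type)
  /-- run a transducer along the tape -/
  | pass (δ : V → C → V × C)
  /-- change the memory -/
  | load (g : V → V)
  /-- sequential composition -/
  | seq (P Q : TapeProg V C)
  /-- repeat while a test on the memory succeeds -/
  | whil (b : V → Bool) (P : TapeProg V C)

namespace TapeProg

variable {V C : Type}

/-- The result of running a transducer along a tape. -/
def scan (δ : V → C → V × C) : V → List C → V × List C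
  | v, [] => (v, [])
  | v, c :: T => ((scan δ (δ v c).1 T).1, (δ v c).2 :: (scan δ (δ v c).1 T).2)

theorem scan_length (δ : V → C → V × C) (v : V) (T : List C) :
    (scan δ v T).2.length = T.length := by
  induction T generalizing v with
  | nil => rfl
  | cons c T ih => simp [scan, ih]

theorem scan_id (v : V) (T : List C) : scan (fun v c => (v, c)) v T = (v, T) := by
  induction T with
  | nil => rfl
  | cons c T ih => simp [scan, ih]

/-- `Exec P s t s'`: started in `s`, the program `P` ends in `s'` after `t` steps. -/
inductive Exec : TapeProg V C → V × List C → ℕ → V × List C → Prop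
  | pass (δ v T) : Exec (.pass δ) (v, T) (2 * T.length + 2) (scan δ v T)
  | load (g v T) : Exec (.load g) (v, T) 1 (g v, T)
  | seq {P Q s s' s'' t u} : Exec P s t s' → Exec Q s' u s'' → Exec (.seq P Q) s (t + u) s''
  | finish {b P s} : b s.1 = false → Exec (.whil b P) s 1 s
  | iter {b P s s' s'' t u} : b s.1 = true → Exec P s t s' → Exec (.whil b P) s' u s'' →
      Exec (.whil b P) s (1 + (t + u)) s''

theorem Exec.length_eq {P : TapeProg V C} {s s' : V × List C} {t : ℕ} (h : Exec P s t s') :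
    s'.2.length = s.2.length := by
  induction h with
  | pass δ v T => exact scan_length δ v T
  | load => rfl
  | seq _ _ ih₁ ih₂ => rw [ih₂, ih₁]
  | finish => rfl
  | iter _ _ _ ih₁ ih₂ => rw [ih₂, ih₁]

/-- The labels of the code of a program. -/
abbrev Lab : TapeProg V C → Type
  | .pass _ => Bool
  | .load _ => Unit
  | .seq P Q => P.Lab ⊕ Q.Lab
  | .whil _ P => Option P.Lab

/-- The program has finitely many labels. -/
abbrev labFintype : (P : TapeProg V C) → Fintype P.Lab
  | .pass _ => inferInstanceAs (Fintype Bool)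
  | .load _ => inferInstanceAs (Fintype Unit)
  | .seq P Q => @instFintypeSum _ _ P.labFintype Q.labFintype
  | .whil _ P => @instFintypeOption _ P.labFintype

/-- The label where the execution starts. -/
def entry : (P : TapeProg V C) → P.Lab
  | .pass _ => false
  | .load _ => ()
  | .seq P _ => Sum.inl P.entry
  | .whil _ _ => none

end TapeProg

/-- The stacks of the machines below. -/
inductive Stk
  | inp
  | main
  | aux
  | out
  deriving DecidableEq

instance : Fintype Stk := ⟨{.inp, .main, .aux, .out}, fun k => by cases k <;> simp⟩

/-- The stack alphabets. -/
abbrev StkAlph (α C : Type) : Stk → Type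
  | .inp => α
  | .main => C
  | .aux => C
  | .out => Bool

/-- Four lists as the contents of the stacks. -/
def stks {α C : Type} (i : List α) (A B : List C) (o : List Bool) : ∀ k, List (StkAlph α C k)
  | .inp => i
  | .main => A
  | .aux => B
  | .out => o

section stks

variable {α C : Type} (i i' : List α) (A A' B B' : List C) (o o' : List Bool)

@[simp] theorem update_stks_inp :
    Function.update (stks i A B o) Stk.inp i' = stks i' A B o := by
  funext k; cases k <;> rfl

@[simp] theorem update_stks_main :
    Function.update (stks i A B o) Stk.main A' = stks i A' B o := by
  funext k; cases k <;> rfl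

@[simp] theorem update_stks_aux :
    Function.update (stks i A B o) Stk.aux B' = stks i A B' o := by
  funext k; cases k <;> rfl

@[simp] theorem update_stks_out :
    Function.update (stks i A B o) Stk.out o' = stks i A B o' := by
  funext k; cases k <;> rfl

@[simp] theorem stks_inp : stks i A B o .inp = i := rfl
@[simp] theorem stks_main : stks i A B o .main = A := rfl
@[simp] theorem stks_aux : stks i A B o .aux = B := rfl
@[simp] theorem stks_out : stks i A B o .out = o := rfl

end stks

/-- Statements of the machines below: the internal state holds the memory and at most one cell. -/
abbrev StkStmt (α V C Λ : Type) : Type := TM2.Stmt (StkAlph α C) Λ (V × Option C)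

/-- Configurations of the machines below. -/
abbrev StkCfg (α V C Λ : Type) : Type := TM2.Cfg (StkAlph α C) Λ (V × Option C)

/-- `Runs M t c c'`: the machine gets from `c` to `c'` in `t` steps. -/
inductive Runs {α V C Λ : Type} (M : Λ → StkStmt α V C Λ) :
    ℕ → StkCfg α V C Λ → StkCfg α V C Λ → Prop
  | refl (c) : Runs M 0 c c
  | head {l v S c n} : Runs M n (TM2.stepAux (M l) v S) c → Runs M (n + 1) ⟨some l, v, S⟩ c

namespace Runs

variable {α V C Λ : Type} {M : Λ → StkStmt α V C Λ} {c c' c'' : StkCfg α V C Λ} {m n : ℕ}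

theorem trans (h : Runs M m c c') (h' : Runs M n c' c'') : Runs M (m + n) c c'' := by
  induction h with
  | refl => simpa using h'
  | head _ ih => rw [Nat.add_right_comm]; exact .head (ih h')

theorem cast (h : Runs M m c c') (e : m = n) : Runs M n c c' := e ▸ h

theorem iterate (h : Runs M n c c') :
    (flip bind (TM2.step M))^[n] (some c) = some c' := by
  induction h with
  | refl => rfl
  | head _ ih => rw [Function.iterate_succ_apply]; exact ih

end Runs

namespace TapeProg

variable {α V C Λ : Type} [Inhabited C]

open TM2.Stmt (push pop branch goto halt) in
/-- Move the cells from one stack to the other, transformed by `δ`, then go to `next`. -/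
def fwdStmt (δ : V → C → V × C) (self next : Λ) : StkStmt α V C Λ :=
  pop .main (fun s c => (s.1, c)) <|
    branch (fun s => s.2.isSome)
      (push .aux (fun s => (δ s.1 (s.2.getD default)).2) <|
        TM2.Stmt.load (fun s => ((δ s.1 (s.2.getD default)).1, s.2)) <| goto fun _ => self)
      (goto fun _ => next)

open TM2.Stmt (push pop branch goto halt) in
/-- Move the cells back, then go to `next`. -/
def backStmt (self next : Λ) : StkStmt α V C Λ :=
  pop .aux (fun s c => (s.1, c)) <|
    branch (fun s => s.2.isSome)
      (push .main (fun s => s.2.getD default) <| goto fun _ => self)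
      (goto fun _ => next)

open TM2.Stmt (push pop branch goto halt) in
/-- The code of a program, embedded into a machine with labels `Λ`. -/
def code : (P : TapeProg V C) → (P.Lab → Λ) → Λ → P.Lab → StkStmt α V C Λ
  | .pass δ, emb, _, false => fwdStmt δ (emb false) (emb true)
  | .pass _, emb, exit, true => backStmt (emb true) exit
  | .load g, _, exit, _ => TM2.Stmt.load (fun s => (g s.1, s.2)) <| goto fun _ => exit
  | .seq P Q, emb, _, .inl l =>
    P.code (fun x => emb (.inl x)) (emb (.inr Q.entry)) l
  | .seq _ Q, emb, exit, .inr l => Q.code (fun x => emb (.inr x)) exit l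
  | .whil b P, emb, exit, none =>
    branch (fun s => b s.1) (goto fun _ => emb (some P.entry)) (goto fun _ => exit)
  | .whil _ P, emb, _, some l => P.code (fun x => emb (some x)) (emb none) l

variable {M : Λ → StkStmt α V C Λ}

theorem runs_fwd {δ : V → C → V × C} {self next : Λ} (h : M self = fwdStmt δ self next)
    (i : List α) (o : List Bool) (T B : List C) (v : V) (x : Option C) :
    Runs M (T.length + 1) ⟨some self, (v, x), stks i T B o⟩
      ⟨some next, ((scan δ v T).1, none), stks i [] ((scan δ v T).2.reverse ++ B) o⟩ := by
  induction T generalizing v x B with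
  | nil =>
    refine .head ?_
    rw [h]
    simpa [fwdStmt, TM2.stepAux, scan] using Runs.refl (M := M) _
  | cons c T ih =>
    refine .head ?_
    rw [h]
    have := ih ((δ v c).2 :: B) (δ v c).1 (some c)
    simpa [fwdStmt, TM2.stepAux, scan] using this

theorem runs_back {self next : Λ} (h : M self = backStmt self next)
    (i : List α) (o : List Bool) (A B : List C) (v : V) (x : Option C) :
    Runs M (B.length + 1) ⟨some self, (v, x), stks i A B o⟩
      ⟨some next, (v, none), stks i (B.reverse ++ A) [] o⟩ := by
  induction B generalizing x A with
  | nil =>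
    refine .head ?_
    rw [h]
    simpa [backStmt, TM2.stepAux] using Runs.refl (M := M) _
  | cons c B ih =>
    refine .head ?_
    rw [h]
    have := ih (c :: A) (some c)
    simpa [backStmt, TM2.stepAux] using this

/-- Between two pieces of code the auxiliary stack and the cell buffer are empty, which makes the
pieces composable. The exit label is generalized because a subprogram exits into the code that
surrounds it. -/
theorem Exec.runs {P : TapeProg V C} {s s' : V × List C} {t : ℕ} (h : Exec P s t s')
    {emb : P.Lab → Λ} {exit : Λ} (hM : ∀ l, M (emb l) = P.code emb exit l)
    (i : List α) (o : List Bool) :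
    Runs M t ⟨some (emb P.entry), (s.1, none), stks i s.2 [] o⟩
      ⟨some exit, (s'.1, none), stks i s'.2 [] o⟩ := by
  induction h generalizing exit with
  | pass δ v T =>
    have h₁ := runs_fwd (hM false) i o T [] v none
    have h₂ := runs_back (hM true) i o [] ((scan δ v T).2.reverse ++ []) (scan δ v T).1 none
    refine ((h₁.trans h₂).cast ?_).trans ?_ (n := 0)
    · simp [scan_length]; omega
    · simpa using Runs.refl (M := M) _
  | load g v T =>
    refine .head ?_
    rw [hM]
    exact Runs.refl _
  | @seq P Q s s' s'' t u _ _ ih₁ ih₂ =>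
    exact (ih₁ (emb := fun x => emb (.inl x)) (fun l => hM (.inl l))).trans
      (ih₂ (emb := fun x => emb (.inr x)) (fun l => hM (.inr l)))
  | @finish b P s hb =>
    refine .head ?_
    rw [show emb (TapeProg.whil b P).entry = emb none from rfl, hM]
    simp only [code, TM2.stepAux, hb]
    exact Runs.refl _
  | @iter b P s s' s'' t u hb _ _ ih₁ ih₂ =>
    rw [Nat.add_comm]
    refine .head ?_
    rw [show emb (TapeProg.whil b P).entry = emb none from rfl, hM]
    simp only [code, TM2.stepAux, hb]
    exact (ih₁ (emb := fun x => emb (some x)) (fun l => hM (some l))).trans (ih₂ hM)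

/-! ### The machine of a program -/

open TM2.Stmt (push pop branch goto halt) in
/-- The code around a program: it fills the tape and reads off the output. -/
def shell (P : TapeProg V C) (v₀ : V) (cell : α → C) (pad : C) (len bit : C → Bool) :
    P.Lab ⊕ Fin 4 → StkStmt α V C (P.Lab ⊕ Fin 4)
  | .inl l => P.code Sum.inl (.inr 2) l
  | .inr 0 =>
    pop .inp (fun s a => (s.1, a.map cell)) <|
      branch (fun s => s.2.isSome)
        (push .aux (fun s => s.2.getD default) <| push .main (fun _ => pad) <|
          goto fun _ => .inr 0)
        (push .main (fun _ => pad) <| push .main (fun _ => pad) <| goto fun _ => .inr 1)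
  | .inr 1 => backStmt (.inr 1) (.inl P.entry)
  | .inr 2 => fwdStmt (fun v c => (v, c)) (.inr 2) (.inr 3)
  | .inr 3 =>
    pop .aux (fun s c => (s.1, c)) <|
      branch (fun s => s.2.isSome)
        (branch (fun s => len (s.2.getD default))
          (push .out (fun s => bit (s.2.getD default)) <| goto fun _ => .inr 3)
          (goto fun _ => .inr 3))
        (TM2.Stmt.load (fun _ => (v₀, none)) halt)

variable (P : TapeProg V C) (v₀ : V) (cell : α → C) (pad : C) (len bit : C → Bool)

/-- Each letter goes to the auxiliary stack and one blank to the main stack, so moving the letters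
back on top leaves the word followed by its padding. The end of the input contributes the two extra
blanks. -/
theorem runs_input (o : List Bool) (w : List α) (A B : List C) (v : V) (x : Option C) :
    Runs (shell P v₀ cell pad len bit) (w.length + 1) ⟨some (.inr 0), (v, x), stks w A B o⟩
      ⟨some (.inr 1), (v, none),
        stks [] (List.replicate (w.length + 2) pad ++ A) ((w.map cell).reverse ++ B) o⟩ := by
  induction w generalizing x A B with
  | nil =>
    refine .head ?_
    simpa [shell, TM2.stepAux] using Runs.refl (M := shell P v₀ cell pad len bit) _
  | cons a w ih =>
    refine .head ?_
    have := ih (pad :: A) (cell a :: B) (some (cell a))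
    rw [show List.replicate (w.length + 2) pad ++ pad :: A
      = List.replicate ((a :: w).length + 2) pad ++ A by
        rw [List.length_cons, Nat.add_right_comm, List.replicate_succ' (n := w.length + 2),
          List.append_assoc]; rfl] at this
    simpa [shell, TM2.stepAux] using this

/-- The auxiliary stack holds the tape reversed, so the last letter is pushed first and the output
stack ends up in reading order. -/
theorem runs_output (i : List α) (B : List C) (o : List Bool) (v : V) (x : Option C) :
    Runs (shell P v₀ cell pad len bit) (B.length + 1) ⟨some (.inr 3), (v, x), stks i [] B o⟩
      ⟨none, (v₀, none), stks i [] [] (((B.reverse).filter len).map bit ++ o)⟩ := by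
  induction B generalizing x o with
  | nil =>
    refine .head ?_
    simpa [shell, TM2.stepAux] using Runs.refl (M := shell P v₀ cell pad len bit) _
  | cons c B ih =>
    refine .head ?_
    cases hc : len c with
    | true =>
      have := ih (bit c :: o) (some c)
      simpa [shell, TM2.stepAux, hc, List.filter_append] using this
    | false =>
      have := ih o (some c)
      simpa [shell, TM2.stepAux, hc, List.filter_append] using this

theorem runs_shell {w : List α} {v' : V} {T' : List C} {t : ℕ}
    (h : Exec P (v₀, w.map cell ++ List.replicate (w.length + 2) pad) t (v', T')) :
    Runs (shell P v₀ cell pad len bit) (6 * w.length + 8 + t)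
      ⟨some (.inr 0), (v₀, none), stks w [] [] []⟩
      ⟨none, (v₀, none), stks [] [] [] ((T'.filter len).map bit)⟩ := by
  have hl : T'.length = 2 * w.length + 2 := by
    have := h.length_eq
    simp at this
    omega
  have h₁ := runs_input P v₀ cell pad len bit [] w [] [] v₀ none
  have h₂ := runs_back (M := shell P v₀ cell pad len bit) (self := .inr 1) rfl [] []
    (List.replicate (w.length + 2) pad ++ []) ((w.map cell).reverse ++ []) v₀ none
  have h₃ := h.runs (M := shell P v₀ cell pad len bit) (emb := .inl) (exit := .inr 2)
    (fun _ => rfl) [] []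
  have h₄ := runs_fwd (M := shell P v₀ cell pad len bit) (self := .inr 2) rfl [] [] T' [] v' none
  rw [scan_id] at h₄
  have h₅ := runs_output P v₀ cell pad len bit [] (T'.reverse ++ []) [] v' none
  simp only [List.append_nil, List.reverse_reverse] at h₁ h₂ h₃ h₄ h₅
  refine ((((h₁.trans h₂).trans h₃).trans h₄).trans h₅).cast ?_
  simp [hl]; omega

end TapeProg

/-- The machine of a tape program. -/
def machine {α V C : Type} [Fintype α] [Fintype V] [Fintype C] [Inhabited C] (P : TapeProg V C)
    (v₀ : V) (cell : α → C) (pad : C) (len bit : C → Bool) : FinTM2 :=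
  have := P.labFintype
  { K := Stk
    k₀ := .inp
    k₁ := .out
    Γ := StkAlph α C
    Λ := P.Lab ⊕ Fin 4
    main := .inr 0
    σ := V × Option C
    initialState := (v₀, none)
    Γk₀Fin := inferInstanceAs (Fintype α)
    m := P.shell v₀ cell pad len bit }

section machine

variable {α V C : Type} [Fintype α] [Fintype V] [Fintype C] [Inhabited C] (P : TapeProg V C)
    (v₀ : V) (cell : α → C) (pad : C) (len bit : C → Bool)

theorem initList_machine (w : List α) :
    initList (machine P v₀ cell pad len bit) w =
      (⟨some (.inr 0), (v₀, none), stks w [] [] []⟩ : StkCfg α V C (P.Lab ⊕ Fin 4)) := by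
  refine congrArg (fun S => (⟨some (.inr 0), (v₀, none), S⟩ : StkCfg α V C (P.Lab ⊕ Fin 4)))
    (funext fun k => ?_)
  cases k <;> rfl

theorem haltList_machine (w : List Bool) :
    haltList (machine P v₀ cell pad len bit) w =
      (⟨none, (v₀, none), stks [] [] [] w⟩ : StkCfg α V C (P.Lab ⊕ Fin 4)) := by
  refine congrArg (fun S => (⟨none, (v₀, none), S⟩ : StkCfg α V C (P.Lab ⊕ Fin 4)))
    (funext fun k => ?_)
  cases k <;> rfl

end machine

open TapeProg in
/-- A function computed by a tape program in polynomial time is computed by a Turing machine in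
polynomial time. -/
theorem computableInPolyTime_of_exec {α V C X Y : Type} [Fintype α] [Fintype V] [Fintype C]
    [Inhabited C] {ea : X → List α} {eb : Y → List Bool} {g : X → Y} (P : TapeProg V C) (v₀ : V)
    (cell : α → C) (pad : C) (len bit : C → Bool) (q : Polynomial ℕ)
    (h : ∀ x, ∃ v' T' t,
      Exec P (v₀, (ea x).map cell ++ List.replicate ((ea x).length + 2) pad) t (v', T') ∧
      t ≤ q.eval (ea x).length ∧ (T'.filter len).map bit = eb (g x)) :
    Nonempty (TM2ComputableInPolyTime ea eb g) := by
  refine ⟨{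
    tm := machine P v₀ cell pad len bit
    inputAlphabet := Equiv.refl α
    outputAlphabet := Equiv.refl Bool
    -- Reading the input and moving it back cost |w| + 1 steps each; moving the final tape of length
    -- 2|w| + 2 and emitting the output cost 2|w| + 3 each.
    time := 6 * Polynomial.X + 8 + q
    outputsFun := fun x => Classical.choice ?_ }⟩
  obtain ⟨v', T', t, hE, ht, ho⟩ := h x
  have hr := (runs_shell P v₀ cell pad len bit hE).iterate
  refine ⟨⟨⟨6 * (ea x).length + 8 + t, ?_⟩, ?_⟩⟩
  · rw [ho, ← initList_machine, ← haltList_machine] at hr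
    have e₁ : List.map (Equiv.refl α).invFun (ea x) = ea x := List.map_id _
    have e₂ : List.map (Equiv.refl Bool).invFun (eb (g x)) = eb (g x) := List.map_id _
    simp only [Option.map_some]
    erw [e₁, e₂]
    exact hr
  · simpa using ht

end EdgeDeletion

namespace EdgeDeletion

/-! ### Tapes with numbered registers

A cell has one bit for each of `m` registers; registers are named by natural numbers. -/

/-- The first `m` values of `f`. -/
def vec (m : ℕ) (f : ℕ → Bool) : Fin m → Bool := fun j => f j

/-- The bit of register `i`. -/
def rd {m : ℕ} (c : Fin m → Bool) (i : ℕ) : Bool := if h : i < m then c ⟨i, h⟩ else false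

/-- Overwrite the bit of register `i`. -/
def wr {m : ℕ} (c : Fin m → Bool) (i : ℕ) (x : Bool) : Fin m → Bool :=
  fun j => if j.1 = i then x else c j

/-- The tape of length `N` whose register `j` holds the set `b j`. -/
def tape (m N : ℕ) (b : ℕ → ℕ → Bool) : List (Fin m → Bool) :=
  (List.range N).map fun p => vec m fun j => b j p

theorem rd_vec {m i : ℕ} (h : i < m) (f : ℕ → Bool) : rd (vec m f) i = f i := by
  simp [rd, vec, h]

theorem wr_vec (m i : ℕ) (f : ℕ → Bool) (x : Bool) :
    wr (vec m f) i x = vec m (Function.update f i x) := by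
  funext j; simp [wr, vec, Function.update_apply]

theorem wr_vec_cell (m i p : ℕ) (b : ℕ → ℕ → Bool) (y : ℕ → Bool) :
    wr (vec m fun j => b j p) i (y p) = vec m fun j => Function.update b i y j p := by
  funext j
  by_cases h : j.1 = i
  · simp [wr, vec, h]
  · simp [wr, vec, h]

@[simp] theorem tape_length (m N : ℕ) (b : ℕ → ℕ → Bool) : (tape m N b).length = N := by
  simp [tape]

open TapeProg

/-- Tape programs with `m` registers, both in the memory and on the tape. -/
abbrev RegProg (m : ℕ) : Type := TapeProg (Fin m → Bool) (Fin m → Bool)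

/-- Started with memory `f` and tape `b`, the program ends within `τ` steps in a state that
satisfies `Q`. -/
def Does (m N : ℕ) (P : RegProg m) (τ : ℕ) (f : ℕ → Bool) (b : ℕ → ℕ → Bool)
    (Q : (ℕ → Bool) → (ℕ → ℕ → Bool) → Prop) : Prop :=
  ∃ f' b' t, t ≤ τ ∧ Exec P (vec m f, tape m N b) t (vec m f', tape m N b') ∧ Q f' b'

section Does

variable {m N : ℕ} {P P' : RegProg m} {τ τ' : ℕ} {f : ℕ → Bool} {b : ℕ → ℕ → Bool}
  {Q Q' : (ℕ → Bool) → (ℕ → ℕ → Bool) → Prop}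

theorem Does.mono (h : Does m N P τ f b Q) (hτ : τ ≤ τ') (hQ : ∀ f' b', Q f' b' → Q' f' b') :
    Does m N P τ' f b Q' := by
  obtain ⟨f', b', t, ht, hE, h⟩ := h
  exact ⟨f', b', t, ht.trans hτ, hE, hQ _ _ h⟩

theorem Does.seq (h : Does m N P τ f b Q) (h' : ∀ f' b', Q f' b' → Does m N P' τ' f' b' Q') :
    Does m N (.seq P P') (τ + τ') f b Q' := by
  obtain ⟨f', b', t, ht, hE, h⟩ := h
  obtain ⟨f'', b'', u, hu, hE', h''⟩ := h' _ _ h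
  exact ⟨f'', b'', t + u, add_le_add ht hu, hE.seq hE', h''⟩

/-- Set a bit of the memory. -/
def setFlag (m e : ℕ) (g : (Fin m → Bool) → Bool) : RegProg m := .load fun v => wr v e (g v)

theorem does_setFlag (e : ℕ) (g : (Fin m → Bool) → Bool)
    (h : Q (Function.update f e (g (vec m f))) b) : Does m N (setFlag m e g) 1 f b Q := by
  refine ⟨_, _, 1, le_rfl, ?_, h⟩
  rw [← wr_vec]
  exact .load _ _ _

/-- Set a bit of the memory if two registers of the tape meet. -/
def meetPass (m e r s : ℕ) : RegProg m :=
  .pass fun v c => (wr v e (rd v e || (rd c r && rd c s)), c)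

theorem scan_meet {e r s : ℕ} (he : e < m) (hr : r < m) (hs : s < m) (f : ℕ → Bool)
    (l : List ℕ) :
    scan (fun v c => (wr v e (rd v e || (rd c r && rd c s)), c)) (vec m f)
      (l.map fun p => vec m fun j => b j p) =
    (vec m (Function.update f e (f e || l.any fun p => b r p && b s p)),
      l.map fun p => vec m fun j => b j p) := by
  induction l generalizing f with
  | nil => simp [scan]
  | cons p l ih => simp [scan, rd_vec, he, hr, hs, wr_vec, ih, Bool.or_assoc]

theorem does_meetPass {e r s : ℕ} (he : e < m) (hr : r < m) (hs : s < m)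
    (h : ∀ x : Bool, (x = true ↔ f e = true ∨ ∃ p < N, b r p = true ∧ b s p = true) →
      Q (Function.update f e x) b) : Does m N (meetPass m e r s) (2 * N + 2) f b Q := by
  refine ⟨_, _, 2 * N + 2, le_rfl, ?_, h (f e || (List.range N).any fun p => b r p && b s p) ?_⟩
  · have := Exec.pass (fun v c => (wr v e (rd v e || (rd c r && rd c s)), c)) (vec m f)
      (tape m N b)
    rw [tape_length, tape, scan_meet he hr hs] at this
    exact this
  · simp

/-- Overwrite a register of the tape cell by cell. -/
def mapPass (m r : ℕ) (g : (Fin m → Bool) → (Fin m → Bool) → Bool) : RegProg m :=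
  .pass fun v c => (v, wr c r (g v c))

theorem does_mapPass (r : ℕ) (g : (Fin m → Bool) → (Fin m → Bool) → Bool)
    (h : Q f (Function.update b r fun p => g (vec m f) (vec m fun j => b j p))) :
    Does m N (mapPass m r g) (2 * N + 2) f b Q := by
  refine ⟨_, _, 2 * N + 2, le_rfl, ?_, h⟩
  have := Exec.pass (fun v c => (v, wr c r (g v c))) (vec m f) (tape m N b)
  have e : scan (fun v c => (v, wr c r (g v c))) (vec m f) (tape m N b) =
      (vec m f, tape m N (Function.update b r fun p => g (vec m f) (vec m fun j => b j p))) := by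
    unfold tape
    induction List.range N with
    | nil => rfl
    | cons p l ih =>
      simp only [List.map_cons, scan, ih]
      congr 2
      exact wr_vec_cell m r p b fun p => g (vec m f) (vec m fun j => b j p)
  rw [tape_length, e] at this
  exact this

/-- Shift a register of the tape by one cell if the memory satisfies `cond`; the bit `0` of the
memory is shifted in, and receives the bit that is shifted out. -/
def shiftPass (m r : ℕ) (cond : (Fin m → Bool) → Bool) : RegProg m :=
  .pass fun v c => if cond v then (wr v 0 (rd c r), wr c r (rd v 0)) else (v, c)

/-- The pass overwrites bit 0 at every cell, so `hc` demands that the condition ignore this bit; the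
decision to shift is then the same along the whole tape. -/
theorem scan_shift_true {r : ℕ} {cond : (Fin m → Bool) → Bool} (hm : 0 < m) (hr : r < m)
    (hc : ∀ f x, cond (vec m (Function.update f 0 x)) = cond (vec m f)) (n : ℕ) (f : ℕ → Bool)
    (k : ℕ) (h : cond (vec m f) = true) :
    scan (fun v c => if cond v then (wr v 0 (rd c r), wr c r (rd v 0)) else (v, c)) (vec m f)
      ((List.range' k n).map fun p => vec m fun j => b j p) =
    (vec m (Function.update f 0 (if n = 0 then f 0 else b r (k + n - 1))),
      (List.range' k n).map fun p => vec m fun j =>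
        Function.update b r (fun p => if p = k then f 0 else b r (p - 1)) j p) := by
  induction n generalizing f k with
  | zero => simp [scan]
  | succ n ih =>
    have h' : cond (vec m (Function.update f 0 (b r k))) = true := by rw [hc, h]
    simp only [List.range'_succ, List.map_cons, scan, h, if_true, rd_vec hm, rd_vec hr, wr_vec]
    rw [ih _ _ h']
    refine Prod.ext ?_ ?_
    · simp only [Function.update_self, Function.update_idem]
      congr 2
      rcases n with - | n
      · simp
      · simp only [Nat.add_eq_zero_iff, one_ne_zero, and_false, if_false]
        congr 1; omega
    · simp only [Function.update_self]
      congr 1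
      · rw [← wr_vec_cell]
        simp [wr_vec]
      · refine List.map_congr_left fun p hp => ?_
        rw [List.mem_range'_1] at hp
        rw [← wr_vec_cell, ← wr_vec_cell]
        congr 1
        have : p ≠ k := by omega
        by_cases hp' : p = k + 1
        · simp [hp']
        · simp [hp', this]

theorem scan_shift_false {r : ℕ} {cond : (Fin m → Bool) → Bool} {v : Fin m → Bool}
    (h : cond v = false) (T : List (Fin m → Bool)) :
    scan (fun v c => if cond v then (wr v 0 (rd c r), wr c r (rd v 0)) else (v, c)) v T
      = (v, T) := by
  induction T with
  | nil => rfl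
  | cons c T ih => simp [scan, h, ih]

theorem does_shiftPass_true {r : ℕ} {cond : (Fin m → Bool) → Bool} (hm : 0 < m) (hr : r < m)
    (hc : ∀ f x, cond (vec m (Function.update f 0 x)) = cond (vec m f))
    (ht : cond (vec m f) = true)
    (h : Q (Function.update f 0 (if N = 0 then f 0 else b r (N - 1)))
      (Function.update b r fun p => if p = 0 then f 0 else b r (p - 1))) :
    Does m N (shiftPass m r cond) (2 * N + 2) f b Q := by
  refine ⟨_, _, 2 * N + 2, le_rfl, ?_, h⟩
  have := Exec.pass (fun v c => if cond v then (wr v 0 (rd c r), wr c r (rd v 0)) else (v, c))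
    (vec m f) (tape m N b)
  have e := scan_shift_true (b := b) hm hr hc N f 0 ht
  rw [Nat.zero_add, ← List.range_eq_range'] at e
  rw [tape_length, tape, e] at this
  exact this

theorem does_shiftPass_false {r : ℕ} {cond : (Fin m → Bool) → Bool}
    (ht : cond (vec m f) = false) (h : Q f b) :
    Does m N (shiftPass m r cond) (2 * N + 2) f b Q := by
  refine ⟨_, _, 2 * N + 2, le_rfl, ?_, h⟩
  have := Exec.pass (fun v c => if cond v then (wr v 0 (rd c r), wr c r (rd v 0)) else (v, c))
    (vec m f) (tape m N b)
  rwa [tape_length, scan_shift_false ht] at this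

/-- The register `r` marks the position `v` (none if `v ≥ N`). -/
def Marks (N : ℕ) (b : ℕ → ℕ → Bool) (r v : ℕ) : Prop := ∀ p < N, (b r p = true ↔ p = v)

theorem Marks.shift {r v : ℕ} (h : Marks N b r v) :
    Marks N (Function.update b r fun p => if p = 0 then false else b r (p - 1)) r (v + 1) := by
  intro p hp
  rcases p with - | p
  · simp
  · simp [h p (by omega)]

theorem marks_congr {b' : ℕ → ℕ → Bool} {r v : ℕ} (h : Marks N b r v)
    (e : ∀ p < N, b' r p = b r p) : Marks N b' r v := fun p hp => by rw [e p hp, h p hp]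

/-- Run `body` with the mark of register `r` at `0, 1, …, N - 1`. -/
def forProg (m r : ℕ) (body : RegProg m) : RegProg m :=
  .seq (setFlag m 0 fun _ => true) <| .seq (shiftPass m r fun _ => true) <|
    .whil (fun v => !rd v 0) <| .seq body <| .seq (setFlag m 0 fun _ => false)
      (shiftPass m r fun _ => true)

/-- The mark is its own loop counter: a single one is shifted in, advances by one cell per round,
and drops into bit 0 after N rounds, which stops the loop. The invariant must therefore not depend
on bit 0 or on register `r`. -/
theorem does_forProg {r : ℕ} {body : RegProg m} (hm : 0 < m) (hr : r < m)
    (I : ℕ → (ℕ → Bool) → (ℕ → ℕ → Bool) → Prop)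
    (hI : ∀ v f b x y, I v f b → I v (Function.update f 0 x) (Function.update b r y))
    (hbody : ∀ v < N, ∀ f b, I v f b → Marks N b r v →
      Does m N body τ f b fun f' b' => I (v + 1) f' b' ∧ Marks N b' r v)
    (h₀ : I 0 f b) (hoff : ∀ p < N, b r p = false) :
    Does m N (forProg m r body) (N * (τ + 2 * N + 4) + 2 * N + 4) f b
      fun f' b' => I N f' b' ∧ ∀ p < N, b' r p = false := by
  have key : ∀ k v, v + k = N → ∀ f b, I v f b → Marks N b r v →
      (f 0 = true ↔ v = N) →
      Does m N (.whil (fun v => !rd v 0) <| .seq body <| .seq (setFlag m 0 fun _ => false)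
        (shiftPass m r fun _ => true)) (k * (τ + 2 * N + 4) + 1) f b
        fun f' b' => I N f' b' ∧ ∀ p < N, b' r p = false := by
    intro k
    induction k with
    | zero =>
      intro v hv f b h hmk hf
      have hv : v = N := by omega
      subst hv
      refine ⟨f, b, 1, by omega, .finish ?_, h, fun p hp => ?_⟩
      · simp [rd_vec hm, hf.2 rfl]
      · simpa [hp.ne] using hmk p hp
    | succ k ih =>
      intro v hv f b h hmk hf
      have hf0 : f 0 = false := by
        rw [← Bool.not_eq_true, hf]; omega
      have hstep : Does m N (.seq body <| .seq (setFlag m 0 fun _ => false)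
          (shiftPass m r fun _ => true)) (τ + (1 + (2 * N + 2))) f b
          fun f' b' => I (v + 1) f' b' ∧ Marks N b' r (v + 1) ∧ (f' 0 = true ↔ v + 1 = N) := by
        refine (hbody v (by omega) f b h hmk).seq fun f' b' h' => ?_
        refine Does.seq (Q := fun f'' b'' => I (v + 1) f'' b'' ∧ Marks N b'' r v ∧ f'' 0 = false)
          (does_setFlag _ _ ⟨?_, h'.2, by simp⟩) ?_
        · simpa using hI _ _ _ false (b' r) h'.1
        · rintro f'' b'' ⟨h₁, h₂, h₃⟩
          refine does_shiftPass_true hm hr (fun _ _ => rfl) rfl ⟨hI _ _ _ _ _ h₁, ?_, ?_⟩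
          · rw [h₃]; exact h₂.shift
          · have hN : N ≠ 0 := by omega
            simp only [Function.update_self, if_neg hN]
            rw [h₂ (N - 1) (by omega)]
            omega
      obtain ⟨f', b', t, ht, hE, h₁, h₂, h₃⟩ := hstep
      obtain ⟨f'', b'', u, hu, hE', h'⟩ := ih (v + 1) (by omega) f' b' h₁ h₂ h₃
      refine ⟨f'', b'', _, ?_, .iter ?_ hE hE', h'⟩
      · rw [Nat.succ_mul]; omega
      · simp [rd_vec hm, hf0]
  have h₁ : Does m N (forProg m r body)
      (1 + ((2 * N + 2) + (N * (τ + 2 * N + 4) + 1))) f b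
      fun f' b' => I N f' b' ∧ ∀ p < N, b' r p = false := by
    refine Does.seq (Q := fun f' b' => I 0 f' b' ∧ (∀ p < N, b' r p = false) ∧ f' 0 = true)
      (does_setFlag _ _ ⟨?_, hoff, by simp⟩) ?_
    · simpa using hI _ _ _ true (b r) h₀
    · rintro f' b' ⟨h₁, h₂, h₃⟩
      refine Does.seq (Q := fun f' b' => I 0 f' b' ∧ Marks N b' r 0 ∧ (f' 0 = true ↔ 0 = N))
        (does_shiftPass_true hm hr (fun _ _ => rfl) rfl ⟨hI _ _ _ _ _ h₁, ?_, ?_⟩) ?_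
      · intro p hp
        rcases p with - | p
        · simp [h₃]
        · simp [h₂ p (by omega)]
      · rcases Nat.eq_zero_or_pos N with rfl | hN
        · simp [h₃]
        · simp [hN.ne, hN.ne', h₂ (N - 1) (by omega)]
      · rintro f' b' ⟨h₁, h₂, h₃⟩
        exact key N 0 (by omega) f' b' h₁ h₂ h₃
  exact h₁.mono (by omega) fun _ _ h => h

end Does

end EdgeDeletion

namespace EdgeDeletion

open TapeProg

/-! ### First-order formulas with counting over the positions of a word -/

/-- Formulas over the positions `0, …, N - 1`, with de Bruijn indices for the variables. -/
inductive Fm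
  /-- the position `i` belongs to the set `r` -/
  | rel (r i : ℕ)
  /-- `i * j + k = l` -/
  | madd (i j k l : ℕ)
  | nand (φ ψ : Fm)
  | ex (φ : Fm)
  /-- the number of positions with the property `φ` is `j` -/
  | cnt (φ : Fm) (j : ℕ)

/-- Extend an assignment. -/
def cons (v : ℕ) (ρ : ℕ → ℕ) : ℕ → ℕ
  | 0 => v
  | i + 1 => ρ i

@[simp] theorem cons_zero (v : ℕ) (ρ : ℕ → ℕ) : cons v ρ 0 = v := rfl
@[simp] theorem cons_succ (v : ℕ) (ρ : ℕ → ℕ) (i : ℕ) : cons v ρ (i + 1) = ρ i := rfl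

open Classical in
/-- The truth value of a formula. -/
def Fm.eval (N : ℕ) (R : ℕ → ℕ → Prop) : Fm → (ℕ → ℕ) → Prop
  | .rel r i, ρ => ρ i < N ∧ R r (ρ i)
  | .madd i j k l, ρ => ρ i * ρ j + ρ k = ρ l ∧ ρ l < N
  | .nand φ ψ, ρ => ¬ (φ.eval N R ρ ∧ ψ.eval N R ρ)
  | .ex φ, ρ => ∃ v < N, φ.eval N R (cons v ρ)
  | .cnt φ j, ρ => ((Finset.range N).filter fun v => φ.eval N R (cons v ρ)).card = ρ j ∧ ρ j < N

/-- The tape represents the sets `R` and the assignment `ρ`, whose variables are held by the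
registers `3 * η i`. The registers `3 * j` with `d ≤ j` are empty. -/
structure Corr (N : ℕ) (R : ℕ → ℕ → Prop) (ρ η : ℕ → ℕ) (d : ℕ) (b : ℕ → ℕ → Bool) : Prop where
  le : ∀ i, ρ i ≤ N
  marks : ∀ i, Marks N b (3 * η i) (ρ i)
  off : ∀ j, d ≤ j → ∀ p < N, b (3 * j) p = false
  rel : ∀ r, ∀ p < N, (b (3 * r + 1) p = true ↔ R r p)

/-- Only the auxiliary registers from level `d` on have changed. -/
def Keep (N d : ℕ) (b b' : ℕ → ℕ → Bool) : Prop :=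
  ∀ p < N, ∀ j, (j % 3 = 2 → j / 3 < d) → b' j p = b j p

/-- Only the bit `0` and the bits from `e` on have changed. -/
def KeepFlags (e : ℕ) (f f' : ℕ → Bool) : Prop := ∀ i, i ≠ 0 → i < e → f' i = f i

variable {N d : ℕ} {R : ℕ → ℕ → Prop} {ρ η : ℕ → ℕ} {b b' b'' : ℕ → ℕ → Bool}

theorem Keep.trans (h : Keep N d b b') (h' : Keep N d b' b'') : Keep N d b b'' :=
  fun p hp j hj => (h' p hp j hj).trans (h p hp j hj)

theorem Corr.of_keep (h : Corr N R ρ η d b) (hk : Keep N d b b') : Corr N R ρ η d b' where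
  le := h.le
  marks i := marks_congr (h.marks i) fun p hp => hk p hp _ (by omega)
  off j hj p hp := by rw [hk p hp _ (by omega), h.off j hj p hp]
  rel r p hp := by rw [hk p hp _ (by omega), h.rel r p hp]

/-- Bind a new variable to the register of level `d`. -/
theorem Corr.push (h : Corr N R ρ η d b) (hη : ∀ i, η i < d) {v : ℕ} (hv : v < N)
    (hk : ∀ p < N, ∀ j, j ≠ 3 * d → (j % 3 = 2 → j / 3 < d) → b' j p = b j p)
    (hm : Marks N b' (3 * d) v) : Corr N R (cons v ρ) (cons d η) (d + 1) b' where
  le := by rintro (_ | i); exacts [hv.le, h.le i]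
  marks := by
    rintro (_ | i)
    · exact hm
    · have := hη i
      exact marks_congr (h.marks i) fun p hp => hk p hp _ (by simp; omega) (by simp)
  off j hj p hp := by rw [hk p hp _ (by omega) (by omega), h.off j (by omega) p hp]
  rel r p hp := by rw [hk p hp _ (by omega) (by omega), h.rel r p hp]

theorem cons_lt (hη : ∀ i, η i < d) : ∀ i, cons d η i < d + 1 := by
  rintro (_ | i)
  · simp
  · exact (hη i).trans (by omega)

/-- The formula `φ` is evaluated by tape programs with sufficiently many registers, in time
`c`. -/
def Evaluable (φ : Fm) : Prop :=
  ∀ (η : ℕ → ℕ) (d e : ℕ), (∀ i, η i < d) → 1 ≤ e →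
    ∃ (M : ℕ) (c : Polynomial ℕ), ∀ m ≥ M, ∃ P : RegProg m, ∀ N R ρ f b, Corr N R ρ η d b →
      Does m N P (c.eval N) f b fun f' b' =>
        (f' e = true ↔ φ.eval N R ρ) ∧ Keep N d b b' ∧ KeepFlags e f f'

theorem evaluable_rel (r i : ℕ) : Evaluable (.rel r i) := by
  intro η d e hη he
  refine ⟨3 * r + 3 * η i + e + 4, 2 * Polynomial.X + 3, fun m hm =>
    ⟨.seq (setFlag m e fun _ => false) (meetPass m e (3 * r + 1) (3 * η i)), ?_⟩⟩
  intro N R ρ f b h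
  refine ((does_setFlag (Q := fun f' b' => f' = Function.update f e false ∧ b' = b) _ _
    ⟨rfl, rfl⟩).seq ?_).mono (τ := 1 + (2 * N + 2)) (by simp; omega) fun _ _ h => h
  rintro _ _ ⟨rfl, rfl⟩
  refine does_meetPass (by omega) (by omega) (by omega) fun x hx => ⟨?_, fun _ _ _ _ => rfl, ?_⟩
  · simp only [Function.update_self, hx, Fm.eval, Bool.false_eq_true, false_or]
    constructor
    · rintro ⟨p, hp, h₁, h₂⟩
      rw [h.rel r p hp] at h₁
      rw [h.marks i p hp] at h₂
      subst h₂
      exact ⟨hp, h₁⟩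
    · rintro ⟨h₁, h₂⟩
      exact ⟨_, h₁, (h.rel r _ h₁).2 h₂, (h.marks i _ h₁).2 rfl⟩
  · intro j _ hj
    simp [hj.ne]

/-- The second formula reports in bit `e + 1`, and evaluating it preserves the bits below, so the
first verdict survives in bit `e`. -/
theorem evaluable_nand {φ ψ : Fm} (hφ : Evaluable φ) (hψ : Evaluable ψ) :
    Evaluable (.nand φ ψ) := by
  intro η d e hη he
  obtain ⟨M₁, c₁, H₁⟩ := hφ η d e hη he
  obtain ⟨M₂, c₂, H₂⟩ := hψ η d (e + 1) hη (by omega)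
  refine ⟨M₁ + M₂ + e + 2, c₁ + (c₂ + 1), fun m hm => ?_⟩
  obtain ⟨P₁, H₁⟩ := H₁ m (by omega)
  obtain ⟨P₂, H₂⟩ := H₂ m (by omega)
  refine ⟨.seq P₁ (.seq P₂ (setFlag m e fun v => !(rd v e && rd v (e + 1)))), ?_⟩
  intro N R ρ f b h
  refine ((H₁ N R ρ f b h).seq (τ' := c₂.eval N + 1) ?_).mono (by simp) fun _ _ h => h
  rintro f₁ b₁ ⟨h₁, hk₁, hf₁⟩
  refine (H₂ N R ρ f₁ b₁ (h.of_keep hk₁)).seq ?_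
  rintro f₂ b₂ ⟨h₂, hk₂, hf₂⟩
  refine does_setFlag _ _ ⟨?_, hk₁.trans hk₂, ?_⟩
  · rw [rd_vec (by omega), rd_vec (by omega), Function.update_self, Fm.eval, ← h₁, ← h₂,
      hf₂ e (by omega) (by omega)]
    cases f₁ e <;> simp
  · intro i hi hie
    rw [Function.update_of_ne hie.ne, hf₂ i hi (by omega), hf₁ i hi hie]

/-- The bound variable is a mark running through register `3 * d`, and bit `e` accumulates the
disjunction of the verdicts. Raising the level to `d + 1` keeps nested quantifiers away from this
register. -/
theorem evaluable_ex {φ : Fm} (hφ : Evaluable φ) : Evaluable (.ex φ) := by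
  intro η d e hη he
  obtain ⟨M, c, H⟩ := hφ (cons d η) (d + 1) (e + 1) (cons_lt hη) (by omega)
  refine ⟨M + 3 * d + e + 2,
    1 + (Polynomial.X * ((c + 1) + 2 * Polynomial.X + 4) + 2 * Polynomial.X + 4), fun m hm => ?_⟩
  obtain ⟨P, H⟩ := H m (by omega)
  refine ⟨.seq (setFlag m e fun _ => false) (forProg m (3 * d)
    (.seq P (setFlag m e fun v => rd v e || rd v (e + 1)))), ?_⟩
  intro N R ρ f b h
  refine ((does_setFlag (Q := fun f' b' => f' = Function.update f e false ∧ b' = b) _ _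
    ⟨rfl, rfl⟩).seq ?_).mono
      (τ := 1 + (N * ((c.eval N + 1) + 2 * N + 4) + 2 * N + 4)) (by simp) fun _ _ h => h
  rintro _ b' ⟨rfl, rfl⟩
  refine (does_forProg (by omega) (by omega) (fun v f' b'' =>
    (f' e = true ↔ ∃ u < v, φ.eval N R (cons u ρ)) ∧
    (∀ p < N, ∀ j, j ≠ 3 * d → (j % 3 = 2 → j / 3 < d) → b'' j p = b' j p) ∧ KeepFlags e f f')
    ?_ ?_ ?_ ?_).mono le_rfl ?_
  · rintro v f' b'' x y ⟨h₁, h₂, h₃⟩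
    refine ⟨by rwa [Function.update_of_ne (by omega)], fun p hp j hj hj' => ?_, fun i hi hie => ?_⟩
    · rw [Function.update_of_ne hj]; exact h₂ p hp j hj hj'
    · rw [Function.update_of_ne hi]; exact h₃ i hi hie
  · rintro v hv f₁ b₁ ⟨h₁, h₂, h₃⟩ hmk
    refine (H N R _ f₁ b₁ (h.push hη hv h₂ hmk)).seq ?_
    rintro f₂ b₂ ⟨h₄, h₅, h₆⟩
    refine does_setFlag _ _ ⟨⟨?_, fun p hp j hj hj' => ?_, fun i hi hie => ?_⟩, ?_⟩
    · rw [rd_vec (by omega), rd_vec (by omega), Function.update_self, Bool.or_eq_true, h₄,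
        h₆ e (by omega) (by omega), h₁]
      constructor
      · rintro (⟨u, hu, h⟩ | h)
        exacts [⟨u, by omega, h⟩, ⟨v, by omega, h⟩]
      · rintro ⟨u, hu, h⟩
        rcases Nat.lt_succ_iff_lt_or_eq.1 hu with hu | rfl
        exacts [Or.inl ⟨u, hu, h⟩, Or.inr h]
    · rw [h₅ p hp j (by omega), h₂ p hp j hj hj']
    · rw [Function.update_of_ne hie.ne, h₆ i hi (by omega), h₃ i hi hie]
    · exact marks_congr hmk fun p hp => h₅ p hp _ (by omega)
  · refine ⟨by simp, fun _ _ _ _ _ => rfl, fun i hi hie => ?_⟩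
    rw [Function.update_of_ne hie.ne]
  · exact h.off d le_rfl
  · rintro f' b'' ⟨⟨h₁, h₂, h₃⟩, h₄⟩
    refine ⟨h₁, fun p hp j hj => ?_, h₃⟩
    by_cases hjd : j = 3 * d
    · rw [hjd, h₄ p hp, h.off d le_rfl p hp]
    · exact h₂ p hp j hjd hj

open Classical in
theorem card_filter_range_succ (p : ℕ → Prop) (v : ℕ) :
    ((Finset.range (v + 1)).filter p).card =
      ((Finset.range v).filter p).card + if p v then 1 else 0 := by
  rw [Finset.range_add_one, Finset.filter_insert]
  split_ifs with h
  · rw [Finset.card_insert_of_notMem (by simp)]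
  · rfl

-- Register `3 * d + 2` is a unary counter: a mark starting at 0 that is shifted whenever `φ` holds.
-- A count of N pushes it off the tape, in agreement with the bound on `ρ j` in the semantics.
open Classical in
theorem evaluable_cnt {φ : Fm} (hφ : Evaluable φ) (k : ℕ) : Evaluable (.cnt φ k) := by
  intro η d e hη he
  obtain ⟨M, c, H⟩ := hφ (cons d η) (d + 1) e (cons_lt hη) (by omega)
  refine ⟨M + 3 * d + 3 * η k + e + 5,
    (2 * Polynomial.X + 2) + (1 + ((2 * Polynomial.X + 2) +
      ((Polynomial.X * ((c + (1 + (2 * Polynomial.X + 2))) + 2 * Polynomial.X + 4) +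
        2 * Polynomial.X + 4) + (1 + (2 * Polynomial.X + 2))))), fun m hm => ?_⟩
  obtain ⟨P, H⟩ := H m (by omega)
  refine ⟨.seq (mapPass m (3 * d + 2) fun _ _ => false) <| .seq (setFlag m 0 fun _ => true) <|
    .seq (shiftPass m (3 * d + 2) fun _ => true) <|
    .seq (forProg m (3 * d) (.seq P <| .seq (setFlag m 0 fun _ => false)
      (shiftPass m (3 * d + 2) fun v => rd v e))) <|
    .seq (setFlag m e fun _ => false) (meetPass m e (3 * d + 2) (3 * η k)), ?_⟩
  intro N R ρ f b h
  refine Does.mono (τ := (2 * N + 2) + (1 + ((2 * N + 2) +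
    ((N * ((c.eval N + (1 + (2 * N + 2))) + 2 * N + 4) + 2 * N + 4) + (1 + (2 * N + 2))))))
    ?_ (by simp) fun _ _ h => h
  refine Does.seq (Q := fun f' b' => f' = f ∧ (∀ p < N, ∀ j, j ≠ 3 * d + 2 → b' j p = b j p) ∧
    ∀ p < N, b' (3 * d + 2) p = false) (does_mapPass _ _ ⟨rfl, ?_, ?_⟩) ?_
  · intro p hp j hj
    rw [Function.update_of_ne hj]
  · simp
  rintro f₁ b₁ ⟨hf₁, hb₁, hacc₁⟩
  refine Does.seq (Q := fun f' b' => f' = Function.update f 0 true ∧ b' = b₁)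
    (does_setFlag _ _ ⟨by rw [hf₁], rfl⟩) ?_
  rintro _ _ ⟨rfl, rfl⟩
  refine Does.seq (Q := fun f' b'' => KeepFlags e f f' ∧
    (∀ p < N, ∀ j, j ≠ 3 * d + 2 → b'' j p = b j p) ∧ Marks N b'' (3 * d + 2) 0)
    (does_shiftPass_true (by omega) (by omega) (fun _ _ => rfl) rfl ⟨?_, ?_, ?_⟩) ?_
  · intro i hi hie
    rw [Function.update_of_ne hi, Function.update_of_ne hi]
  · intro p hp j hj
    rw [Function.update_of_ne hj, hb₁ p hp j hj]
  · intro p hp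
    rcases p with - | p
    · simp
    · simp [hacc₁ p (by omega)]
  rintro f₂ b₂ ⟨hf₂, hb₂, hacc₂⟩
  refine Does.seq (does_forProg (by omega) (by omega) (fun v f' b'' => KeepFlags e f f' ∧
    (∀ p < N, ∀ j, j ≠ 3 * d → (j % 3 = 2 → j / 3 < d) → b'' j p = b j p) ∧
    Marks N b'' (3 * d + 2) ((Finset.range v).filter fun u => φ.eval N R (cons u ρ)).card)
    ?_ ?_ ?_ ?_) ?_
  · rintro v f' b'' x y ⟨h₁, h₂, h₃⟩
    refine ⟨fun i hi hie => ?_, fun p hp j hj hj' => ?_, marks_congr h₃ fun p _ => ?_⟩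
    · rw [Function.update_of_ne hi]; exact h₁ i hi hie
    · rw [Function.update_of_ne hj]; exact h₂ p hp j hj hj'
    · rw [Function.update_of_ne (by omega)]
  · rintro v hv f₁ b₁ ⟨h₁, h₂, h₃⟩ hmk
    refine (H N R _ f₁ b₁ (h.push hη hv h₂ hmk)).seq ?_
    rintro f₂ b₂ ⟨h₄, h₅, h₆⟩
    have h₃' := marks_congr h₃ fun p hp => h₅ p hp (3 * d + 2) (by omega)
    have hmk' := marks_congr hmk fun p hp => h₅ p hp (3 * d) (by omega)
    have hf : KeepFlags e f (Function.update f₂ 0 false) := fun i hi hie => by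
      rw [Function.update_of_ne hi, h₆ i hi hie, h₁ i hi hie]
    refine Does.seq (Q := fun f' b' => f' = Function.update f₂ 0 false ∧ b' = b₂)
      (does_setFlag _ _ ⟨rfl, rfl⟩) ?_
    rintro _ _ ⟨rfl, rfl⟩
    rw [card_filter_range_succ]
    by_cases hev : φ.eval N R (cons v ρ)
    · refine does_shiftPass_true (by omega) (by omega) (fun f x => ?_) ?_
        ⟨⟨fun i hi hie => ?_, fun p hp j hj hj' => ?_, ?_⟩, ?_⟩
      · rw [rd_vec (by omega), rd_vec (by omega), Function.update_of_ne (by omega)]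
      · rw [rd_vec (by omega), Function.update_of_ne (by omega), h₄.2 hev]
      · rw [Function.update_of_ne hi]; exact hf i hi hie
      · rw [Function.update_of_ne (by omega), h₅ p hp j (by omega), h₂ p hp j hj hj']
      · rw [if_pos hev, Function.update_self]
        exact h₃'.shift
      · exact marks_congr hmk' fun p _ => by rw [Function.update_of_ne (by omega)]
    · refine does_shiftPass_false ?_
        ⟨⟨hf, fun p hp j hj hj' => ?_, ?_⟩, hmk'⟩
      · rw [rd_vec (by omega), Function.update_of_ne (by omega), ← Bool.not_eq_true, h₄]
        exact hev
      · rw [h₅ p hp j (by omega), h₂ p hp j hj hj']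
      · rwa [if_neg hev, add_zero]
  · exact ⟨hf₂, fun p hp j _ hj => hb₂ p hp j (by omega), by simpa using hacc₂⟩
  · intro p hp
    rw [hb₂ p hp _ (by omega), h.off d le_rfl p hp]
  rintro f₃ b₃ ⟨⟨hf₃, hb₃, hacc₃⟩, hoff₃⟩
  have hk : Keep N d b b₃ := fun p hp j hj => by
    by_cases hjd : j = 3 * d
    · rw [hjd, hoff₃ p hp, h.off d le_rfl p hp]
    · exact hb₃ p hp j hjd hj
  refine Does.seq (Q := fun f' b' => f' = Function.update f₃ e false ∧ b' = b₃)
    (does_setFlag _ _ ⟨rfl, rfl⟩) ?_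
  rintro _ _ ⟨rfl, rfl⟩
  refine does_meetPass (by omega) (by omega) (by omega) fun x hx => ⟨?_, hk, fun i hi hie => ?_⟩
  · simp only [Function.update_self, hx, Fm.eval, Bool.false_eq_true, false_or]
    have hmk := (h.of_keep hk).marks k
    constructor
    · rintro ⟨p, hp, h₁, h₂⟩
      rw [hacc₃ p hp] at h₁
      rw [hmk p hp] at h₂
      omega
    · rintro ⟨h₁, h₂⟩
      exact ⟨_, h₂, (hacc₃ _ h₂).2 h₁.symm, (hmk _ h₂).2 rfl⟩
  · rw [Function.update_of_ne hie.ne, Function.update_of_ne hie.ne]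
    exact hf₃ i hi hie

end EdgeDeletion

namespace EdgeDeletion

open TapeProg

theorem Marks.add_shift {N r v : ℕ} {b : ℕ → ℕ → Bool} {f : ℕ → Bool} (h : Marks N b r v)
    (hf : f 0 = false) :
    Marks N (Function.update b r fun p => if p = 0 then f 0 else b r (p - 1)) r (v + 1) := by
  rw [hf]; exact h.shift

/-- The passes that add `j` to the mark of the accumulator if the bit `e` is not set. -/
def addProg (m d e j : ℕ) : RegProg m :=
  .seq (setFlag m (e + 1) fun _ => false) <| forProg m (3 * (d + 1)) <|
    .seq (meetPass m (e + 1) (3 * (d + 1)) (3 * j)) <| .seq (setFlag m 0 fun _ => false) <|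
      shiftPass m (3 * d + 2) fun v => !rd v e && !rd v (e + 1)

/-- Bit `e + 1` is raised when the running mark meets the mark of `y`, before the shift of that
round. Hence the accumulator moves exactly in the rounds `0, …, y - 1`. -/
theorem does_addProg {m N d e j y z : ℕ} {f : ℕ → Bool} {b : ℕ → ℕ → Bool} (he : 1 ≤ e)
    (hm : 3 * d + 3 * j + e + 7 ≤ m) (hy : y ≤ N) (hj : j < d) (hmy : Marks N b (3 * j) y)
    (hoff : ∀ p < N, b (3 * (d + 1)) p = false) (hacc : Marks N b (3 * d + 2) z) :
    Does m N (addProg m d e j)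
      (1 + (N * (((2 * N + 2) + (1 + (2 * N + 2))) + 2 * N + 4) + 2 * N + 4)) f b
      fun f' b' => KeepFlags (e + 1) f f' ∧ (∀ p < N, ∀ i, i ≠ 3 * d + 2 → b' i p = b i p) ∧
        Marks N b' (3 * d + 2) (z + if f e then 0 else y) := by
  refine Does.seq (Q := fun f' b' => f' = Function.update f (e + 1) false ∧ b' = b)
    (does_setFlag _ _ ⟨rfl, rfl⟩) ?_
  rintro _ b ⟨rfl, rfl⟩
  refine (does_forProg (by omega) (by omega) (fun v f' b' => KeepFlags (e + 1) f f' ∧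
    (∀ p < N, ∀ i, i ≠ 3 * d + 2 → i ≠ 3 * (d + 1) → b' i p = b i p) ∧
    (f' (e + 1) = true ↔ y < v) ∧
    Marks N b' (3 * d + 2) (z + if f e then 0 else min v y)) ?_ ?_ ?_ hoff).mono le_rfl ?_
  · rintro v f' b' x y ⟨h₁, h₂, h₃, h₄⟩
    refine ⟨fun i hi hie => ?_, fun p hp i hi hi' => ?_, ?_, marks_congr h₄ fun p _ => ?_⟩
    · rw [Function.update_of_ne hi]; exact h₁ i hi hie
    · rw [Function.update_of_ne hi']; exact h₂ p hp i hi hi'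
    · rwa [Function.update_of_ne (by omega)]
    · rw [Function.update_of_ne (by omega)]
  · rintro v hv f₁ b₁ ⟨h₁, h₂, h₃, h₄⟩ hmk
    have hmy' : Marks N b₁ (3 * j) y :=
      marks_congr hmy fun p hp => h₂ p hp _ (by omega) (by omega)
    refine Does.seq (Q := fun f' b' => KeepFlags (e + 1) f f' ∧ b' = b₁ ∧
      (f' (e + 1) = true ↔ y ≤ v))
      (does_meetPass (by omega) (by omega) (by omega) fun x hx => ⟨?_, rfl, ?_⟩) ?_
    · intro i hi hie
      rw [Function.update_of_ne hie.ne]; exact h₁ i hi hie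
    · rw [Function.update_self, hx, h₃]
      constructor
      · rintro (h | ⟨p, hp, hp₁, hp₂⟩)
        · omega
        · rw [hmk p hp] at hp₁
          rw [hmy' p hp] at hp₂
          omega
      · intro h
        rcases h.lt_or_eq with h | rfl
        · exact Or.inl h
        · exact Or.inr ⟨y, hv, (hmk y hv).2 rfl, (hmy' y hv).2 rfl⟩
    rintro f₂ b₁ ⟨h₅, rfl, h₆⟩
    refine Does.seq (Q := fun f' b' => f' = Function.update f₂ 0 false ∧ b' = b₁)
      (does_setFlag _ _ ⟨rfl, rfl⟩) ?_
    rintro _ b₁ ⟨rfl, rfl⟩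
    have hfe : f₂ e = f e := h₅ e (by omega) (by omega)
    have hkf : KeepFlags (e + 1) f (Function.update f₂ 0 false) := fun i hi hie => by
      rw [Function.update_of_ne hi]; exact h₅ i hi hie
    by_cases hc : f e = false ∧ v < y
    · have h7 : f₂ (e + 1) = false := by rw [← Bool.not_eq_true, h₆]; omega
      refine does_shiftPass_true (by omega) (by omega) (fun f x => ?_) ?_
        ⟨⟨fun i hi hie => ?_, fun p hp i hi hi' => ?_, ?_, ?_⟩, ?_⟩
      · rw [rd_vec (by omega), rd_vec (by omega), rd_vec (by omega), rd_vec (by omega),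
          Function.update_of_ne (by omega), Function.update_of_ne (by omega)]
      · rw [rd_vec (by omega), rd_vec (by omega), Function.update_of_ne (by omega),
          Function.update_of_ne (by omega), hfe, h7, hc.1]
        rfl
      · rw [Function.update_of_ne hi]; exact hkf i hi hie
      · rw [Function.update_of_ne hi]; exact h₂ p hp i hi hi'
      · rw [Function.update_of_ne (by omega), Function.update_of_ne (by omega), h₆]; omega
      · have := h₄.add_shift (f := Function.update f₂ 0 false) (by simp)
        simp only [hc.1, Bool.false_eq_true, if_false] at this ⊢
        convert this using 1
        omega
      · exact marks_congr hmk fun p _ => by rw [Function.update_of_ne (by omega)]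
    · refine does_shiftPass_false ?_ ⟨⟨hkf, h₂, ?_, ?_⟩, hmk⟩
      · rw [rd_vec (by omega), rd_vec (by omega), Function.update_of_ne (by omega),
          Function.update_of_ne (by omega), hfe]
        by_cases hv' : v < y
        · simp only [hv', and_true, Bool.not_eq_false] at hc
          simp [hc]
        · rw [h₆.2 (by omega)]; simp
      · rw [Function.update_of_ne (by omega), h₆]; omega
      · convert h₄ using 2
        split_ifs with h
        · rfl
        · simp only [Bool.not_eq_true] at h
          simp only [h, true_and] at hc
          omega
  · refine ⟨fun i hi hie => ?_, fun _ _ _ _ _ => rfl, by simp, by simpa using hacc⟩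
    rw [Function.update_of_ne hie.ne]
  · rintro f' b' ⟨⟨h₁, h₂, -, h₄⟩, h₅⟩
    refine ⟨h₁, fun p hp i hi => ?_, by rwa [min_eq_right hy] at h₄⟩
    by_cases hi' : i = 3 * (d + 1)
    · rw [hi', h₅ p hp, hoff p hp]
    · exact h₂ p hp i hi hi'

/-- Multiplication is repeated addition: the accumulator starts as a copy of the mark of `k`, and
`j` is added in each round before the outer mark reaches `i`. A result that is too large leaves the
tape and so meets no mark, as the bound on `l` requires. -/
theorem evaluable_madd (i j k l : ℕ) : Evaluable (.madd i j k l) := by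
  intro η d e hη he
  refine ⟨3 * d + 3 * η i + 3 * η j + 3 * η k + 3 * η l + e + 7,
    (2 * Polynomial.X + 2) + (1 + ((Polynomial.X * (((2 * Polynomial.X + 2) +
      (1 + (Polynomial.X * (((2 * Polynomial.X + 2) + (1 + (2 * Polynomial.X + 2))) +
        2 * Polynomial.X + 4) + 2 * Polynomial.X + 4))) + 2 * Polynomial.X + 4) +
        2 * Polynomial.X + 4) + (1 + (2 * Polynomial.X + 2)))), fun m hm =>
    ⟨.seq (mapPass m (3 * d + 2) fun _ c => rd c (3 * η k)) <|
      .seq (setFlag m e fun _ => false) <|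
      .seq (forProg m (3 * d) (.seq (meetPass m e (3 * d) (3 * η i)) (addProg m d e (η j)))) <|
      .seq (setFlag m e fun _ => false) (meetPass m e (3 * d + 2) (3 * η l)), ?_⟩⟩
  intro N R ρ f b h
  refine Does.mono (τ := (2 * N + 2) + (1 + ((N * (((2 * N + 2) +
    (1 + (N * (((2 * N + 2) + (1 + (2 * N + 2))) + 2 * N + 4) + 2 * N + 4))) + 2 * N + 4) +
    2 * N + 4) + (1 + (2 * N + 2))))) ?_ (by simp) fun _ _ h => h
  refine Does.seq (Q := fun f' b' => f' = f ∧ (∀ p < N, ∀ j, j ≠ 3 * d + 2 → b' j p = b j p) ∧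
    Marks N b' (3 * d + 2) (ρ k)) (does_mapPass _ _ ⟨rfl, ?_, ?_⟩) ?_
  · intro p hp j hj
    rw [Function.update_of_ne hj]
  · intro p hp
    rw [Function.update_self, rd_vec (by omega), h.marks k p hp]
  rintro f₁ b₁ ⟨hf₁, hb₁, hacc₁⟩
  refine Does.seq (Q := fun f' b' => f' = Function.update f e false ∧ b' = b₁)
    (does_setFlag _ _ ⟨by rw [hf₁], rfl⟩) ?_
  rintro _ b₁ ⟨rfl, rfl⟩
  refine Does.seq (does_forProg (by omega) (by omega) (fun v f' b' => KeepFlags e f f' ∧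
    (∀ p < N, ∀ j, j ≠ 3 * d → j ≠ 3 * d + 2 → b' j p = b j p) ∧ (f' e = true ↔ ρ i < v) ∧
    Marks N b' (3 * d + 2) (min v (ρ i) * ρ j + ρ k)) ?_ ?_ ?_ ?_) ?_
  · rintro v f' b' x y ⟨h₁, h₂, h₃, h₄⟩
    refine ⟨fun i hi hie => ?_, fun p hp j hj hj' => ?_, ?_, marks_congr h₄ fun p _ => ?_⟩
    · rw [Function.update_of_ne hi]; exact h₁ i hi hie
    · rw [Function.update_of_ne hj]; exact h₂ p hp j hj hj'
    · rwa [Function.update_of_ne (by omega)]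
    · rw [Function.update_of_ne (by omega)]
  · rintro v hv f₂ b₂ ⟨h₁, h₂, h₃, h₄⟩ hmk
    have hηi := hη i
    have hηj := hη j
    have hmi : Marks N b₂ (3 * η i) (ρ i) :=
      marks_congr (h.marks i) fun p hp => h₂ p hp _ (by omega) (by omega)
    refine Does.seq (Q := fun f' b' => KeepFlags e f f' ∧ b' = b₂ ∧ (f' e = true ↔ ρ i ≤ v))
      (does_meetPass (by omega) (by omega) (by omega) fun x hx => ⟨?_, rfl, ?_⟩) ?_
    · intro i hi hie
      rw [Function.update_of_ne hie.ne]; exact h₁ i hi hie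
    · rw [Function.update_self, hx, h₃]
      constructor
      · rintro (h | ⟨p, hp, hp₁, hp₂⟩)
        · omega
        · rw [hmk p hp] at hp₁
          rw [hmi p hp] at hp₂
          omega
      · intro h
        rcases h.lt_or_eq with h | h
        · exact Or.inl h
        · exact Or.inr ⟨v, hv, (hmk v hv).2 rfl, (hmi v hv).2 h.symm⟩
    rintro f₃ _ ⟨h₅, rfl, h₆⟩
    refine (does_addProg he (by omega) (h.le j) hηj
      (marks_congr (h.marks j) fun p hp => h₂ p hp _ (by omega) (by omega)) (fun p hp => ?_)
      h₄).mono le_rfl ?_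
    · rw [h₂ p hp _ (by omega) (by omega), h.off _ (by omega) p hp]
    · rintro f₄ b₄ ⟨h₇, h₈, h₉⟩
      refine ⟨⟨fun i hi hie => ?_, fun p hp j hj hj' => ?_, ?_, ?_⟩, ?_⟩
      · rw [h₇ i hi (by omega), h₅ i hi hie]
      · rw [h₈ p hp j hj', h₂ p hp j hj hj']
      · rw [h₇ e (by omega) (by omega), h₆]; omega
      · convert h₉ using 1
        by_cases hx : ρ i ≤ v
        · rw [if_pos (h₆.2 hx), min_eq_right hx, min_eq_right (by omega), add_zero]
        · rw [if_neg (by rwa [h₆]), min_eq_left (by omega), min_eq_left (by omega)]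
          ring
      · exact marks_congr hmk fun p hp => h₈ p hp _ (by omega)
  · refine ⟨fun i hi hie => ?_, fun p hp j _ hj => hb₁ p hp j hj, by simp, by simpa using hacc₁⟩
    rw [Function.update_of_ne hie.ne]
  · intro p hp
    rw [hb₁ p hp _ (by omega), h.off d le_rfl p hp]
  rintro f₃ b₃ ⟨⟨hf₃, hb₃, -, hacc₃⟩, hoff₃⟩
  have hk : Keep N d b b₃ := fun p hp j hj => by
    by_cases hjd : j = 3 * d
    · rw [hjd, hoff₃ p hp, h.off d le_rfl p hp]
    · exact hb₃ p hp j hjd (by omega)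
  refine Does.seq (Q := fun f' b' => f' = Function.update f₃ e false ∧ b' = b₃)
    (does_setFlag _ _ ⟨rfl, rfl⟩) ?_
  rintro _ b₃ ⟨rfl, rfl⟩
  refine does_meetPass (by omega) (by omega) (by omega) fun x hx => ⟨?_, hk, fun i hi hie => ?_⟩
  · simp only [Function.update_self, hx, Fm.eval, Bool.false_eq_true, false_or]
    have hmk := (h.of_keep hk).marks l
    rw [min_eq_right (h.le i)] at hacc₃
    constructor
    · rintro ⟨p, hp, h₁, h₂⟩
      rw [hacc₃ p hp] at h₁
      rw [hmk p hp] at h₂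
      omega
    · rintro ⟨h₁, h₂⟩
      exact ⟨_, h₂, (hacc₃ _ h₂).2 h₁.symm, (hmk _ h₂).2 rfl⟩
  · rw [Function.update_of_ne hie.ne, Function.update_of_ne hie.ne]
    exact hf₃ i hi hie

theorem evaluable (φ : Fm) : Evaluable φ := by
  induction φ with
  | rel r i => exact evaluable_rel r i
  | madd i j k l => exact evaluable_madd i j k l
  | nand φ ψ h₁ h₂ => exact evaluable_nand h₁ h₂
  | ex φ h => exact evaluable_ex h
  | cnt φ j h => exact evaluable_cnt h j

/-! ### Programs that compute sets of positions -/

/-- Programs over sets of positions. -/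
inductive Prg
  /-- let the set `r` consist of the positions with the property `φ` -/
  | set (r : ℕ) (φ : Fm)
  | seq (P Q : Prg)
  /-- run `P` for each position in turn -/
  | loop (P : Prg)

/-- The sets after the first `n` rounds of a loop. -/
def iterSets (step : ℕ → (ℕ → ℕ → Prop) → ℕ → ℕ → Prop) (R : ℕ → ℕ → Prop) : ℕ → ℕ → ℕ → Prop
  | 0 => R
  | v + 1 => step v (iterSets step R v)

/-- The sets after the execution of a program. -/
def Prg.run (N : ℕ) : Prg → (ℕ → ℕ) → (ℕ → ℕ → Prop) → ℕ → ℕ → Prop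
  | .set r φ, ρ, R => Function.update R r fun v => v < N ∧ φ.eval N R (cons v ρ)
  | .seq P Q, ρ, R => Q.run N ρ (P.run N ρ R)
  | .loop P, ρ, R => iterSets (fun v => P.run N (cons v ρ)) R N

/-- The program `P` is executed by tape programs with sufficiently many registers, in time `c`. -/
def Executable (P : Prg) : Prop :=
  ∀ (η : ℕ → ℕ) (d : ℕ), (∀ i, η i < d) →
    ∃ (M : ℕ) (c : Polynomial ℕ), ∀ m ≥ M, ∃ T : RegProg m, ∀ N R ρ f b, Corr N R ρ η d b →
      Does m N T (c.eval N) f b fun _ b' => Corr N (P.run N ρ R) ρ η d b'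

/-- The new set is collected in the scratch register `3 * d + 2` and copied only at the end, because
`φ` may refer to the old set `r` throughout. -/
theorem executable_set (r : ℕ) (φ : Fm) : Executable (.set r φ) := by
  intro η d hη
  obtain ⟨M, c, H⟩ := evaluable φ (cons d η) (d + 1) 1 (cons_lt hη) le_rfl
  refine ⟨M + 3 * d + 3 * r + 3, (Polynomial.X * ((c + (2 * Polynomial.X + 2)) +
    2 * Polynomial.X + 4) + 2 * Polynomial.X + 4) + (2 * Polynomial.X + 2), fun m hm => ?_⟩
  obtain ⟨P, H⟩ := H m (by omega)
  refine ⟨.seq (forProg m (3 * d) (.seq P (mapPass m (3 * d + 2) fun v c =>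
      if rd c (3 * d) then rd v 1 else rd c (3 * d + 2))))
    (mapPass m (3 * r + 1) fun _ c => rd c (3 * d + 2)), ?_⟩
  intro N R ρ f b h
  refine Does.mono (τ := (N * ((c.eval N + (2 * N + 2)) + 2 * N + 4) + 2 * N + 4) + (2 * N + 2))
    ?_ (by simp) fun _ _ h => h
  refine Does.seq (does_forProg (by omega) (by omega) (fun v f' b' =>
    (∀ p < N, ∀ j, j ≠ 3 * d → (j % 3 = 2 → j / 3 < d) → b' j p = b j p) ∧
    ∀ p < N, p < v → (b' (3 * d + 2) p = true ↔ φ.eval N R (cons p ρ))) ?_ ?_ ?_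
    (h.off d le_rfl)) ?_
  · rintro v f' b' x y ⟨h₁, h₂⟩
    refine ⟨fun p hp j hj hj' => ?_, fun p hp hpv => ?_⟩
    · rw [Function.update_of_ne hj]; exact h₁ p hp j hj hj'
    · rw [Function.update_of_ne (by omega)]; exact h₂ p hp hpv
  · rintro v hv f₁ b₁ ⟨h₁, h₂⟩ hmk
    refine (H N R _ f₁ b₁ (h.push hη hv h₁ hmk)).seq ?_
    rintro f₂ b₂ ⟨h₄, h₅, -⟩
    have hmk' := marks_congr hmk fun p hp => h₅ p hp (3 * d) (by omega)
    refine does_mapPass _ _ ⟨⟨fun p hp j hj hj' => ?_, fun p hp hpv => ?_⟩, ?_⟩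
    · rw [Function.update_of_ne (by omega), h₅ p hp j (by omega), h₁ p hp j hj hj']
    · rw [Function.update_self, rd_vec (by omega), rd_vec (by omega), rd_vec (by omega)]
      by_cases hpv' : p = v
      · subst hpv'
        rw [if_pos ((hmk' p hp).2 rfl), h₄]
      · rw [if_neg (by rwa [hmk' p hp]), h₅ p hp _ (by omega), h₂ p hp (by omega)]
    · exact marks_congr hmk' fun p _ => by rw [Function.update_of_ne (by omega)]
  · exact ⟨fun _ _ _ _ _ => rfl, fun p _ hp => absurd hp (Nat.not_lt_zero p)⟩
  rintro f₁ b₁ ⟨⟨h₁, h₂⟩, h₃⟩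
  have hk : Keep N d b b₁ := fun p hp j hj => by
    by_cases hjd : j = 3 * d
    · rw [hjd, h₃ p hp, h.off d le_rfl p hp]
    · exact h₁ p hp j hjd hj
  have hC := h.of_keep hk
  refine does_mapPass _ _ ⟨h.le, fun i => ?_, fun j hj p hp => ?_, fun r' p hp => ?_⟩
  · exact marks_congr (hC.marks i) fun p _ => by rw [Function.update_of_ne (by omega)]
  · rw [Function.update_of_ne (by omega), hC.off j hj p hp]
  · by_cases hr : r' = r
    · subst hr
      rw [Function.update_self, rd_vec (by omega), h₂ p hp hp]
      simp [Prg.run, hp]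
    · rw [Function.update_of_ne (by omega), hC.rel r' p hp, Prg.run, Function.update_of_ne hr]

theorem executable_seq {P Q : Prg} (hP : Executable P) (hQ : Executable Q) :
    Executable (.seq P Q) := by
  intro η d hη
  obtain ⟨M₁, c₁, H₁⟩ := hP η d hη
  obtain ⟨M₂, c₂, H₂⟩ := hQ η d hη
  refine ⟨M₁ + M₂, c₁ + c₂, fun m hm => ?_⟩
  obtain ⟨P₁, H₁⟩ := H₁ m (by omega)
  obtain ⟨P₂, H₂⟩ := H₂ m (by omega)
  refine ⟨.seq P₁ P₂, fun N R ρ f b h => ?_⟩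
  exact ((H₁ N R ρ f b h).seq fun f' b' h' => H₂ N _ ρ f' b' h').mono (by simp) fun _ _ h => h

theorem executable_loop {P : Prg} (hP : Executable P) : Executable (.loop P) := by
  intro η d hη
  obtain ⟨M, c, H⟩ := hP (cons d η) (d + 1) (cons_lt hη)
  refine ⟨M + 3 * d + 1, Polynomial.X * (c + 2 * Polynomial.X + 4) + 2 * Polynomial.X + 4,
    fun m hm => ?_⟩
  obtain ⟨T, H⟩ := H m (by omega)
  refine ⟨forProg m (3 * d) T, fun N R ρ f b h => ?_⟩
  refine Does.mono (τ := N * (c.eval N + 2 * N + 4) + 2 * N + 4) ?_ (by simp) fun _ _ h => h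
  refine (does_forProg (by omega) (by omega) (fun v _ b' =>
    (∀ i, Marks N b' (3 * η i) (ρ i)) ∧ (∀ j, d + 1 ≤ j → ∀ p < N, b' (3 * j) p = false) ∧
    ∀ r, ∀ p < N, (b' (3 * r + 1) p = true ↔
      iterSets (fun v => P.run N (cons v ρ)) R v r p)) ?_ ?_ ?_ (h.off d le_rfl)).mono le_rfl ?_
  · rintro v f' b' x y ⟨h₁, h₂, h₃⟩
    refine ⟨fun i => ?_, fun j hj p hp => ?_, fun r p hp => ?_⟩
    · have := hη i
      exact marks_congr (h₁ i) fun p _ => by rw [Function.update_of_ne (by omega)]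
    · rw [Function.update_of_ne (by omega)]; exact h₂ j hj p hp
    · rw [Function.update_of_ne (by omega)]; exact h₃ r p hp
  · rintro v hv f₁ b₁ ⟨h₁, h₂, h₃⟩ hmk
    refine (H N _ (cons v ρ) f₁ b₁ ⟨?_, ?_, h₂, h₃⟩).mono le_rfl fun f₂ b₂ h' => ?_
    · rintro (_ | i); exacts [hv.le, h.le i]
    · rintro (_ | i); exacts [hmk, h₁ i]
    · exact ⟨⟨fun i => h'.marks (i + 1), h'.off, h'.rel⟩, h'.marks 0⟩
  · exact ⟨h.marks, fun j hj => h.off j (by omega), h.rel⟩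
  · rintro f₁ b₁ ⟨⟨h₁, h₂, h₃⟩, h₄⟩
    refine ⟨h.le, h₁, fun j hj => ?_, h₃⟩
    rcases hj.lt_or_eq with hj | rfl
    exacts [h₂ j hj, h₄]

theorem executable (P : Prg) : Executable P := by
  induction P with
  | set r φ => exact executable_set r φ
  | seq P Q h₁ h₂ => exact executable_seq h₁ h₂
  | loop P h => exact executable_loop h

/-- The sets of positions that represent a word: `a ∈ α` has the letter bits `bits a`. -/
def inputSets {α : Type} (bits : α → ℕ → Prop) (w : List α) : ℕ → ℕ → Prop :=
  fun r p => ∃ a, w[p]? = some a ∧ bits a r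

open Classical in
/-- A function whose values are read off two sets of positions computed by a program can be
computed by a Turing machine in polynomial time. The positions range over the double of the
length of the input, plus two. -/
theorem computableInPolyTime_of_prg {α X Y : Type} [Fintype α] {ea : X → List α}
    {eb : Y → List Bool} {g : X → Y} (bits : α → ℕ → Prop) (P : Prg) (len bit : ℕ)
    (h : ∀ x, ((List.range (2 * (ea x).length + 2)).filter fun p =>
        decide (P.run (2 * (ea x).length + 2) (fun _ => 2 * (ea x).length + 2)
          (inputSets bits (ea x)) len p)).map (fun p =>
        decide (P.run (2 * (ea x).length + 2) (fun _ => 2 * (ea x).length + 2)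
          (inputSets bits (ea x)) bit p)) = eb (g x)) :
    Nonempty (Turing.TM2ComputableInPolyTime ea eb g) := by
  -- No variable is bound yet: all of them have the off-tape value N and share the empty register 0,
  -- so binding starts at level 1.
  obtain ⟨M, c, H⟩ := executable P (fun _ => 0) 1 (fun _ => Nat.one_pos)
  obtain ⟨T, H⟩ := H (M + 3 * len + 3 * bit + 2) (by omega)
  refine computableInPolyTime_of_exec T (vec _ fun _ => false)
    (fun a => vec _ fun j => decide (j % 3 = 1 ∧ bits a (j / 3))) (vec _ fun _ => false)
    (fun v => rd v (3 * len + 1)) (fun v => rd v (3 * bit + 1)) (c.comp (2 * Polynomial.X + 2))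
    fun x => ?_
  set w := ea x
  set N := 2 * w.length + 2 with hN
  let b : ℕ → ℕ → Bool := fun j p => decide (j % 3 = 1 ∧ inputSets bits w (j / 3) p)
  have hb : ∀ m, w.map (fun a => vec m fun j => decide (j % 3 = 1 ∧ bits a (j / 3))) ++
      List.replicate (w.length + 2) (vec m fun _ => false) = tape m N b := by
    intro m
    refine List.ext_getElem (by simp [hN]; omega) fun p h₁ h₂ => ?_
    simp only [tape, List.getElem_map, List.getElem_range]
    by_cases hp : p < w.length
    · rw [List.getElem_append_left (by simpa using hp)]
      simp [b, inputSets, hp]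
    · rw [List.getElem_append_right (by simpa using hp)]
      simp [b, inputSets, hp]
  have hC : Corr N (inputSets bits w) (fun _ => N) (fun _ => 0) 1 b := by
    refine ⟨fun _ => le_rfl, fun _ p hp => ?_, fun j _ p _ => ?_, fun r p _ => ?_⟩
    · simp [b, hp.ne]
    · simp [b]
    · have : (3 * r + 1) / 3 = r := by omega
      simp [b, this]
  obtain ⟨f', b', t, ht, hE, hC'⟩ := H N _ _ (fun _ => false) b hC
  rw [← hb] at hE
  refine ⟨_, _, t, hE, by simpa using ht, ?_⟩
  rw [← h x]
  unfold tape
  rw [List.filter_map, List.map_map]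
  have e₁ : ∀ r ∈ [len, bit], ∀ p < N,
      rd (vec (M + 3 * len + 3 * bit + 2) fun j => b' j p) (3 * r + 1) =
        decide (P.run N (fun _ => N) (inputSets bits w) r p) := by
    intro r hr p hp
    rw [rd_vec (by simp at hr; omega), Bool.eq_iff_iff, hC'.rel r p hp, decide_eq_true_iff]
  have e₂ : (List.range N).filter ((fun v => rd v (3 * len + 1)) ∘ fun p =>
      vec (M + 3 * len + 3 * bit + 2) fun j => b' j p) = (List.range N).filter fun p =>
        decide (P.run N (fun _ => N) (inputSets bits w) len p) :=
    List.filter_congr fun p hp => e₁ len (by simp) p (List.mem_range.1 hp)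
  rw [e₂]
  refine List.map_congr_left fun p hp => ?_
  exact e₁ bit (by simp) p (List.mem_range.1 (List.mem_of_mem_filter hp))

end EdgeDeletion

namespace EdgeDeletion

/-! ### Definable predicates -/

/-- Rename the variables of a formula. -/
def Fm.rename : Fm → (ℕ → ℕ) → Fm
  | .rel r i, s => .rel r (s i)
  | .madd i j k l, s => .madd (s i) (s j) (s k) (s l)
  | .nand φ ψ, s => .nand (φ.rename s) (ψ.rename s)
  | .ex φ, s => .ex (φ.rename (cons 0 fun i => s i + 1))
  | .cnt φ j, s => .cnt (φ.rename (cons 0 fun i => s i + 1)) (s j)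

open Classical in
theorem Fm.eval_rename {N : ℕ} {R : ℕ → ℕ → Prop} (φ : Fm) (s ρ : ℕ → ℕ) :
    (φ.rename s).eval N R ρ ↔ φ.eval N R fun i => ρ (s i) := by
  have key : ∀ (s ρ : ℕ → ℕ) (v : ℕ), (fun i => cons v ρ ((cons 0 fun i => s i + 1) i)) =
      cons v fun i => ρ (s i) := by
    intro s ρ v; funext i; cases i <;> rfl
  induction φ generalizing s ρ with
  | rel | madd => rfl
  | nand φ ψ h₁ h₂ => simp only [rename, eval, h₁, h₂]
  | ex φ h => simp only [rename, eval, h, key]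
  | cnt φ j h =>
    simp only [rename, eval]
    have e : ∀ v, (φ.rename (cons 0 fun i => s i + 1)).eval N R (cons v ρ) ↔
        φ.eval N R (cons v fun i => ρ (s i)) := fun v =>
      (h _ _).trans (by rw [key])
    rw [Finset.filter_congr fun v _ => e v]

/-- For each input of type `B`, a structure with positions, sets of positions and an assignment. -/
structure Sys (B : Type) where
  size : B → ℕ
  two_le : ∀ b, 2 ≤ size b
  sets : B → ℕ → ℕ → Prop
  env : B → ℕ → ℕ

/-- Types of assignments. -/
class Ctx {B : outParam Type} (σ : outParam (Sys B)) (γ : Type) where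
  base : γ → B
  env : γ → ℕ → ℕ

section

variable {B : Type} {σ : Sys B} {γ : Type} [Ctx σ γ]

instance (n : γ → ℕ) : Ctx σ (Σ g, Fin (n g)) where
  base q := Ctx.base q.1
  env q := cons q.2 (Ctx.env q.1)

/-- The number of positions. -/
abbrev size (g : γ) : ℕ := σ.size (Ctx.base g)

/-- A predicate given by a formula over the sets with indices below `m`. -/
class Dfn (m : ℕ) (p : γ → Prop) : Prop where
  out : ∃ φ : Fm, ∀ (g : γ) (R : ℕ → ℕ → Prop), (∀ r < m, R r = σ.sets (Ctx.base g) r) →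
    (φ.eval (size g) R (Ctx.env g) ↔ p g)

/-- A function whose graph, restricted to the positions, is definable. -/
class Trm (m : ℕ) (x : γ → ℕ) : Prop where
  out : Dfn m fun q : Σ g : γ, Fin (size g) => (q.2 : ℕ) = x q.1

/-- A function bounded by the number of positions. -/
class Bdd (x : γ → ℕ) : Prop where
  out : ∀ g, x g < size g

/-- A variable. -/
class Var (x : γ → ℕ) : Prop where
  out : ∃ i, ∀ g, Ctx.env g i = x g

variable {m : ℕ} {p q : γ → Prop} {x y : γ → ℕ}

theorem Dfn.of_iff (h : Dfn m p) (hpq : ∀ g, q g ↔ p g) : Dfn m q := by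
  rwa [show q = p from funext fun g => propext (hpq g)]

theorem Dfn.comap {δ : Type} [Ctx σ δ] (f : δ → γ) (s : ℕ → ℕ)
    (hb : ∀ d, Ctx.base (f d) = Ctx.base d) (he : ∀ d i, Ctx.env (f d) i = Ctx.env d (s i))
    (h : Dfn m p) : Dfn m fun d => p (f d) := by
  obtain ⟨φ, h⟩ := h.out
  refine ⟨φ.rename s, fun d R hR => ?_⟩
  rw [Fm.eval_rename, ← h (f d) R (by rwa [hb]), size, size, hb, show Ctx.env (f d) = _ from
    funext (he d)]

section connectives

instance (priority := 900) Dfn.not [h : Dfn m p] : Dfn m fun g => ¬ p g := by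
  obtain ⟨φ, h⟩ := h.out
  exact ⟨.nand φ φ, fun g R hR => by simp [Fm.eval, h g R hR]⟩

instance Dfn.and [h : Dfn m p] [h' : Dfn m q] : Dfn m fun g => p g ∧ q g := by
  obtain ⟨φ, h⟩ := h.out
  obtain ⟨ψ, h'⟩ := h'.out
  refine ⟨.nand (.nand φ ψ) (.nand φ ψ), fun g R hR => ?_⟩
  simp only [Fm.eval, h g R hR, h' g R hR]
  tauto

instance Dfn.or [Dfn m p] [Dfn m q] : Dfn m fun g => p g ∨ q g :=
  Dfn.of_iff (p := fun g => ¬ (¬ p g ∧ ¬ q g)) inferInstance fun g => by tauto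

instance (priority := 800) Dfn.imp [Dfn m p] [Dfn m q] : Dfn m fun g => p g → q g :=
  Dfn.of_iff (p := fun g => ¬ p g ∨ q g) inferInstance fun g => by tauto

instance Dfn.iff [Dfn m p] [Dfn m q] : Dfn m fun g => (p g ↔ q g) :=
  Dfn.of_iff (p := fun g => (p g → q g) ∧ (q g → p g)) inferInstance fun g => by tauto

end connectives

/-- A range of quantification. -/
class Below (n : γ → ℕ) : Prop where
  le : ∀ g, n g ≤ size g

/-- A definable range of quantification. -/
class Rng (m : ℕ) (n : γ → ℕ) : Prop extends Below n where
  dfn : Dfn m fun q : Σ g : γ, Fin (size g) => (q.2 : ℕ) < n q.1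

instance : Below fun g : γ => size g := ⟨fun _ => le_rfl⟩

instance Rng.size : Rng m fun g : γ => size g where
  le _ := le_rfl
  dfn := by
    refine ⟨.nand (.rel 0 0) (.nand (.rel 0 0) (.rel 0 0)), fun g R hR => ?_⟩
    simp only [Fm.eval, g.2.2, iff_true]
    tauto

/-- Quantifiers of formulas range over all positions, those of a context over `Fin (n g)`. This
relativization to the range serves both quantification and counting. -/
theorem Dfn.comap_le {n : γ → ℕ} [hn : Rng m n] {p : (Σ g, Fin (n g)) → Prop} (h : Dfn m p) :
    Dfn m fun q : Σ g : γ, Fin (EdgeDeletion.size g) => ∃ h : q.2 < n q.1, p ⟨q.1, q.2, h⟩ := by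
  obtain ⟨φ, h⟩ := h.out
  obtain ⟨ψ, hψ⟩ := hn.dfn.out
  refine ⟨.nand (.nand φ ψ) (.nand φ ψ), fun g R hR => ?_⟩
  have h₁ := hψ g R hR
  have : (Fm.nand (.nand φ ψ) (.nand φ ψ)).eval (EdgeDeletion.size g) R (Ctx.env g) ↔
      (φ.eval (EdgeDeletion.size g) R (Ctx.env g) ∧ ψ.eval (EdgeDeletion.size g) R (Ctx.env g)) := by
    simp only [Fm.eval]; tauto
  rw [this, h₁]
  by_cases hlt : (g.2 : ℕ) < n g.1
  · simp only [hlt, and_true, exists_true_left]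
    exact h ⟨g.1, g.2, hlt⟩ R hR
  · simp [hlt]

instance Dfn.ex {n : γ → ℕ} [hn : Rng m n] {p : ∀ g, Fin (n g) → Prop}
    [h : Dfn m fun q : Σ g, Fin (n g) => p q.1 q.2] : Dfn m fun g => ∃ v : Fin (n g), p g v := by
  obtain ⟨φ, h⟩ := h.comap_le.out
  refine ⟨.ex φ, fun g R hR => ?_⟩
  constructor
  · rintro ⟨v, hv, he⟩
    obtain ⟨hlt, he⟩ := (h ⟨g, v, hv⟩ R hR).1 he
    exact ⟨_, he⟩
  · rintro ⟨v, he⟩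
    exact ⟨v, v.2.trans_le (hn.le g), (h ⟨g, v, v.2.trans_le (hn.le g)⟩ R hR).2 ⟨v.2, he⟩⟩

instance Dfn.all {n : γ → ℕ} [hn : Rng m n] {p : ∀ g, Fin (n g) → Prop}
    [h : Dfn m fun q : Σ g, Fin (n g) => p q.1 q.2] : Dfn m fun g => ∀ v : Fin (n g), p g v :=
  Dfn.of_iff (p := fun g => ¬ ∃ v : Fin (n g), ¬ p g v) inferInstance fun g => by simp

section indices

variable {n₀ : γ → ℕ} {n₁ : (Σ g, Fin (n₀ g)) → ℕ} {n₂ : (Σ g, Fin (n₁ g)) → ℕ}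
  {n₃ : (Σ g, Fin (n₂ g)) → ℕ} {n₄ : (Σ g, Fin (n₃ g)) → ℕ} {n₅ : (Σ g, Fin (n₄ g)) → ℕ}
  {n₆ : (Σ g, Fin (n₅ g)) → ℕ} {n₇ : (Σ g, Fin (n₆ g)) → ℕ}

instance : Var fun q : Σ g, Fin (n₀ g) => (q.2 : ℕ) := ⟨0, fun _ => rfl⟩
instance : Var fun q : Σ g, Fin (n₁ g) => (q.1.2 : ℕ) := ⟨1, fun _ => rfl⟩
instance : Var fun q : Σ g, Fin (n₂ g) => (q.1.1.2 : ℕ) := ⟨2, fun _ => rfl⟩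
instance : Var fun q : Σ g, Fin (n₃ g) => (q.1.1.1.2 : ℕ) := ⟨3, fun _ => rfl⟩
instance : Var fun q : Σ g, Fin (n₄ g) => (q.1.1.1.1.2 : ℕ) := ⟨4, fun _ => rfl⟩
instance : Var fun q : Σ g, Fin (n₅ g) => (q.1.1.1.1.1.2 : ℕ) := ⟨5, fun _ => rfl⟩
instance : Var fun q : Σ g, Fin (n₆ g) => (q.1.1.1.1.1.1.2 : ℕ) := ⟨6, fun _ => rfl⟩
instance : Var fun q : Σ g, Fin (n₇ g) => (q.1.1.1.1.1.1.1.2 : ℕ) := ⟨7, fun _ => rfl⟩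

end indices

instance {n : γ → ℕ} [hn : Below n] (v : ∀ g, Fin (n g)) : Bdd fun g => (v g : ℕ) :=
  ⟨fun g => (v g).2.trans_le (hn.le g)⟩

/-- The only arithmetic atom. Equality, constants, sums and products of general terms are all
obtained from it by quantifying over intermediate values. -/
theorem Dfn.mul_add_eq (a b c d : γ → ℕ) [ha : Var a] [hb : Var b] [hc : Var c] [hd : Var d]
    [hbd : Bdd d] : Dfn m fun g => a g * b g + c g = d g := by
  obtain ⟨i, hi⟩ := ha.out
  obtain ⟨j, hj⟩ := hb.out
  obtain ⟨k, hk⟩ := hc.out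
  obtain ⟨l, hl⟩ := hd.out
  refine ⟨.madd i j k l, fun g R _ => ?_⟩
  simp only [Fm.eval, hi, hj, hk, hl, and_iff_left_iff_imp]
  exact fun _ => hbd.out g


theorem Var.fst (h : Var x) (n : γ → ℕ) : Var fun q : Σ g, Fin (n g) => x q.1 := by
  obtain ⟨i, h⟩ := h.out
  exact ⟨i + 1, fun q => h q.1⟩

theorem Trm.fst (h : Trm m x) (n : γ → ℕ) : Trm m fun q : Σ g, Fin (n g) => x q.1 :=
  ⟨h.out.comap (γ := Σ g : γ, Fin (size g)) (δ := Σ q : Σ g, Fin (n g), Fin (size q))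
    (fun q => ⟨q.1.1, q.2⟩) (cons 0 fun i => i + 2) (fun _ => rfl)
    fun d i => by cases i <;> rfl⟩

section arithmetic

attribute [local instance] Dfn.mul_add_eq

/-- The equation `a * a + a = a` characterizes zero. -/
theorem Dfn.var_eq_zero (a : γ → ℕ) [Var a] [Bdd a] : Dfn m fun g => a g = 0 :=
  Dfn.of_iff (Dfn.mul_add_eq a a a a) fun g => by simp

theorem Dfn.var_eq (a b : γ → ℕ) [ha : Var a] [hb : Var b] [hbd : Bdd b] :
    Dfn m fun g => a g = b g := by
  have := ha.fst size
  have := hb.fst size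
  have : Bdd fun q : Σ g : γ, Fin (size g) => b q.1 := ⟨fun q => hbd.out q.1⟩
  have := Dfn.var_eq_zero (m := m) fun q : Σ g : γ, Fin (size g) => (q.2 : ℕ)
  refine Dfn.of_iff (p := fun g => ∃ z : Fin (size g), (z : ℕ) = 0 ∧ (z : ℕ) * z + a g = b g)
    inferInstance fun g => ?_
  constructor
  · intro h
    exact ⟨⟨0, by have := σ.two_le (Ctx.base g); unfold size; omega⟩, by simp [h]⟩
  · rintro ⟨z, hz, h⟩
    simpa [hz] using h

instance Trm.of_var [h : Var x] : Trm m x := by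
  have := h.fst size
  exact ⟨Dfn.of_iff (Dfn.var_eq _ _) fun q => eq_comm⟩

instance Trm.zero : Trm m fun _ : γ => 0 := ⟨Dfn.var_eq_zero _⟩

instance Dfn.eq [h : Trm m x] [h' : Trm m y] [hb : Bdd x] : Dfn m fun g => x g = y g := by
  have := h.out
  have := h'.out
  refine Dfn.of_iff (p := fun g => ∃ a : Fin (size g), (a : ℕ) = x g ∧ (a : ℕ) = y g)
    inferInstance fun g => ?_
  constructor
  · exact fun h => ⟨⟨x g, hb.out g⟩, rfl, h⟩
  · rintro ⟨a, h₁, h₂⟩; exact h₁.symm.trans h₂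

/-- One is the nonzero solution of `q * q = q`; at least two positions exist, so it occurs among
them. -/
instance Trm.one : Trm m fun _ : γ => 1 := by
  refine ⟨Dfn.of_iff (p := fun q : Σ g : γ, Fin (size g) => ¬ (q.2 : ℕ) = 0 ∧
    ∃ z : Fin (size q), (z : ℕ) = 0 ∧ (q.2 : ℕ) * q.2 + z = q.2) inferInstance fun q => ?_⟩
  constructor
  · intro h
    refine ⟨by omega, ⟨0, by have := σ.two_le (Ctx.base q); unfold size; omega⟩, by simp [h]⟩
  · rintro ⟨h₁, z, hz, h₂⟩
    simpa [hz, h₁] using h₂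

instance Trm.add [h : Trm m x] [h' : Trm m y] : Trm m fun g => x g + y g := by
  have := (((h.fst size).fst size).fst size).fst size
  have := (((h'.fst size).fst size).fst size).fst size
  refine ⟨Dfn.of_iff (p := fun q : Σ g : γ, Fin (size g) => ∃ a b o : Fin (size q.1),
    (a : ℕ) = x q.1 ∧ (b : ℕ) = y q.1 ∧ (o : ℕ) = 1 ∧ (a : ℕ) * o + b = q.2) inferInstance
    fun q => ?_⟩
  constructor
  · intro h
    have := q.2.2
    exact ⟨⟨x q.1, by omega⟩, ⟨y q.1, by omega⟩, ⟨1, σ.two_le _⟩, by simp [h]⟩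
  · rintro ⟨a, b, o, h₁, h₂, h₃, h₄⟩
    rw [← h₄, h₁, h₂, h₃, mul_one]

/-- If the product is nonzero, both factors are at most the product and hence are positions. A zero
product needs its own disjunct, since the other factor may then exceed every position. -/
instance Trm.mul [h : Trm m x] [h' : Trm m y] : Trm m fun g => x g * y g := by
  have := (((h.fst size).fst size).fst size).fst size
  have := (((h'.fst size).fst size).fst size).fst size
  have := (h.fst size).fst size
  have := (h'.fst size).fst size
  refine ⟨Dfn.of_iff (p := fun q : Σ g : γ, Fin (size g) =>
    ((q.2 : ℕ) = 0 ∧ ∃ a : Fin (size q.1), (a : ℕ) = 0 ∧ ((a : ℕ) = x q.1 ∨ (a : ℕ) = y q.1)) ∨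
    ∃ a b z : Fin (size q.1),
    (a : ℕ) = x q.1 ∧ (b : ℕ) = y q.1 ∧ (z : ℕ) = 0 ∧ (a : ℕ) * b + z = q.2) inferInstance
    fun q => ?_⟩
  have h0 : 0 < size q.1 := by have := σ.two_le (Ctx.base q.1); unfold size; omega
  constructor
  · intro h
    have := q.2.2
    by_cases hx : x q.1 = 0
    · exact Or.inl ⟨by simp [h, hx], ⟨0, h0⟩, by simp [hx]⟩
    by_cases hy : y q.1 = 0
    · exact Or.inl ⟨by simp [h, hy], ⟨0, h0⟩, by simp [hy]⟩
    have h₁ := Nat.le_mul_of_pos_right (x q.1) (Nat.pos_of_ne_zero hy)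
    have h₂ := Nat.le_mul_of_pos_left (y q.1) (Nat.pos_of_ne_zero hx)
    exact Or.inr ⟨⟨x q.1, by omega⟩, ⟨y q.1, by omega⟩, ⟨0, h0⟩, by simp [h]⟩
  · rintro (⟨h, a, h₁, h₂ | h₂⟩ | ⟨a, b, z, h₁, h₂, h₃, h₄⟩)
    · rw [h, ← h₂, h₁, zero_mul]
    · rw [h, ← h₂, h₁, mul_zero]
    · rw [← h₄, h₁, h₂, h₃, add_zero]

end arithmetic

/-- Only the left side is assumed to be a position. The universal quantifier over `b` makes the
formula true when `y` exceeds the range, where the inequality holds anyway. -/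
instance Dfn.le [h : Trm m x] [h' : Trm m y] [hb : Bdd x] : Dfn m fun g => x g ≤ y g := by
  have := h.fst size
  have := (h'.fst size).fst size
  refine Dfn.of_iff (p := fun g => ∃ a : Fin (size g), (a : ℕ) = x g ∧
    ∀ b : Fin (size g), (b : ℕ) = y g → ∃ c : Fin (size g), (b : ℕ) = a + c) inferInstance
    fun g => ?_
  constructor
  · refine fun h => ⟨⟨x g, hb.out g⟩, rfl, fun b hb => ⟨⟨b - x g, by omega⟩, ?_⟩⟩
    simp only
    omega
  · rintro ⟨a, h₁, h₂⟩
    by_contra hlt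
    have := a.2
    obtain ⟨c, hc⟩ := h₂ ⟨y g, by omega⟩ rfl
    simp only at hc
    omega

instance Dfn.lt [h : Trm m x] [h' : Trm m y] [hb : Bdd x] : Dfn m fun g => x g < y g :=
  Dfn.of_iff (p := fun g => x g ≤ y g ∧ ¬ x g = y g) inferInstance fun _ => lt_iff_le_and_ne

open Classical in
instance Trm.card {n : γ → ℕ} [hn : Rng m n] {p : ∀ g, Fin (n g) → Prop}
    {inst : ∀ g, DecidablePred (p g)}
    [h : Dfn m fun q : Σ g, Fin (n g) => p q.1 q.2] :
    Trm m fun g => (Finset.univ.filter (p g)).card := by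
  obtain ⟨φ, h⟩ := h.comap_le.out
  -- Inside the counting quantifier, index 0 is the counted variable and index 1 the value compared
  -- with the count; the renaming makes `φ` skip the latter.
  refine ⟨⟨.cnt (φ.rename (cons 0 fun i => i + 2)) 0, fun q R hR => ?_⟩⟩
  have key : ∀ v, (fun i => cons v (cons q.2 (Ctx.env q.1)) (cons 0 (fun i => i + 2) i)) =
      cons v (Ctx.env q.1) := by
    intro v; funext i; cases i <;> rfl
  have e : ∀ v, v < size q.1 → ((φ.rename (cons 0 fun i => i + 2)).eval (size q.1) R
      (cons v (cons q.2 (Ctx.env q.1))) ↔ ∃ h : v < n q.1, p q.1 ⟨v, h⟩) := by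
    intro v hv
    rw [Fm.eval_rename, key]
    exact h ⟨q.1, v, hv⟩ R hR
  have hcard : ((Finset.range (size q.1)).filter fun v => (φ.rename (cons 0 fun i => i + 2)).eval
      (size q.1) R (cons v (cons q.2 (Ctx.env q.1)))).card = (Finset.univ.filter (p q.1)).card := by
    rw [Finset.filter_congr fun v hv => e v (Finset.mem_range.1 hv), ← Finset.card_map
      Fin.valEmbedding]
    congr 1
    ext v
    simp only [Finset.mem_filter, Finset.mem_range, Finset.mem_map, Finset.mem_univ, true_and,
      Fin.valEmbedding_apply]
    constructor
    · rintro ⟨-, h, hp⟩; exact ⟨_, hp, rfl⟩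
    · rintro ⟨v, hp, rfl⟩; exact ⟨v.2.trans_le (hn.le _), v.2, hp⟩
  show _ ∧ _ ↔ _
  refine (and_iff_left q.2.2).trans ?_
  rw [eq_comm]
  exact iff_of_eq (congrArg (fun c => (q.2 : ℕ) = c) hcard)

section vertices

variable {n : γ → ℕ} [hn : Below n] {u v : ∀ g, Fin (n g)} [Trm m fun g => (u g : ℕ)]
  [Trm m fun g => (v g : ℕ)]

instance Dfn.fin_eq : Dfn m fun g => u g = v g :=
  Dfn.of_iff (p := fun g => (u g : ℕ) = v g) inferInstance fun _ => Fin.ext_iff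

instance Dfn.fin_le : Dfn m fun g => u g ≤ v g :=
  Dfn.of_iff (p := fun g => (u g : ℕ) ≤ v g) inferInstance fun _ => Iff.rfl

instance Dfn.fin_lt : Dfn m fun g => u g < v g :=
  Dfn.of_iff (p := fun g => (u g : ℕ) < v g) inferInstance fun _ => Iff.rfl

end vertices

/-- A set of positions is definable at every bounded term. -/
theorem Dfn.rel {r : ℕ} (hr : r < m) [h : Trm m x] [hb : Bdd x] :
    Dfn m fun g => σ.sets (Ctx.base g) r (x g) := by
  have := h.out
  have : Dfn m fun q : Σ g : γ, Fin (size g) => σ.sets (Ctx.base q.1) r q.2 :=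
    ⟨.rel r 0, fun q R hR => by
      change _ ↔ σ.sets (Ctx.base q) r q.2
      rw [← hR r hr]
      exact and_iff_right q.2.2⟩
  refine Dfn.of_iff (p := fun g => ∃ a : Fin (size g), (a : ℕ) = x g ∧
    σ.sets (Ctx.base g) r a) inferInstance fun g => ?_
  constructor
  · exact fun h => ⟨⟨x g, hb.out g⟩, rfl, h⟩
  · rintro ⟨a, h₁, h₂⟩; rwa [← h₁]

end

end EdgeDeletion

namespace EdgeDeletion

/-! ### Computing sets of positions one after the other -/

section Reach

variable {A : Type} {σ : Sys (A × ℕ)} {init : A → ℕ → ℕ → Prop} {m : ℕ}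

/-- The context of a system without further variables. -/
abbrev Sys.ctx {B : Type} (σ : Sys B) : Ctx σ B := ⟨id, σ.env⟩

/-- Some program computes the first `m` sets of the system at the last stage. -/
def Reach (σ : Sys (A × ℕ)) (init : A → ℕ → ℕ → Prop) (m : ℕ) : Prop :=
  ∃ P : Prg, ∀ a, ∀ r < m, P.run (σ.size (a, 0)) (fun _ => σ.size (a, 0)) (init a) r =
    σ.sets (a, σ.size (a, 0)) r

theorem reach_init (h : ∀ a t, ∀ r < m, init a r = σ.sets (a, t) r) : Reach σ init m :=
  ⟨.set m (.rel 0 0), fun a r hr => by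
    rw [Prg.run, Function.update_of_ne hr.ne]; exact h _ _ r hr⟩

variable (hsize : ∀ a t, σ.size (a, t) = σ.size (a, 0))
  (henv : ∀ a t, σ.env (a, t) = cons t fun _ => σ.size (a, 0))
  (hlt : ∀ a t p, σ.sets (a, t) m p → p < σ.size (a, 0))

include hsize henv hlt

theorem Reach.set (h : Reach σ init m)
    (hd : letI := σ.ctx; Dfn m fun q : Σ b : A × ℕ, Fin (σ.size b) => σ.sets q.1 m q.2) :
    Reach σ init (m + 1) := by
  obtain ⟨P, hP⟩ := h
  obtain ⟨φ, hφ⟩ := hd.out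
  refine ⟨P.seq (.set m φ), fun a r hr => ?_⟩
  rw [Prg.run, Prg.run]
  rcases (Nat.lt_succ_iff.1 hr).lt_or_eq with h | rfl
  · rw [Function.update_of_ne h.ne, hP a r h]
  · rw [Function.update_self]
    funext v
    by_cases hv : v < σ.size (a, 0)
    -- At the last stage the round number equals the size, so the environment is constant and agrees
    -- with the one in which the program runs.
    · have := hφ ⟨(a, σ.size (a, 0)), v, by rwa [hsize]⟩ _ (hP a)
      simp only [size, Ctx.env, Ctx.base, id, henv, hsize] at this
      rw [propext (and_iff_right hv), propext this.symm]
      congr 2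
      funext i
      cases i <;> rfl
    · exact propext (iff_of_false (fun h => hv h.1) fun h => hv (hlt _ _ _ h))

/-- The loop variable is the round number, so one formula that defines set `m` at stage `t + 1` from
the sets at stage `t` can serve as the loop body. The sets below `m` do not change with the stage
and remain valid. -/
theorem Reach.loop (h : Reach σ init m) (h₀ : ∀ a p, ¬ σ.sets (a, 0) m p)
    (hst : ∀ a t, ∀ r < m, σ.sets (a, t) r = σ.sets (a, 0) r)
    (hd : letI := σ.ctx; Dfn (m + 1) fun q : Σ b : A × ℕ, Fin (σ.size b) =>
      σ.sets (q.1.1, q.1.2 + 1) m q.2) :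
    Reach σ init (m + 1) := by
  obtain ⟨P, hP⟩ := h
  obtain ⟨φ, hφ⟩ := hd.out
  -- `T` is a tautology and `.nand T T` a contradiction, which empties set `m` before the first
  -- round.
  let T : Fm := .nand (.rel m 0) (.nand (.rel m 0) (.rel m 0))
  refine ⟨P.seq (.seq (.set m (.nand T T)) (.loop (.set m φ))), fun a r hr => ?_⟩
  rw [Prg.run, Prg.run, Prg.run]
  set R₀ := (Prg.set m (.nand T T)).run (σ.size (a, 0)) (fun _ => σ.size (a, 0))
    (P.run (σ.size (a, 0)) (fun _ => σ.size (a, 0)) (init a)) with hR₀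
  suffices H : ∀ t, ∀ r < m + 1, iterSets (fun v => (Prg.set m φ).run (σ.size (a, 0))
      (cons v fun _ => σ.size (a, 0))) R₀ t r = σ.sets (a, t) r from H _ r hr
  intro t
  induction t with
  | zero =>
    intro r hr
    rw [iterSets, hR₀, Prg.run]
    rcases (Nat.lt_succ_iff.1 hr).lt_or_eq with h | rfl
    · rw [Function.update_of_ne h.ne, hP a r h, hst _ _ _ h]
    · rw [Function.update_self]
      funext v
      refine propext (iff_of_false (fun h => ?_) (h₀ a v))
      have h' := h.2
      simp only [Fm.eval, T] at h'
      tauto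
  | succ t ih =>
    intro r hr
    rw [iterSets, Prg.run]
    rcases (Nat.lt_succ_iff.1 hr).lt_or_eq with h | rfl
    · rw [Function.update_of_ne h.ne, ih r hr, hst _ _ _ h, hst a (t + 1) _ h]
    · rw [Function.update_self]
      funext v
      by_cases hv : v < σ.size (a, 0)
      · have := hφ ⟨(a, t), v, by rwa [hsize]⟩ _ ih
        simp only [size, Ctx.env, Ctx.base, id, henv, hsize] at this
        rw [propext (and_iff_right hv), ← propext this]
      · exact propext (iff_of_false (fun h => hv h.1) fun h => hv (hlt _ _ _ h))

end Reach

end EdgeDeletion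

namespace EdgeDeletion

open Classical

/-! ### Claws and diamonds -/

section Obstacles

variable {V : Type*}

/-- `a` is the center of an induced claw with leaves `b`, `c`, `d`. -/
def IsClaw (G : SimpleGraph V) (a b c d : V) : Prop :=
  (G.Adj a b ∧ G.Adj a c ∧ G.Adj a d) ∧ (b ≠ c ∧ b ≠ d ∧ c ≠ d) ∧
    ¬ G.Adj b c ∧ ¬ G.Adj b d ∧ ¬ G.Adj c d

/-- `a`, `b`, `c`, `d` induce a diamond without the edge `ad`. -/
def IsDiamond (G : SimpleGraph V) (a b c d : V) : Prop :=
  (G.Adj a b ∧ G.Adj a c ∧ G.Adj b c ∧ G.Adj b d ∧ G.Adj c d) ∧ a ≠ d ∧ ¬ G.Adj a d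

/-- A claw or a diamond. -/
def IsObstacle (G : SimpleGraph V) (a b c d : V) : Prop :=
  IsClaw G a b c d ∨ IsDiamond G a b c d

theorem isObstacle_iff_exists_emb {G : SimpleGraph V} :
    (∃ a b c d, IsObstacle G a b c d) ↔ ∃ H ∈ clawDiamond, SimpleGraph.IsIndContained H.2 G := by
  constructor
  · rintro ⟨a, b, c, d, h | h⟩
    · refine ⟨⟨4, claw⟩, Or.inl rfl, ⟨⟨⟨![a, b, c, d], ?_⟩, ?_⟩⟩⟩
      · obtain ⟨⟨h₁, h₂, h₃⟩, ⟨h₄, h₅, h₆⟩, -⟩ := h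
        intro i j hij
        fin_cases i <;> fin_cases j <;>
          simp_all [h₁.ne, h₂.ne, h₃.ne, h₁.ne', h₂.ne', h₃.ne', h₄.symm, h₅.symm, h₆.symm]
      · obtain ⟨⟨h₁, h₂, h₃⟩, -, h₄, h₅, h₆⟩ := h
        intro i j
        fin_cases i <;> fin_cases j <;>
          simp [claw, h₁, h₂, h₃, h₄, h₅, h₆, h₁.symm, h₂.symm, h₃.symm, G.adj_comm c b,
            G.adj_comm d b, G.adj_comm d c]
    · refine ⟨⟨4, diamond⟩, Or.inr rfl, ⟨⟨⟨![a, b, c, d], ?_⟩, ?_⟩⟩⟩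
      · obtain ⟨⟨h₁, h₂, h₃, h₄, h₅⟩, h₆, -⟩ := h
        intro i j hij
        fin_cases i <;> fin_cases j <;>
          simp_all [h₁.ne, h₂.ne, h₃.ne, h₄.ne, h₅.ne, h₁.ne', h₂.ne', h₃.ne', h₄.ne', h₅.ne',
            h₆.symm]
      · obtain ⟨⟨h₁, h₂, h₃, h₄, h₅⟩, -, h₆⟩ := h
        intro i j
        fin_cases i <;> fin_cases j <;>
          simp [diamond, h₁, h₂, h₃, h₄, h₅, h₆, h₁.symm, h₂.symm, h₃.symm, h₄.symm, h₅.symm,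
            G.adj_comm d a]
  · rintro ⟨H, rfl | rfl, ⟨φ⟩⟩
    · refine ⟨φ (0 : Fin 4), φ (1 : Fin 4), φ (2 : Fin 4), φ (3 : Fin 4), Or.inl ?_⟩
      simp only [IsClaw, φ.map_adj_iff, ne_eq, φ.injective.eq_iff]
      simp [claw]
    · refine ⟨φ (0 : Fin 4), φ (1 : Fin 4), φ (2 : Fin 4), φ (3 : Fin 4), Or.inr ?_⟩
      simp only [IsDiamond, φ.map_adj_iff, ne_eq, φ.injective.eq_iff]
      simp [diamond]

theorem isFree_iff {G : SimpleGraph V} :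
    IsFree clawDiamond G ↔ ∀ a b c d, ¬ IsObstacle G a b c d := by
  have := not_congr (isObstacle_iff_exists_emb (G := G))
  push Not at this
  exact this.symm

/-- Some edge induced by `a`, `b`, `c`, `d` has both ends in `X`. -/
def HasEdgeIn (G : SimpleGraph V) (X : Set V) (a b c d : V) : Prop :=
  (a ∈ X ∧ b ∈ X ∧ G.Adj a b) ∨ (a ∈ X ∧ c ∈ X ∧ G.Adj a c) ∨ (a ∈ X ∧ d ∈ X ∧ G.Adj a d) ∨
  (b ∈ X ∧ c ∈ X ∧ G.Adj b c) ∨ (b ∈ X ∧ d ∈ X ∧ G.Adj b d) ∨ (c ∈ X ∧ d ∈ X ∧ G.Adj c d)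

/-- Every claw and every diamond of `G` has an edge with both ends in `X`. -/
def Meets (G : SimpleGraph V) (X : Set V) : Prop :=
  ∀ a b c d, IsObstacle G a b c d → HasEdgeIn G X a b c d

variable {G : SimpleGraph V} {X : Set V}

/-- The common neighbors outside `X` of two adjacent vertices, not both in `X`, form a clique. -/
theorem Meets.adj_of_common (hX : Meets G X) {a b v w : V} (hab : G.Adj a b)
    (h : a ∉ X ∨ b ∉ X) (hv : v ∉ X) (hw : w ∉ X) (hvw : v ≠ w) (hav : G.Adj a v)
    (hbv : G.Adj b v) (haw : G.Adj a w) (hbw : G.Adj b w) : G.Adj v w := by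
  by_contra hn
  have := hX v a b w (Or.inr ⟨⟨hav.symm, hbv.symm, hab, haw, hbw⟩, hvw, hn⟩)
  unfold HasEdgeIn at this
  tauto

/-- Here `x` may belong to `X`: in the diamond that would arise, every edge contains `a` or `b`, and
both lie outside. -/
theorem Meets.adj_of_common' (hX : Meets G X) {a b x w : V} (hab : G.Adj a b)
    (ha : a ∉ X) (hb : b ∉ X) (hw : w ∉ X) (hvw : x ≠ w) (hav : G.Adj a x)
    (hbv : G.Adj b x) (haw : G.Adj a w) (hbw : G.Adj b w) : G.Adj x w := by
  by_contra hn
  have := hX x a b w (Or.inr ⟨⟨hav.symm, hbv.symm, hab, haw, hbw⟩, hvw, hn⟩)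
  unfold HasEdgeIn at this
  tauto

/-- Among three neighbors outside `X` of a vertex, two are adjacent. -/
theorem Meets.not_claw (hX : Meets G X) {a b c d : V} (hb : b ∉ X) (hc : c ∉ X)
    (hab : G.Adj a b) (hac : G.Adj a c) (had : G.Adj a d) (hbc : b ≠ c) (hbd : b ≠ d)
    (hcd : c ≠ d) (h : a ∉ X ∨ d ∉ X) : G.Adj b c ∨ G.Adj b d ∨ G.Adj c d := by
  by_contra hn
  push Not at hn
  have := hX a b c d (Or.inl ⟨⟨hab, hac, had⟩, ⟨hbc, hbd, hcd⟩, hn.1, hn.2.1, hn.2.2⟩)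
  unfold HasEdgeIn at this
  tauto

section Light

variable [Fintype V]

/-- The common neighbors outside `X`. -/
noncomputable def common (G : SimpleGraph V) (X : Set V) (a b : V) : Finset V :=
  Finset.univ.filter fun w => w ∉ X ∧ G.Adj a w ∧ G.Adj b w

theorem mem_common {a b w : V} : w ∈ common G X a b ↔ w ∉ X ∧ G.Adj a w ∧ G.Adj b w := by
  simp [common]

/-- An edge with few common neighbors outside `X`. -/
def IsLight (G : SimpleGraph V) (X : Set V) (k : ℕ) (a b : V) : Prop :=
  G.Adj a b ∧ (common G X a b).card ≤ 2 * k + 2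

/-- Add to `T` all vertices outside `X` joined to `T` by a light edge. -/
def expand (G : SimpleGraph V) (X : Set V) (k : ℕ) (T : Set V) : Set V :=
  {v | v ∈ T ∨ (v ∉ X ∧ ∃ u ∈ T, IsLight G X k u v)}

theorem subset_expand (k : ℕ) (T : Set V) : T ⊆ expand G X k T := fun _ => Or.inl

/-- A light neighbor `b` together with its common neighbors with `u` accounts for at most 2k + 3
vertices. If a second light neighbor `c` is not covered, the absence of claws makes every further
one adjacent to `b` or `c`, so two such groups suffice. -/
theorem Meets.ncard_light_le (hX : Meets G X) (k : ℕ) (u : V) :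
    {v | v ∉ X ∧ IsLight G X k u v}.ncard ≤ 4 * k + 6 := by
  have hcard : ∀ b, IsLight G X k u b → (insert b (common G X u b)).card ≤ 2 * k + 3 :=
    fun b hb => (Finset.card_insert_le _ _).trans (by have := hb.2; omega)
  have hin : ∀ b v, IsLight G X k u v → v ∉ X → G.Adj b v → v ∈ insert b (common G X u b) :=
    fun b v hv hvX h => Finset.mem_insert_of_mem (mem_common.2 ⟨hvX, hv.1, h⟩)
  by_cases h₁ : ∃ b, b ∉ X ∧ IsLight G X k u b
  swap
  · rw [Set.eq_empty_of_forall_notMem (s := {v | v ∉ X ∧ IsLight G X k u v})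
      fun v hv => h₁ ⟨v, hv⟩]
    simp
  obtain ⟨b, hbX, hb⟩ := h₁
  by_cases h₂ : ∃ c, c ∉ X ∧ IsLight G X k u c ∧ c ∉ insert b (common G X u b)
  · obtain ⟨c, hcX, hc, hcb⟩ := h₂
    have hbc : b ≠ c := by rintro rfl; simp at hcb
    have hnbc : ¬ G.Adj b c := fun h => hcb (hin b c hc hcX h)
    have hsub : {v | v ∉ X ∧ IsLight G X k u v} ⊆
        ((insert b (common G X u b) ∪ insert c (common G X u c) : Finset V) : Set V) := by
      rintro v ⟨hvX, hv⟩
      rw [Finset.mem_coe, Finset.mem_union]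
      by_cases hvb : b = v
      · subst hvb; simp
      by_cases hvc : c = v
      · subst hvc; simp
      rcases hX.not_claw hbX hcX hb.1 hc.1 hv.1 hbc hvb hvc (Or.inr hvX) with h | h | h
      · exact absurd h hnbc
      · exact Or.inl (hin b v hv hvX h)
      · exact Or.inr (hin c v hv hvX h)
    refine (Set.ncard_le_ncard hsub (Finset.finite_toSet _)).trans ?_
    rw [Set.ncard_coe_finset]
    refine (Finset.card_union_le _ _).trans ?_
    have := hcard b hb
    have := hcard c hc
    omega
  · push Not at h₂
    have hsub : {v | v ∉ X ∧ IsLight G X k u v} ⊆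
        ((insert b (common G X u b) : Finset V) : Set V) := fun v hv => h₂ v hv.1 hv.2
    refine (Set.ncard_le_ncard hsub (Finset.finite_toSet _)).trans ?_
    rw [Set.ncard_coe_finset]
    have := hcard b hb
    omega

theorem Meets.ncard_expand_le (hX : Meets G X) (k : ℕ) (T : Set V) :
    (expand G X k T).ncard ≤ T.ncard * (4 * k + 7) := by
  have hfin : ∀ s : Set V, s.Finite := fun s => s.toFinite
  have hsub : expand G X k T ⊆
      ((T.toFinset ∪ T.toFinset.biUnion fun u =>
        {v | v ∉ X ∧ IsLight G X k u v}.toFinset : Finset V) : Set V) := by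
    rintro v (h | ⟨hv, u, hu, h⟩)
    · simp [h]
    · simp only [Finset.coe_union, Set.mem_union, Finset.mem_coe, Finset.mem_biUnion,
        Set.mem_toFinset]
      exact Or.inr ⟨u, hu, hv, h⟩
  refine (Set.ncard_le_ncard hsub (Finset.finite_toSet _)).trans ?_
  rw [Set.ncard_coe_finset]
  refine (Finset.card_union_le _ _).trans ?_
  have h₁ : (T.toFinset.biUnion fun u =>
      {v | v ∉ X ∧ IsLight G X k u v}.toFinset).card ≤ T.toFinset.card * (4 * k + 6) := by
    refine Finset.card_biUnion_le_card_mul _ _ _ fun u _ => ?_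
    rw [← Set.ncard_eq_toFinset_card']
    exact hX.ncard_light_le k u
  rw [Set.ncard_eq_toFinset_card' T]
  linarith

end Light

end Obstacles

end EdgeDeletion

namespace EdgeDeletion

open Classical

/-! ### Moving a solution close to X -/

section Trim

variable {V : Type*} {G : SimpleGraph V} {X : Set V} {k : ℕ} {F : Finset (Sym2 V)}

/-- Many vertices contain two that are not touched by a small set of edges. -/
theorem exists_untouched (hF : F.card ≤ k) {W : Finset V} (hW : 2 * k + 2 ≤ W.card) :
    ∃ u ∈ W, ∃ v ∈ W, u ≠ v ∧ (∀ w, s(u, w) ∉ F) ∧ ∀ w, s(v, w) ∉ F := by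
  -- An edge touches at most two vertices, so 2k + 2 candidates leave two untouched.
  have h₁ : (F.biUnion Sym2.toFinset).card ≤ F.card * 2 := by
    refine Finset.card_biUnion_le_card_mul _ _ _ fun e _ => ?_
    rw [Sym2.card_toFinset]
    split_ifs <;> omega
  have h₂ : 1 < (W \ F.biUnion Sym2.toFinset).card := by
    have := Finset.le_card_sdiff (F.biUnion Sym2.toFinset) W
    omega
  obtain ⟨u, hu, v, hv, huv⟩ := Finset.one_lt_card.1 h₂
  rw [Finset.mem_sdiff, Finset.mem_biUnion] at hu hv
  refine ⟨u, hu.1, v, hv.1, huv, fun w hw => hu.2 ⟨_, hw, ?_⟩, fun w hw => hv.2 ⟨_, hw, ?_⟩⟩ <;>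
    simp [Sym2.mem_toFinset]

/-- A heavy edge is not deleted by a small solution. -/
theorem Meets.common_le_of_mem [Fintype V] (hX : Meets G X) (hF : F.card ≤ k)
    (hFG : (F : Set (Sym2 V)) ⊆ G.edgeSet)
    (hfree : ∀ a b c d, ¬ IsObstacle (G.deleteEdges (F : Set (Sym2 V))) a b c d) {a b : V}
    (hab : s(a, b) ∈ F) (h : a ∉ X ∨ b ∉ X) : (common G X a b).card ≤ 2 * k + 1 := by
  by_contra hn
  obtain ⟨v, hv, w, hw, hvw, hv', hw'⟩ := exists_untouched hF (W := common G X a b) (by omega)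
  have hadj : G.Adj a b := hFG hab
  rw [mem_common] at hv hw
  -- The untouched vertices `v` and `w` are adjacent, and with the ends of the deleted edge `ab`
  -- they induce a diamond lacking that edge.
  refine hfree a v w b (Or.inr ⟨⟨?_, ?_, ?_, ?_, ?_⟩, hadj.ne, ?_⟩) <;>
    simp only [SimpleGraph.deleteEdges_adj, Finset.mem_coe]
  · exact ⟨hv.2.1, by rw [Sym2.eq_swap]; exact hv' a⟩
  · exact ⟨hw.2.1, by rw [Sym2.eq_swap]; exact hw' a⟩
  · exact ⟨hX.adj_of_common hadj h hv.1 hw.1 hvw hv.2.1 hv.2.2 hw.2.1 hw.2.2, hv' w⟩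
  · exact ⟨hv.2.2.symm, hv' b⟩
  · exact ⟨hw.2.2.symm, hw' b⟩
  · exact fun h => h.2 hab

/-- The edge `uv` meets `X` or its clique in `G - X` is joined to `X`. -/
def Attached (G : SimpleGraph V) (X : Set V) (u v : V) : Prop :=
  u ∈ X ∨ v ∈ X ∨ ∃ x ∈ X, G.Adj x u ∧ G.Adj x v

theorem Attached.symm {u v : V} (h : Attached G X u v) : Attached G X v u := by
  rcases h with h | h | ⟨x, hx, hu, hv⟩
  exacts [Or.inr (Or.inl h), Or.inl h, Or.inr (Or.inr ⟨x, hx, hv, hu⟩)]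

/-- A vertex of `X` adjacent to `u` and `v` is also adjacent to their common neighbor `w`. For edges
of `G - X`, attachment is thus a property of the clique containing the edge. -/
theorem Meets.attached_congr (hX : Meets G X) {u v w : V} (hu : u ∉ X) (hv : v ∉ X) (hw : w ∉ X)
    (huv : G.Adj u v) (huw : G.Adj u w) (hvw : G.Adj v w) (h : Attached G X u v) :
    Attached G X u w := by
  rcases h with h | h | ⟨x, hx, hxu, hxv⟩
  · exact absurd h hu
  · exact absurd h hv
  · exact Or.inr (Or.inr ⟨x, hx, hxu, hX.adj_of_common' huv hu hv hw (by rintro rfl; exact hw hx)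
      hxu.symm hxv.symm huw hvw⟩)

/-- `v` belongs to `S`, and `F` separates `v` from its clique in `G - X` that contains `w`. -/
def Isolated (G : SimpleGraph V) (X S : Set V) (F : Finset (Sym2 V)) (v w : V) : Prop :=
  v ∈ S ∧ s(v, w) ∈ F ∧ ∀ w', w' ∉ X → G.Adj v w' → G.Adj w w' → s(v, w') ∈ F

/-- The vertices `v` and `w` name the same clique of `u` in `G - X`: a further common neighbor of
`u` and `w` outside `X` is also adjacent to `v`. -/
theorem Meets.isolated_congr {S : Set V} (hX : Meets G X) {u v w : V} (hv : v ∉ X) (hw : w ∉ X)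
    (huv : G.Adj u v) (huw : G.Adj u w) (hvw : G.Adj v w) (h : Isolated G X S F u v) :
    Isolated G X S F u w := by
  refine ⟨h.1, h.2.2 w hw huw hvw, fun w' hw' huw' hww' => ?_⟩
  by_cases hvw' : v = w'
  · exact hvw' ▸ h.2.1
  · exact h.2.2 w' hw' huw' (hX.adj_of_common huw (Or.inr hw) hv hw' hvw' huv hvw.symm huw' hww')

/-- The deleted edges that cannot be restored. -/
def Essential (G : SimpleGraph V) (X S : Set V) (F : Finset (Sym2 V)) (u v : V) : Prop :=
  s(u, v) ∈ F ∧ (Attached G X u v ∨ Isolated G X S F u v ∨ Isolated G X S F v u)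

theorem Essential.symm {S : Set V} {u v : V} (h : Essential G X S F u v) :
    Essential G X S F v u :=
  ⟨by rw [Sym2.eq_swap]; exact h.1, h.2.imp Attached.symm Or.symm⟩

/-- The essential edges of `F`. -/
noncomputable def essential (G : SimpleGraph V) (X S : Set V) (F : Finset (Sym2 V)) :
    Finset (Sym2 V) :=
  F.filter fun e => ∃ u v, e = s(u, v) ∧ Essential G X S F u v

theorem essential_subset (S : Set V) : essential G X S F ⊆ F := Finset.filter_subset _ _

theorem mem_essential {S : Set V} {u v : V} :
    s(u, v) ∈ essential G X S F ↔ Essential G X S F u v := by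
  simp only [essential, Finset.mem_filter]
  constructor
  · rintro ⟨-, u', v', h, he⟩
    rcases Sym2.eq_iff.1 h with ⟨rfl, rfl⟩ | ⟨rfl, rfl⟩
    exacts [he, he.symm]
  · exact fun h => ⟨h.1, u, v, rfl, h⟩

section

variable [Fintype V] (hX : Meets G X) (hF : F.card ≤ k) (hFG : (F : Set (Sym2 V)) ⊆ G.edgeSet)
  (hfree : ∀ a b c d, ¬ IsObstacle (G.deleteEdges (F : Set (Sym2 V))) a b c d)

include hX hF hFG hfree

/-- A deleted edge has at most 2k + 1 common neighbors. When both ends lie outside `X`, the edge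
from the attaching vertex `x` to `v` has the same ones plus possibly `u`, hence is still light. -/
theorem Meets.mem_expand_of_attached {u v : V} (huv : s(u, v) ∈ F) (h : Attached G X u v) :
    v ∈ expand G X k X := by
  by_cases hv : v ∈ X
  · exact Or.inl hv
  have hadj : G.Adj u v := hFG huv
  have hc := hX.common_le_of_mem hF hFG hfree huv (Or.inr hv)
  refine Or.inr ⟨hv, ?_⟩
  by_cases hu : u ∈ X
  · exact ⟨u, hu, hadj, by omega⟩
  rcases h with h | h | ⟨x, hx, hxu, hxv⟩
  · exact absurd h hu
  · exact absurd h hv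
  refine ⟨x, hx, hxv, ?_⟩
  have hsub : common G X x v ⊆ insert u (common G X u v) := by
    intro w hw
    rw [mem_common] at hw
    by_cases hwu : u = w
    · simp [hwu]
    · exact Finset.mem_insert_of_mem (mem_common.2 ⟨hw.1, hX.adj_of_common hxv (Or.inr hv) hu hw.1
        hwu hxu hadj.symm hw.2.1 hw.2.2, hw.2.2⟩)
  have := Finset.card_le_card hsub
  have := Finset.card_insert_le u (common G X u v)
  omega

/-- The second layer is needed for isolation: there one end lies in the first expansion and the
other end is reached from it by the deleted edge, which is light. -/
theorem Meets.mem_expand_of_essential {u v : V}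
    (h : Essential G X (expand G X k X) F u v) : v ∈ expand G X k (expand G X k X) := by
  by_cases hatt : Attached G X u v
  · exact Or.inl (hX.mem_expand_of_attached hF hFG hfree h.1 hatt)
  have hu : u ∉ X := fun h => hatt (Or.inl h)
  have hv : v ∉ X := fun h => hatt (Or.inr (Or.inl h))
  rcases h.2 with h' | h' | h'
  · exact absurd h' hatt
  · have := hX.common_le_of_mem hF hFG hfree h.1 (Or.inr hv)
    exact Or.inr ⟨hv, u, h'.1, hFG h.1, by omega⟩
  · exact Or.inl h'.1

end

section

variable (hX : Meets G X) {S : Set V}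

include hX

/-- The triangle lies outside `X` in one clique. Attachment of `bc` would pass to `ab`, and
isolation of `b` or `c` from that clique would make `ab` or `ac` essential. -/
theorem Meets.trim_adj {a b c : V} (hatt : ¬ Attached G X a b)
    (hab : G.Adj a b) (hab' : ¬ Essential G X S F a b) (hac : G.Adj a c)
    (hac' : ¬ Essential G X S F a c) (hbc : G.Adj b c) : ¬ Essential G X S F b c := by
  have ha : a ∉ X := fun h => hatt (Or.inl h)
  have hb : b ∉ X := fun h => hatt (Or.inr (Or.inl h))
  have hc : c ∉ X := fun h => hatt (Or.inr (Or.inr ⟨c, h, hac.symm, hbc.symm⟩))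
  rintro ⟨-, h | h | h⟩
  · exact hatt (hX.attached_congr hb hc ha hbc hab.symm hac.symm h).symm
  · have := hX.isolated_congr hc ha hbc hab.symm hac.symm h
    exact hab' (Essential.symm ⟨this.2.1, Or.inr (Or.inl this)⟩)
  · have := hX.isolated_congr hb ha hbc.symm hac.symm hab.symm h
    exact hac' (Essential.symm ⟨this.2.1, Or.inr (Or.inl this)⟩)

theorem Meets.attached_triangle {a b c : V} (hab : G.Adj a b) (hac : G.Adj a c)
    (hbc : G.Adj b c) (h : Attached G X a c) : Attached G X a b := by
  by_cases ha : a ∈ X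
  · exact Or.inl ha
  by_cases hb : b ∈ X
  · exact Or.inr (Or.inl hb)
  by_cases hc : c ∈ X
  · exact Or.inr (Or.inr ⟨c, hc, hac.symm, hbc.symm⟩)
  exact hX.attached_congr ha hc hb hac hab hbc.symm h

variable (hfree : ∀ a b c d, ¬ IsObstacle (G.deleteEdges (F : Set (Sym2 V))) a b c d)

include hfree

/-- If `bc` is attached, then so are all five edges, and attached edges are never restored: the
diamond already exists after deleting `F`. If it is not attached, all four vertices lie in one
clique outside `X`, and `ad` survives by `trim_adj`. -/
theorem Meets.trim_not_diamond (a b c d : V) :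
    ¬ IsDiamond (G.deleteEdges (essential G X S F : Set (Sym2 V))) a b c d := by
  simp only [IsDiamond, SimpleGraph.deleteEdges_adj, Finset.mem_coe, mem_essential]
  rintro ⟨⟨⟨hab, hab'⟩, ⟨hac, hac'⟩, ⟨hbc, hbc'⟩, ⟨hbd, hbd'⟩, ⟨hcd, hcd'⟩⟩, hne, had⟩
  have hatt : ¬ Attached G X b c := by
    intro hatt
    have h₁ : Attached G X a b :=
      (hX.attached_triangle hab.symm hbc hac hatt).symm
    have h₂ : Attached G X a c :=
      (hX.attached_triangle hac.symm hbc.symm hab hatt.symm).symm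
    have h₃ : Attached G X b d := hX.attached_triangle hbd hbc hcd.symm hatt
    have h₄ : Attached G X c d := hX.attached_triangle hcd hbc.symm hbd.symm hatt.symm
    have key : ∀ u v, Attached G X u v → ¬ Essential G X S F u v → s(u, v) ∉ F :=
      fun u v h h' h'' => h' ⟨h'', Or.inl h⟩
    refine hfree a b c d (Or.inr ⟨⟨?_, ?_, ?_, ?_, ?_⟩, hne, ?_⟩) <;>
      simp only [SimpleGraph.deleteEdges_adj, Finset.mem_coe]
    · exact ⟨hab, key _ _ h₁ hab'⟩
    · exact ⟨hac, key _ _ h₂ hac'⟩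
    · exact ⟨hbc, key _ _ hatt hbc'⟩
    · exact ⟨hbd, key _ _ h₃ hbd'⟩
    · exact ⟨hcd, key _ _ h₄ hcd'⟩
    · exact fun h => had ⟨h.1, fun h' => h.2 h'.1⟩
  have hb : b ∉ X := fun h => hatt (Or.inl h)
  have hc : c ∉ X := fun h => hatt (Or.inr (Or.inl h))
  have hd : d ∉ X := fun h => hatt (Or.inr (Or.inr ⟨d, h, hbd.symm, hcd.symm⟩))
  have ha : a ∉ X := fun h => hatt (Or.inr (Or.inr ⟨a, h, hab, hac⟩))
  have hadj : G.Adj a d :=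
    hX.adj_of_common hbc (Or.inl hb) ha hd hne hab.symm hac.symm hbd hcd
  refine had ⟨hadj, hX.trim_adj (a := b) (fun h => hatt ?_) hab.symm (fun h => hab' h.symm) hbd
    hbd' hadj⟩
  exact hX.attached_triangle hbc hab.symm hac.symm h

/-- The claw contains a restored edge `ab`, whose clique is not attached to `X`. The two other
leaves lie off this clique, and various replacements of one vertex turn the claw into an obstacle
that `F` itself would have left, unless essentiality or heaviness is contradicted. -/
theorem Meets.trim_not_claw [Fintype V] (hF : F.card ≤ k) (hFG : (F : Set (Sym2 V)) ⊆ G.edgeSet)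
    (hS : S = expand G X k X) {a b c d : V}
    (hab : G.Adj a b) (hab' : ¬ Essential G X S F a b) (habF : s(a, b) ∈ F)
    (hac : G.Adj a c) (hac' : ¬ Essential G X S F a c)
    (had : G.Adj a d) (had' : ¬ Essential G X S F a d)
    (hbc : b ≠ c) (hbd : b ≠ d) (hcd : c ≠ d)
    (nbc : G.Adj b c → Essential G X S F b c) (nbd : G.Adj b d → Essential G X S F b d)
    (ncd : G.Adj c d → Essential G X S F c d) : False := by
  have hatt : ¬ Attached G X a b := fun h => hab' ⟨habF, Or.inl h⟩
  have ha : a ∉ X := fun h => hatt (Or.inl h)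
  have hb : b ∉ X := fun h => hatt (Or.inr (Or.inl h))
  have gbc : ¬ G.Adj b c := fun h => hX.trim_adj hatt hab hab' hac hac' h (nbc h)
  have gbd : ¬ G.Adj b d := fun h => hX.trim_adj hatt hab hab' had had' h (nbd h)
  -- If `ac` were restored as well, `c` would lie outside `X` and `b`, `c`, `d` would be pairwise
  -- nonadjacent in `G`: a claw without an edge in `X`.
  have hacF : s(a, c) ∉ F := by
    intro hacF
    have hatt' : ¬ Attached G X a c := fun h => hac' ⟨hacF, Or.inl h⟩
    have hc : c ∉ X := fun h => hatt' (Or.inr (Or.inl h))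
    have gcd : ¬ G.Adj c d := fun h => hX.trim_adj hatt' hac hac' had had' h (ncd h)
    rcases hX.not_claw hb hc hab hac had hbc hbd hcd (Or.inl ha) with h | h | h
    exacts [gbc h, gbd h, gcd h]
  have hadF : s(a, d) ∉ F := by
    intro hadF
    have hatt' : ¬ Attached G X a d := fun h => had' ⟨hadF, Or.inl h⟩
    have hd : d ∉ X := fun h => hatt' (Or.inr (Or.inl h))
    have gcd : ¬ G.Adj c d := fun h => hX.trim_adj hatt' had had' hac hac' h.symm (ncd h).symm
    rcases hX.not_claw hb hd hab had hac hbd hbc hcd.symm (Or.inl ha) with h | h | h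
    exacts [gbd h, gbc h, gcd h.symm]
  have hcdF : G.Adj c d → s(c, d) ∈ F := fun h => (ncd h).1
  -- If `a` were in the first expansion, then `ab` being inessential would leave an undeleted edge
  -- `aw` in the clique of `ab`; replacing `b` by `w` gives a claw after deleting `F`.
  have haS : a ∉ S := by
    intro haS
    have hiso : ¬ Isolated G X S F a b := fun h => hab' ⟨habF, Or.inr (Or.inl h)⟩
    unfold Isolated at hiso
    push Not at hiso
    obtain ⟨w, hw, haw, hbw, hawF⟩ := hiso haS habF
    have hout : ∀ v, G.Adj a v → b ≠ v → ¬ G.Adj b v → v ≠ w ∧ ¬ G.Adj w v := by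
      intro v hav hbv gbv
      refine ⟨by rintro rfl; exact gbv hbw, fun h => ?_⟩
      by_cases hv : v ∈ X
      · exact hatt (hX.attached_congr ha hw hb haw hab hbw.symm
          (Or.inr (Or.inr ⟨v, hv, hav.symm, h.symm⟩)))
      · exact gbv (hX.adj_of_common haw (Or.inl ha) hb hv hbv hab hbw.symm hav h)
    obtain ⟨h₁, h₂⟩ := hout c hac hbc gbc
    obtain ⟨h₃, h₄⟩ := hout d had hbd gbd
    refine hfree a w c d (Or.inl ⟨⟨?_, ?_, ?_⟩, ⟨h₁.symm, h₃.symm, hcd⟩, ?_, ?_, ?_⟩) <;>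
      simp only [SimpleGraph.deleteEdges_adj, Finset.mem_coe]
    · exact ⟨haw, hawF⟩
    · exact ⟨hac, hacF⟩
    · exact ⟨had, hadF⟩
    · exact fun h => h₂ h.1
    · exact fun h => h₄ h.1
    · exact fun h => h.2 (hcdF h.1)
  -- Outside the first expansion, `a` can only be joined to `X` by heavy edges.
  have hheavy : ∀ x ∈ X, G.Adj x a → 2 * k + 2 < (common G X x a).card := by
    intro x hx hxa
    by_contra hn
    exact haS (hS ▸ Or.inr ⟨ha, x, hx, hxa, not_lt.1 hn⟩)
  have hout : ∀ x ∈ X, G.Adj a x → ∀ w, w ∉ X → G.Adj x w → G.Adj a w →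
      b ≠ w ∧ ¬ G.Adj b w := by
    intro x hx hax w hw hxw haw
    refine ⟨?_, fun h => ?_⟩
    · rintro rfl
      exact hatt (Or.inr (Or.inr ⟨x, hx, hax.symm, hxw⟩))
    · exact hatt (hX.attached_congr ha hw hb haw hab h.symm
        (Or.inr (Or.inr ⟨x, hx, hax.symm, hxw⟩)))
  -- A leaf `x` in `X` shares with `a` many neighbors, one of them an untouched `w` different from
  -- `y`. It turns out adjacent to `y`, so that `x`, `a`, `w`, `y` induce a diamond after deleting
  -- `F`.
  have main : ∀ x y, x ∈ X → G.Adj a x → s(a, x) ∉ F → G.Adj a y → s(a, y) ∉ F → x ≠ y →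
      b ≠ y → ¬ G.Adj b y → (G.Adj x y → s(x, y) ∈ F) → False := by
    intro x y hx hax haxF hay hayF hxy hby gby hxyF
    obtain ⟨w, hw, hwy, hwF⟩ : ∃ w ∈ common G X x a, w ≠ y ∧ ∀ u, s(w, u) ∉ F := by
      obtain ⟨u, hu, v, hv, huv, hu', hv'⟩ :=
        exists_untouched hF (W := common G X x a) (hheavy x hx hax.symm).le
      by_cases huy : u = y
      · exact ⟨v, hv, by rintro rfl; exact huv huy, hv'⟩
      · exact ⟨u, hu, huy, hu'⟩
    rw [mem_common] at hw
    obtain ⟨hbw, gbw⟩ := hout x hx hax w hw.1 hw.2.1 hw.2.2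
    -- The neighbors of `a` outside `X` that avoid the clique of `b` are pairwise adjacent, as
    -- otherwise they form a claw with `b`. If `y` is in `X`, a common neighbor `w'` of `y` and `a`
    -- serves as intermediary.
    have hadj : G.Adj w y := by
      by_cases hy : y ∈ X
      · obtain ⟨w', hw'⟩ := Finset.card_pos.1 ((Nat.zero_le _).trans_lt (hheavy y hy hay.symm))
        rw [mem_common] at hw'
        obtain ⟨hbw', gbw'⟩ := hout y hy hay w' hw'.1 hw'.2.1 hw'.2.2
        by_cases hww' : w = w'
        · rw [hww']; exact hw'.2.1.symm
        · have : G.Adj w w' := by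
            rcases hX.not_claw hb hw.1 hab hw.2.2 hw'.2.2 hbw hbw' hww' (Or.inl ha) with h | h | h
            exacts [absurd h gbw, absurd h gbw', h]
          exact (hX.adj_of_common' hw'.2.2 ha hw'.1 hw.1 hwy.symm hay hw'.2.1.symm hw.2.2
            this.symm).symm
      · rcases hX.not_claw hb hw.1 hab hw.2.2 hay hbw hby hwy (Or.inl ha) with h | h | h
        exacts [absurd h gbw, absurd h gby, h]
    refine hfree x a w y (Or.inr ⟨⟨?_, ?_, ?_, ?_, ?_⟩, hxy, ?_⟩) <;>
      simp only [SimpleGraph.deleteEdges_adj, Finset.mem_coe]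
    · exact ⟨hax.symm, by rwa [Sym2.eq_swap]⟩
    · exact ⟨hw.2.1, by rw [Sym2.eq_swap]; exact hwF x⟩
    · exact ⟨hw.2.2, by rw [Sym2.eq_swap]; exact hwF a⟩
    · exact ⟨hay, hayF⟩
    · exact ⟨hadj, hwF y⟩
    · exact fun h => h.2 (hxyF h.1)
  by_cases hc : c ∈ X
  · exact main c d hc hac hacF had hadF hcd hbd gbd hcdF
  by_cases hd : d ∈ X
  · exact main d c hd had hadF hac hacF hcd.symm hbc gbc
      fun h => by rw [Sym2.eq_swap]; exact hcdF h.symm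
  have gcd : G.Adj c d := by
    rcases hX.not_claw hb hc hab hac had hbc hbd hcd (Or.inl ha) with h | h | h
    exacts [absurd h gbc, absurd h gbd, h]
  obtain ⟨hF', h | h | h⟩ := ncd gcd
  · rcases h with h | h | ⟨x, hx, hxc, hxd⟩
    · exact hc h
    · exact hd h
    have hxa : G.Adj x a := hX.adj_of_common' gcd hc hd ha (by rintro rfl; exact ha hx)
      hxc.symm hxd.symm hac.symm had.symm
    -- Beyond `c` and `d`, the common neighbors of `x` and `a` are those of `c` and `d` other than
    -- `a`: at most 2 + (2k + 1) - 1 = 2k + 2, against heaviness. This is where the threshold of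
    -- `IsLight` is tight.
    have hsub : common G X x a ⊆ insert c (insert d ((common G X c d).erase a)) := by
      intro w hw
      rw [mem_common] at hw
      simp only [Finset.mem_insert, Finset.mem_erase, mem_common]
      by_cases hwc : w = c
      · exact Or.inl hwc
      by_cases hwd : w = d
      · exact Or.inr (Or.inl hwd)
      exact Or.inr (Or.inr ⟨hw.2.2.ne', hw.1,
        hX.adj_of_common hxa (Or.inr ha) hc hw.1 (Ne.symm hwc) hxc hac hw.2.1 hw.2.2,
        hX.adj_of_common hxa (Or.inr ha) hd hw.1 (Ne.symm hwd) hxd had hw.2.1 hw.2.2⟩)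
    have h₁ := Finset.card_le_card hsub
    have h₂ := Finset.card_insert_le c (insert d ((common G X c d).erase a))
    have h₃ := Finset.card_insert_le d ((common G X c d).erase a)
    have h₄ := Finset.card_erase_of_mem (mem_common.2 ⟨ha, hac.symm, had.symm⟩ :
      a ∈ common G X c d)
    have h₅ := hX.common_le_of_mem hF hFG hfree hF' (Or.inl hc)
    have h₆ := hheavy x hx hxa
    omega
  · have := hX.isolated_congr hd ha gcd hac.symm had.symm h
    exact hac' (Essential.symm ⟨this.2.1, Or.inr (Or.inl this)⟩)
  · have := hX.isolated_congr hc ha gcd.symm had.symm hac.symm h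
    exact had' (Essential.symm ⟨this.2.1, Or.inr (Or.inl this)⟩)

end

/-- Every small solution contains a solution near `X`. -/
theorem Meets.exists_solution_near [Fintype V] (hX : Meets G X) (hF : F.card ≤ k)
    (hFG : (F : Set (Sym2 V)) ⊆ G.edgeSet)
    (hfree : ∀ a b c d, ¬ IsObstacle (G.deleteEdges (F : Set (Sym2 V))) a b c d) :
    ∃ F' ⊆ F, (∀ e ∈ F', ∀ v ∈ e, v ∈ expand G X k (expand G X k X)) ∧
      ∀ a b c d, ¬ IsObstacle (G.deleteEdges (F' : Set (Sym2 V))) a b c d := by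
  refine ⟨essential G X (expand G X k X) F, essential_subset _, ?_, ?_⟩
  · intro e he v hv
    induction e with | _ u w => ?_
    rw [mem_essential] at he
    rcases Sym2.mem_iff.1 hv with rfl | rfl
    · exact hX.mem_expand_of_essential hF hFG hfree he.symm
    · exact hX.mem_expand_of_essential hF hFG hfree he
  rintro a b c d (h | h)
  swap
  · exact hX.trim_not_diamond hfree a b c d h
  have h' := h
  simp only [IsClaw, SimpleGraph.deleteEdges_adj, Finset.mem_coe, mem_essential, not_and,
    not_not] at h
  obtain ⟨⟨⟨hab, hab'⟩, ⟨hac, hac'⟩, ⟨had, had'⟩⟩, ⟨hbc, hbd, hcd⟩, nbc, nbd, ncd⟩ := h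
  -- Up to permuting the leaves, either some edge of the claw was restored or the claw was already
  -- present after deleting `F`.
  by_cases h₁ : s(a, b) ∈ F
  · exact hX.trim_not_claw hfree hF hFG rfl hab hab' h₁ hac hac' had had' hbc hbd hcd nbc nbd ncd
  by_cases h₂ : s(a, c) ∈ F
  · exact hX.trim_not_claw hfree hF hFG rfl hac hac' h₂ hab hab' had had' hbc.symm hcd hbd
      (fun h => (nbc h.symm).symm) ncd nbd
  by_cases h₃ : s(a, d) ∈ F
  · exact hX.trim_not_claw hfree hF hFG rfl had had' h₃ hab hab' hac hac' hbd.symm hcd.symm hbc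
      (fun h => (nbd h.symm).symm) (fun h => (ncd h.symm).symm) nbc
  refine hfree a b c d (Or.inl ⟨⟨?_, ?_, ?_⟩, ⟨hbc, hbd, hcd⟩, ?_, ?_, ?_⟩) <;>
    simp only [SimpleGraph.deleteEdges_adj, Finset.mem_coe]
  · exact ⟨hab, h₁⟩
  · exact ⟨hac, h₂⟩
  · exact ⟨had, h₃⟩
  · exact fun h => h.2 (nbc h.1).1
  · exact fun h => h.2 (nbd h.1).1
  · exact fun h => h.2 (ncd h.1).1

end Trim

end EdgeDeletion

namespace EdgeDeletion

open Classical

/-! ### Obstacles as four-tuples -/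

theorem IsObstacle.of_iff {V W : Type*} {G : SimpleGraph V} {H : SimpleGraph W} {t : Fin 4 → V}
    {t' : Fin 4 → W} (hinj : ∀ i j, t i = t j ↔ t' i = t' j)
    (hadj : ∀ i j, G.Adj (t i) (t j) ↔ H.Adj (t' i) (t' j))
    (h : IsObstacle G (t 0) (t 1) (t 2) (t 3)) : IsObstacle H (t' 0) (t' 1) (t' 2) (t' 3) := by
  simpa only [IsObstacle, IsClaw, IsDiamond, hadj, ne_eq, hinj] using h

theorem IsObstacle.injective {V : Type*} {G : SimpleGraph V} {t : Fin 4 → V}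
    (h : IsObstacle G (t 0) (t 1) (t 2) (t 3)) : Function.Injective t := by
  rcases h with ⟨⟨h₁, h₂, h₃⟩, ⟨h₄, h₅, h₆⟩, -⟩ | ⟨⟨h₁, h₂, h₃, h₄, h₅⟩, h₆, -⟩
  · have := h₁.ne; have := h₂.ne; have := h₃.ne
    intro i j hij
    fin_cases i <;> fin_cases j <;> simp_all
  · have := h₁.ne; have := h₂.ne; have := h₃.ne; have := h₄.ne; have := h₅.ne
    intro i j hij
    fin_cases i <;> fin_cases j <;> simp_all

theorem hasEdgeIn_of {V : Type*} {G : SimpleGraph V} {X : Set V} {t : Fin 4 → V} {i j : Fin 4}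
    (hi : t i ∈ X) (hj : t j ∈ X) (hij : G.Adj (t i) (t j)) :
    HasEdgeIn G X (t 0) (t 1) (t 2) (t 3) := by
  have key : ∀ i j : Fin 4, t i ∈ X ∧ t j ∈ X ∧ G.Adj (t i) (t j) → i < j →
      HasEdgeIn G X (t 0) (t 1) (t 2) (t 3) := by
    intro i j h hlt
    fin_cases i <;> fin_cases j <;> first
      | exact absurd hlt (by decide)
      | exact Or.inl h
      | exact Or.inr (Or.inl h)
      | exact Or.inr (Or.inr (Or.inl h))
      | exact Or.inr (Or.inr (Or.inr (Or.inl h)))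
      | exact Or.inr (Or.inr (Or.inr (Or.inr (Or.inl h))))
      | exact Or.inr (Or.inr (Or.inr (Or.inr (Or.inr h))))
  rcases lt_trichotomy i j with h | h | h
  · exact key i j ⟨hi, hj, hij⟩ h
  · exact absurd hij (h ▸ G.loopless.irrefl _)
  · exact key j i ⟨hj, hi, hij.symm⟩ h

/-! ### Greedy packing of obstacles as a lower bound -/

section Greedy

variable {V : Type*} {G : SimpleGraph V}

/-- `X'` arises from `X` by adding the vertices of an obstacle without edges in `X`, if there is
one. -/
def GreedyStep (G : SimpleGraph V) (X X' : Set V) : Prop :=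
  (Meets G X ∧ X' = X) ∨
    ∃ a b c d, IsObstacle G a b c d ∧ ¬ HasEdgeIn G X a b c d ∧ X' = X ∪ {a, b, c, d}

theorem ncard_greedy_le {X : ℕ → Set V} (h₀ : X 0 = ∅) (h : ∀ t, GreedyStep G (X t) (X (t + 1)))
    (t : ℕ) : (X t).ncard ≤ 4 * t := by
  induction t with
  | zero => simp [h₀]
  | succ t ih =>
    rcases h t with ⟨-, h⟩ | ⟨a, b, c, d, -, -, h⟩
    · rw [h]; omega
    · rw [h]
      have h₁ := Set.ncard_union_le (X t) {a, b, c, d}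
      have h₂ := Set.ncard_insert_le a {b, c, d}
      have h₃ := Set.ncard_insert_le b {c, d}
      have h₄ := Set.ncard_insert_le c {d}
      rw [Set.ncard_singleton] at h₄
      omega

/-- As long as the greedy procedure finds obstacles, these have disjoint sets of edges. -/
theorem le_card_of_greedy {X : ℕ → Set V}
    (h : ∀ t, GreedyStep G (X t) (X (t + 1))) {F : Finset (Sym2 V)} (t : ℕ)
    (ht : ¬ Meets G (X t))
    (hF : ∀ a ∈ X t, ∀ b ∈ X t, ∀ c ∈ X t, ∀ d ∈ X t,
      ¬ IsObstacle (G.deleteEdges (F : Set (Sym2 V))) a b c d) :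
    t ≤ (F.filter fun e => ∀ v ∈ e, v ∈ X t).card := by
  induction t with
  | zero => simp
  | succ t ih =>
    rcases h t with ⟨hm, he⟩ | ⟨a, b, c, d, ho, hn, he⟩
    · rw [he] at ht; exact absurd hm ht
    have hsub : X t ⊆ X (t + 1) := by rw [he]; exact Set.subset_union_left
    have ih' := ih (fun hm => hn (hm a b c d ho)) fun a ha b hb c hc d hd =>
      hF a (hsub ha) b (hsub hb) c (hsub hc) d (hsub hd)
    have hmem : ∀ i, ![a, b, c, d] i ∈ X (t + 1) := by
      rw [he]; intro i; fin_cases i <;> simp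
    -- Some edge of the new obstacle is deleted; otherwise it would survive on the vertices of the
    -- next set.
    obtain ⟨i, j, hij, hijF⟩ : ∃ i j, G.Adj (![a, b, c, d] i) (![a, b, c, d] j) ∧
        s(![a, b, c, d] i, ![a, b, c, d] j) ∈ F := by
      by_contra hcon
      push Not at hcon
      refine hF a (hmem 0) b (hmem 1) c (hmem 2) d (hmem 3)
        (IsObstacle.of_iff (t := ![a, b, c, d]) (t' := ![a, b, c, d]) (fun _ _ => Iff.rfl)
          (fun i j => ?_) ho)
      simp only [SimpleGraph.deleteEdges_adj, Finset.mem_coe]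
      exact ⟨fun h => ⟨h, hcon i j h⟩, fun h => h.1⟩
    -- This deleted edge is not inside the previous set, so the count strictly increases.
    have hnot : ¬ (![a, b, c, d] i ∈ X t ∧ ![a, b, c, d] j ∈ X t) := by
      rintro ⟨hi, hj⟩
      exact hn (hasEdgeIn_of hi hj hij)
    refine Nat.succ_le_of_lt (ih'.trans_lt (Finset.card_lt_card ?_))
    rw [Finset.ssubset_iff_of_subset]
    · refine ⟨s(![a, b, c, d] i, ![a, b, c, d] j), ?_, ?_⟩
      · rw [Finset.mem_filter]
        refine ⟨hijF, fun v hv => ?_⟩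
        rcases Sym2.mem_iff.1 hv with rfl | rfl
        exacts [hmem i, hmem j]
      · rw [Finset.mem_filter]
        exact fun h => hnot ⟨h.2 _ (Sym2.mem_mk_left _ _), h.2 _ (Sym2.mem_mk_right _ _)⟩
    · intro e he'
      rw [Finset.mem_filter] at he' ⊢
      exact ⟨he'.1, fun v hv => hsub (he'.2 v hv)⟩

end Greedy

/-! ### Representatives for pairs of vertices not both in S -/

section Representatives

variable {V : Type*} {G : SimpleGraph V} {S X : Set V}

/-- The pairs `(u, v)` and `(u', v')` cannot be distinguished by `a`, `b` and `S`. -/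
def SameType (G : SimpleGraph V) (S : Set V) (a b u v u' v' : V) : Prop :=
  u' ∉ S ∧ u' ≠ v' ∧ (v ∈ S → v' = v) ∧ (v ∉ S → v' ∉ S) ∧ (G.Adj a u ↔ G.Adj a u') ∧
    (G.Adj b u ↔ G.Adj b u') ∧ (G.Adj a v ↔ G.Adj a v') ∧ (G.Adj b v ↔ G.Adj b v') ∧
    (G.Adj u v ↔ G.Adj u' v')

theorem SameType.trans {a b u v u' v' u'' v'' : V} (h : SameType G S a b u v u' v')
    (h' : SameType G S a b u' v' u'' v'') : SameType G S a b u v u'' v'' := by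
  obtain ⟨h₁, h₂, h₃, h₄, h₅, h₆, h₇, h₈, h₉⟩ := h
  obtain ⟨i₁, i₂, i₃, i₄, i₅, i₆, i₇, i₈, i₉⟩ := h'
  refine ⟨i₁, i₂, fun h => ?_, fun h => i₄ (h₄ h), h₅.trans i₅, h₆.trans i₆, h₇.trans i₇,
    h₈.trans i₈, h₉.trans i₉⟩
  have := h₃ h
  rw [← this]
  exact i₃ (this ▸ h)

variable [LinearOrder V]

/-- The pair `(u, v)` is the least one of its type. -/
def IsLeast' (G : SimpleGraph V) (S : Set V) (a b u v : V) : Prop :=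
  ∀ u' v', SameType G S a b u v u' v' → u < u' ∨ (u = u' ∧ v ≤ v')

/-- The pair `(u, v)` represents a type. -/
def Kept (G : SimpleGraph V) (S : Set V) (u v : V) : Prop :=
  u ∉ S ∧ u ≠ v ∧ ∃ a ∈ S, ∃ b ∈ S, IsLeast' G S a b u v

/-- The vertices kept in the compressed instance. -/
def keptSet (G : SimpleGraph V) (X S : Set V) : Set V :=
  {v | v ∈ X ∨ v ∈ S ∨ (∃ u, Kept G S u v) ∨ ∃ u, Kept G S v u}

/-- Take the lexicographically least pair of the type. By transitivity of `SameType` it is also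
least for its own type, which is what `Kept` asks for. -/
theorem exists_kept [Finite V] {a b u v : V} (ha : a ∈ S) (hb : b ∈ S) (hu : u ∉ S)
    (huv : u ≠ v) : ∃ u' v', SameType G S a b u v u' v' ∧ Kept G S u' v' := by
  have := Fintype.ofFinite V
  obtain ⟨p, hp, hmin⟩ := Finset.exists_min_image
    (Finset.univ.filter fun p : V × V => SameType G S a b u v p.1 p.2) (fun p => toLex p)
    ⟨(u, v), Finset.mem_filter.2 ⟨Finset.mem_univ _, hu, huv, fun _ => rfl, id, Iff.rfl, Iff.rfl,
      Iff.rfl, Iff.rfl, Iff.rfl⟩⟩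
  rw [Finset.mem_filter] at hp
  refine ⟨p.1, p.2, hp.2, hp.2.1, hp.2.2.1, a, ha, b, hb, fun u'' v'' h => ?_⟩
  have := hmin (u'', v'') (by simpa using hp.2.trans h)
  rwa [Prod.Lex.toLex_le_toLex] at this

/-- A kept pair is determined by `a`, `b`, the second component if it lies in `S`, and five
adjacency bits, because two kept pairs with the same data are each at most the other. -/
theorem ncard_kept_le [Finite V] :
    {p : V × V | Kept G S p.1 p.2}.ncard ≤ 32 * (S.ncard * (S.ncard * (S.ncard + 1))) := by
  have := Fintype.ofFinite V
  have hex : ∀ p : V × V, ∃ a b, Kept G S p.1 p.2 → a ∈ S ∧ b ∈ S ∧ IsLeast' G S a b p.1 p.2 := by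
    intro p
    by_cases h : Kept G S p.1 p.2
    · obtain ⟨-, -, a, ha, b, hb, h⟩ := h
      exact ⟨a, b, fun _ => ⟨ha, hb, h⟩⟩
    · exact ⟨p.1, p.1, fun h' => absurd h' h⟩
  choose a b hab using hex
  let key : V × V → V × V × Option V × Bool × Bool × Bool × Bool × Bool := fun p =>
    (a p, b p, if p.2 ∈ S then some p.2 else none, decide (G.Adj (a p) p.1),
      decide (G.Adj (b p) p.1), decide (G.Adj (a p) p.2), decide (G.Adj (b p) p.2),
      decide (G.Adj p.1 p.2))
  have hcard : ((S.toFinset ×ˢ S.toFinset ×ˢ S.toFinset.insertNone ×ˢ Finset.univ :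
      Finset (V × V × Option V × Bool × Bool × Bool × Bool × Bool))).card =
      32 * (S.ncard * (S.ncard * (S.ncard + 1))) := by
    simp only [Finset.card_product, Finset.card_insertNone, Set.ncard_eq_toFinset_card' S,
      Finset.card_univ, Fintype.card_prod, Fintype.card_bool]
    ring
  rw [← hcard, ← Set.ncard_coe_finset]
  refine Set.ncard_le_ncard_of_injOn key ?_ ?_ (Finset.finite_toSet _)
  · intro p hp
    obtain ⟨ha, hb, -⟩ := hab p hp
    simp only [Finset.coe_product, Set.mem_prod, Finset.mem_coe, Set.mem_toFinset,
      Finset.mem_univ, and_true, key]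
    refine ⟨ha, hb, ?_⟩
    split_ifs with h <;> simp [h]
  · intro p hp q hq hpq
    obtain ⟨-, -, hp'⟩ := hab p hp
    obtain ⟨-, -, hq'⟩ := hab q hq
    simp only [key, Prod.mk.injEq, decide_eq_decide] at hpq
    obtain ⟨e₁, e₂, e₃, e₄, e₅, e₆, e₇, e₈⟩ := hpq
    rw [← e₁] at hq' e₄ e₆
    rw [← e₂] at hq' e₅ e₇
    have hS : (p.2 ∈ S → q.2 = p.2) ∧ (p.2 ∉ S → q.2 ∉ S) ∧ (q.2 ∈ S → p.2 = q.2) ∧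
        (q.2 ∉ S → p.2 ∉ S) := by
      by_cases h₁ : p.2 ∈ S <;> by_cases h₂ : q.2 ∈ S <;> simp_all
    have h₁ := hp' q.1 q.2 ⟨hq.1, hq.2.1, hS.1, hS.2.1, e₄, e₅, e₆, e₇, e₈⟩
    have h₂ := hq' p.1 p.2 ⟨hp.1, hp.2.1, hS.2.2.1, hS.2.2.2, e₄.symm, e₅.symm, e₆.symm, e₇.symm,
      e₈.symm⟩
    rcases h₁ with h₁ | ⟨h₁, h₁'⟩
    · rcases h₂ with h₂ | ⟨h₂, -⟩
      · exact absurd h₁ h₂.asymm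
      · exact absurd h₂.symm h₁.ne
    · rcases h₂ with h₂ | ⟨-, h₂'⟩
      · exact absurd h₁.symm h₂.ne
      · exact Prod.ext h₁ (le_antisymm h₁' h₂')

theorem ncard_keptSet_le [Finite V] :
    (keptSet G X S).ncard ≤
      X.ncard + S.ncard + 64 * (S.ncard * (S.ncard * (S.ncard + 1))) := by
  have hsub : keptSet G X S ⊆ X ∪ (S ∪ (Prod.snd '' {p : V × V | Kept G S p.1 p.2} ∪
      Prod.fst '' {p : V × V | Kept G S p.1 p.2})) := by
    rintro v (h | h | ⟨u, h⟩ | ⟨u, h⟩)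
    · exact Or.inl h
    · exact Or.inr (Or.inl h)
    · exact Or.inr (Or.inr (Or.inl ⟨(u, v), h, rfl⟩))
    · exact Or.inr (Or.inr (Or.inr ⟨(v, u), h, rfl⟩))
  have h₀ := Set.ncard_le_ncard hsub (Set.toFinite _)
  have h₁ := Set.ncard_union_le X (S ∪ (Prod.snd '' {p : V × V | Kept G S p.1 p.2} ∪
      Prod.fst '' {p : V × V | Kept G S p.1 p.2}))
  have h₂ := Set.ncard_union_le S (Prod.snd '' {p : V × V | Kept G S p.1 p.2} ∪
      Prod.fst '' {p : V × V | Kept G S p.1 p.2})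
  have h₃ := Set.ncard_union_le (Prod.snd '' {p : V × V | Kept G S p.1 p.2})
      (Prod.fst '' {p : V × V | Kept G S p.1 p.2})
  have h₄ := Set.ncard_image_le (f := Prod.snd) (Set.toFinite {p : V × V | Kept G S p.1 p.2})
  have h₅ := Set.ncard_image_le (f := Prod.fst) (Set.toFinite {p : V × V | Kept G S p.1 p.2})
  have h₆ := ncard_kept_le (G := G) (S := S)
  omega

/-- Replace the vertices of an obstacle outside `S` by kept vertices. -/
theorem exists_kept_tuple [Finite V] {H : SimpleGraph V}
    (hH : ∀ u v, u ∉ S ∨ v ∉ S → (H.Adj u v ↔ G.Adj u v)) {t : Fin 4 → V}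
    (ht : Function.Injective t) {i j : Fin 4} (hij : i ≠ j) (hi : t i ∈ S) (hj : t j ∈ S) :
    ∃ t' : Fin 4 → V, (∀ m, t' m ∈ keptSet G X S) ∧ (∀ m m', t m = t m' ↔ t' m = t' m') ∧
      ∀ m m', H.Adj (t m) (t m') ↔ H.Adj (t' m) (t' m') := by
  obtain ⟨k, l, hik, hil, hjk, hjl, hkl, hall⟩ : ∃ k l : Fin 4, i ≠ k ∧ i ≠ l ∧ j ≠ k ∧ j ≠ l ∧
      k ≠ l ∧ ∀ m, m = i ∨ m = j ∨ m = k ∨ m = l := by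
    have : ∀ i j : Fin 4, i ≠ j → ∃ k l : Fin 4, i ≠ k ∧ i ≠ l ∧ j ≠ k ∧ j ≠ l ∧
        k ≠ l ∧ ∀ m, m = i ∨ m = j ∨ m = k ∨ m = l := by decide
    exact this i j hij
  have hS : ∀ v ∈ S, v ∈ keptSet G X S := fun v hv => Or.inr (Or.inl hv)
  -- If one of the remaining vertices is outside `S`, it takes the role of `t k`, and the pair `(t
  -- k, t l)` is replaced by its representative relative to `t i` and `t j`. Nothing is assumed
  -- about `t l`, so both orders of the pair are covered.
  have main : ∀ k l : Fin 4, i ≠ k → i ≠ l → j ≠ k → j ≠ l → k ≠ l →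
      (∀ m, m = i ∨ m = j ∨ m = k ∨ m = l) → t k ∉ S →
      ∃ t' : Fin 4 → V, (∀ m, t' m ∈ keptSet G X S) ∧ (∀ m m', t m = t m' ↔ t' m = t' m') ∧
      ∀ m m', H.Adj (t m) (t m') ↔ H.Adj (t' m) (t' m') := by
    intro k l hik hil hjk hjl hkl hall hk
    obtain ⟨u', v', ⟨h₁, h₂, h₃, h₄, h₅, h₆, h₇, h₈, h₉⟩, hK⟩ :=
      exists_kept (G := G) hi hj hk (ht.ne hkl)
    have hne : ∀ m ∈ S, m ≠ u' := fun m hm h => h₁ (h ▸ hm)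
    have hv : t i ≠ v' ∧ t j ≠ v' := by
      by_cases hl : t l ∈ S
      · rw [h₃ hl]; exact ⟨ht.ne hil, ht.ne hjl⟩
      · exact ⟨fun h => h₄ hl (h ▸ hi), fun h => h₄ hl (h ▸ hj)⟩
    have aik : H.Adj (t i) (t k) ↔ H.Adj (t i) u' := by
      rw [hH _ _ (Or.inr hk), hH _ _ (Or.inr h₁), h₅]
    have ajk : H.Adj (t j) (t k) ↔ H.Adj (t j) u' := by
      rw [hH _ _ (Or.inr hk), hH _ _ (Or.inr h₁), h₆]
    have akl : H.Adj (t k) (t l) ↔ H.Adj u' v' := by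
      rw [hH _ _ (Or.inl hk), hH _ _ (Or.inl h₁), h₉]
    have ail : (H.Adj (t i) (t l) ↔ H.Adj (t i) v') ∧ (H.Adj (t j) (t l) ↔ H.Adj (t j) v') := by
      by_cases hl : t l ∈ S
      · rw [h₃ hl]; exact ⟨Iff.rfl, Iff.rfl⟩
      · rw [hH _ _ (Or.inr hl), hH _ _ (Or.inr (h₄ hl)), hH _ _ (Or.inr hl),
          hH _ _ (Or.inr (h₄ hl))]
        exact ⟨h₇, h₈⟩
    let t' : Fin 4 → V := fun m => if m = k then u' else if m = l then v' else t m
    have ti : t' i = t i := by simp [t', hik, hil]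
    have tj : t' j = t j := by simp [t', hjk, hjl]
    have tk : t' k = u' := by simp [t']
    have tl : t' l = v' := by simp [t', hkl.symm]
    refine ⟨t', fun m => ?_, fun m m' => ?_, fun m m' => ?_⟩
    · rcases hall m with rfl | rfl | rfl | rfl
      · rw [ti]; exact hS _ hi
      · rw [tj]; exact hS _ hj
      · rw [tk]; exact Or.inr (Or.inr (Or.inr ⟨v', hK⟩))
      · rw [tl]; exact Or.inr (Or.inr (Or.inl ⟨u', hK⟩))
    · rw [ht.eq_iff]
      have := hne _ hi
      have := hne _ hj
      have := ht.ne hij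
      rcases hall m with rfl | rfl | rfl | rfl <;> rcases hall m' with rfl | rfl | rfl | rfl <;>
        simp only [ti, tj, tk, tl] <;> clear hall ail aik ajk akl h₅ h₆ h₇ h₈ h₉ hH <;> grind
    · rcases hall m with rfl | rfl | rfl | rfl <;> rcases hall m' with rfl | rfl | rfl | rfl <;>
        simp only [ti, tj, tk, tl, SimpleGraph.irrefl] <;>
        first
        | exact aik | exact ajk | exact akl | exact ail.1 | exact ail.2
        | (rw [H.adj_comm, aik, H.adj_comm])
        | (rw [H.adj_comm, ajk, H.adj_comm])
        | (rw [H.adj_comm, akl, H.adj_comm])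
        | (rw [H.adj_comm, ail.1, H.adj_comm])
        | (rw [H.adj_comm, ail.2, H.adj_comm])
  by_cases hk : t k ∈ S
  · by_cases hl : t l ∈ S
    · refine ⟨t, fun m => ?_, fun _ _ => Iff.rfl, fun _ _ => Iff.rfl⟩
      rcases hall m with rfl | rfl | rfl | rfl
      exacts [hS _ hi, hS _ hj, hS _ hk, hS _ hl]
    · exact main l k hil hik hjl hjk hkl.symm (fun m => by have := hall m; tauto) hl
  · exact main k l hik hil hjk hjl hkl hall hk

/-- Deletions inside `S` change only adjacencies within `S`, and the representatives respect
everything else. So an obstacle anywhere can be transported into the kept vertices. -/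
theorem Meets.free_of_keptSet [Finite V] (hX : Meets G X) (hXS : X ⊆ S) {F : Finset (Sym2 V)}
    (hF : ∀ e ∈ F, ∀ v ∈ e, v ∈ S)
    (hfree : ∀ a ∈ keptSet G X S, ∀ b ∈ keptSet G X S, ∀ c ∈ keptSet G X S, ∀ d ∈ keptSet G X S,
      ¬ IsObstacle (G.deleteEdges (F : Set (Sym2 V))) a b c d) (a b c d : V) :
    ¬ IsObstacle (G.deleteEdges (F : Set (Sym2 V))) a b c d := by
  intro ho
  set H := G.deleteEdges (F : Set (Sym2 V)) with hHdef
  have hH : ∀ u v, u ∉ S ∨ v ∉ S → (H.Adj u v ↔ G.Adj u v) := by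
    intro u v huv
    simp only [hHdef, SimpleGraph.deleteEdges_adj, Finset.mem_coe, and_iff_left_iff_imp]
    intro _ h
    rcases huv with huv | huv
    · exact huv (hF _ h u (Sym2.mem_mk_left _ _))
    · exact huv (hF _ h v (Sym2.mem_mk_right _ _))
  let t : Fin 4 → V := ![a, b, c, d]
  have ho' : IsObstacle H (t 0) (t 1) (t 2) (t 3) := ho
  have ht := ho'.injective
  -- With at most one vertex in `S` the obstacle would already exist in `G`, and would then have an
  -- edge inside `X ⊆ S`.
  obtain ⟨i, j, hij, hi, hj⟩ : ∃ i j, i ≠ j ∧ t i ∈ S ∧ t j ∈ S := by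
    by_contra hcon
    push Not at hcon
    have hG : IsObstacle G (t 0) (t 1) (t 2) (t 3) := by
      refine IsObstacle.of_iff (t := t) (t' := t) (fun _ _ => Iff.rfl) (fun i j => ?_) ho'
      by_cases hij : i = j
      · simp [hij]
      · exact hH _ _ (by by_contra h; push Not at h; exact hcon i j hij h.1 h.2)
    rcases hX _ _ _ _ hG with h | h | h | h | h | h
    · exact hcon 0 1 (by decide) (hXS h.1) (hXS h.2.1)
    · exact hcon 0 2 (by decide) (hXS h.1) (hXS h.2.1)
    · exact hcon 0 3 (by decide) (hXS h.1) (hXS h.2.1)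
    · exact hcon 1 2 (by decide) (hXS h.1) (hXS h.2.1)
    · exact hcon 1 3 (by decide) (hXS h.1) (hXS h.2.1)
    · exact hcon 2 3 (by decide) (hXS h.1) (hXS h.2.1)
  obtain ⟨t', hK, hinj, hadj⟩ := exists_kept_tuple (X := X) hH ht hij hi hj
  exact hfree _ (hK 0) _ (hK 1) _ (hK 2) _ (hK 3) (IsObstacle.of_iff hinj hadj ho')

end Representatives

end EdgeDeletion

namespace EdgeDeletion

open Classical

/-! ### A canonical, definable choice in the greedy step -/

section Greedy

variable {V : Type*} [LinearOrder V] (G : SimpleGraph V)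

/-- An obstacle without edges in `X`. -/
def IsNewObstacle (X : Set V) (a b c d : V) : Prop :=
  IsObstacle G a b c d ∧ ¬ HasEdgeIn G X a b c d

/-- The lexicographic order of quadruples. -/
def LexLe (a b c d a' b' c' d' : V) : Prop :=
  a < a' ∨ (a = a' ∧ (b < b' ∨ (b = b' ∧ (c < c' ∨ (c = c' ∧ d ≤ d')))))

/-- Add the vertices of the first obstacle without edges in `X`. -/
def addObstacle (X : Set V) : Set V :=
  {v | v ∈ X ∨ ∃ a b c d, IsNewObstacle G X a b c d ∧
    (∀ a' b' c' d', IsNewObstacle G X a' b' c' d' → LexLe a b c d a' b' c' d') ∧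
    (v = a ∨ v = b ∨ v = c ∨ v = d)}

/-- The result of adding obstacles greedily. -/
def greedy : ℕ → Set V
  | 0 => ∅
  | t + 1 => addObstacle G (greedy t)

theorem LexLe.antisymm {a b c d a' b' c' d' : V} (h : LexLe a b c d a' b' c' d')
    (h' : LexLe a' b' c' d' a b c d) : a = a' ∧ b = b' ∧ c = c' ∧ d = d' := by
  unfold LexLe at h h'
  rcases lt_trichotomy a a' with h₁ | rfl | h₁ <;> rcases lt_trichotomy b b' with h₂ | rfl | h₂ <;>
    rcases lt_trichotomy c c' with h₃ | rfl | h₃ <;>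
    rcases lt_trichotomy d d' with h₄ | rfl | h₄ <;>
    simp_all [lt_asymm, not_le_of_gt, ne_of_gt, ne_of_lt]

/-- The lexicographic order singles out one quadruple, so a definition that quantifies over all
least obstacles still adds only four vertices. -/
theorem greedyStep_addObstacle [Finite V] (X : Set V) : GreedyStep G X (addObstacle G X) := by
  by_cases hX : Meets G X
  · refine Or.inl ⟨hX, Set.ext fun v => ⟨?_, Or.inl⟩⟩
    rintro (h | ⟨a, b, c, d, ⟨h₁, h₂⟩, -⟩)
    exacts [h, absurd (hX a b c d h₁) h₂]
  · have := Fintype.ofFinite V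
    have hne : (Finset.univ.filter fun q : V × V × V × V =>
        IsNewObstacle G X q.1 q.2.1 q.2.2.1 q.2.2.2).Nonempty := by
      unfold Meets at hX
      push Not at hX
      obtain ⟨a, b, c, d, h⟩ := hX
      exact ⟨(a, b, c, d), Finset.mem_filter.2 ⟨Finset.mem_univ _, h⟩⟩
    obtain ⟨⟨a, b, c, d⟩, hq, hmin⟩ := Finset.exists_min_image _
      (fun q : V × V × V × V => toLex (q.1, toLex (q.2.1, toLex (q.2.2.1, q.2.2.2)))) hne
    have hq' := (Finset.mem_filter.1 hq).2
    have hmin' : ∀ a' b' c' d', IsNewObstacle G X a' b' c' d' → LexLe a b c d a' b' c' d' := by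
      intro a' b' c' d' h
      have := hmin (a', b', c', d') (Finset.mem_filter.2 ⟨Finset.mem_univ _, h⟩)
      simpa only [Prod.Lex.toLex_le_toLex, Prod.Lex.toLex_lt_toLex, LexLe] using this
    refine Or.inr ⟨a, b, c, d, hq'.1, hq'.2, Set.ext fun v => ?_⟩
    constructor
    · rintro (h | ⟨a', b', c', d', h, h', hv⟩)
      · exact Or.inl h
      · obtain ⟨rfl, rfl, rfl, rfl⟩ := (hmin' _ _ _ _ h).antisymm (h' _ _ _ _ hq')
        exact Or.inr hv
    · rintro (h | h)
      · exact Or.inl h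
      · exact Or.inr ⟨a, b, c, d, hq', hmin', h⟩

theorem greedyStep_greedy [Finite V] (t : ℕ) : GreedyStep G (greedy G t) (greedy G (t + 1)) :=
  greedyStep_addObstacle G _

end Greedy

/-! ### The compressed instance: correctness and size -/

theorem isObstacle_deleteEdges_comap {V W : Type*} (G : SimpleGraph V) (e : W ↪ V)
    {F : Finset (Sym2 V)} {F' : Finset (Sym2 W)} (h : ∀ i j, s(e i, e j) ∈ F ↔ s(i, j) ∈ F')
    (a b c d : W) : IsObstacle ((G.comap e).deleteEdges (F' : Set (Sym2 W))) a b c d ↔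
      IsObstacle (G.deleteEdges (F : Set (Sym2 V))) (e a) (e b) (e c) (e d) := by
  simp [IsObstacle, IsClaw, IsDiamond, SimpleGraph.deleteEdges_adj, h]

namespace Instance

variable (I : Instance)

/-- The vertices of a packing of obstacles. -/
def core : Set (Fin I.n) := greedy I.G (I.k + 1)

/-- The vertices close to the core, if this meets all obstacles. -/
def near : Set (Fin I.n) :=
  {v | Meets I.G I.core ∧ v ∈ expand I.G I.core I.k (expand I.G I.core I.k I.core)}

/-- The vertices of the compressed instance. -/
noncomputable def kept : Finset (Fin I.n) := (keptSet I.G I.core I.near).toFinset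

/-- The annotated instance on the vertices `K`, with those in `S` annotated. -/
noncomputable def restrict (K : Finset (Fin I.n)) (S : Set (Fin I.n)) : AnnotatedInstance where
  n := K.card
  G := I.G.comap (K.orderEmbOfFin rfl)
  S := Finset.univ.filter fun i => K.orderEmbOfFin rfl i ∈ S
  k := I.k

/-- The compressed instance. -/
noncomputable def compress : AnnotatedInstance := I.restrict I.kept I.near

variable {I}

theorem mem_kept {v : Fin I.n} : v ∈ I.kept ↔ v ∈ keptSet I.G I.core I.near := by
  simp [kept]

/-- Only obstacles within the core are excluded, so the bound applies to the input and equally to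
the compressed graph, which contains the core. -/
theorem lt_card_of_not_meets (hX : ¬ Meets I.G I.core) {F : Finset (Sym2 (Fin I.n))}
    (hF : ∀ a ∈ I.core, ∀ b ∈ I.core, ∀ c ∈ I.core, ∀ d ∈ I.core,
      ¬ IsObstacle (I.G.deleteEdges (F : Set (Sym2 (Fin I.n)))) a b c d) : I.k < F.card :=
  (le_card_of_greedy (greedyStep_greedy I.G) (I.k + 1) hX hF).trans
    (Finset.card_le_card (@Finset.filter_subset _ _ (_) F))

theorem compress_mem_of_mem (h : I ∈ edgeDeletion clawDiamond) :
    I.compress ∈ annotatedEdgeDeletion clawDiamond := by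
  obtain ⟨F, ⟨hFG, hfree⟩, hF⟩ := h
  rw [isFree_iff] at hfree
  by_cases hX : Meets I.G I.core
  · obtain ⟨F', hF', hnear, hfree'⟩ := hX.exists_solution_near hF hFG hfree
    set e := I.kept.orderEmbOfFin rfl
    let F'' : Finset (Sym2 (Fin I.kept.card)) := Finset.univ.filter fun x => x.map e ∈ F'
    have hF'' : ∀ x, x ∈ F'' ↔ x.map e ∈ F' := fun x => by
      rw [Finset.mem_filter, and_iff_right (Finset.mem_univ x)]
    have hmem : ∀ i j, s(e i, e j) ∈ F' ↔ s(i, j) ∈ F'' := fun i j => (hF'' s(i, j)).symm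
    refine ⟨F'', ⟨?_, ?_⟩, ?_, ?_⟩
    · intro x hx
      induction x with
      | h i j => exact hFG (hF' ((hmem i j).2 hx))
    · refine isFree_iff.2 fun a b c d h => ?_
      exact hfree' _ _ _ _ ((isObstacle_deleteEdges_comap I.G e.toEmbedding hmem a b c d).1 h)
    · refine le_trans ?_ ((Finset.card_le_card hF').trans hF)
      exact Finset.card_le_card_of_injOn (Sym2.map e) (fun x hx => (hF'' x).1 hx)
        (Sym2.map.injective e.injective).injOn
    · intro x hx v hv
      refine Finset.mem_filter.2 ⟨Finset.mem_univ _, hX, ?_⟩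
      exact hnear _ ((hF'' x).1 hx) _ (Sym2.mem_map.2 ⟨v, hv, rfl⟩)
  · exact absurd hF (lt_card_of_not_meets hX fun a _ b _ c _ d _ => hfree a b c d).not_ge

/-- A solution on the kept vertices is pushed forward unchanged. If the core does not meet every
obstacle, the core alone rules such a solution out, so no separate trivial no-instance is needed. -/
theorem mem_of_compress_mem (h : I.compress ∈ annotatedEdgeDeletion clawDiamond) :
    I ∈ edgeDeletion clawDiamond := by
  obtain ⟨F', ⟨hFG, hfree⟩, hF, hS⟩ := h
  rw [isFree_iff] at hfree
  let e : Fin I.kept.card ↪o Fin I.n := I.kept.orderEmbOfFin rfl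
  have hrange : ∀ v ∈ keptSet I.G I.core I.near, ∃ i, e i = v := by
    intro v hv
    rw [← mem_kept] at hv
    have : v ∈ Set.range e := by rw [Finset.range_orderEmbOfFin]; exact hv
    exact this
  let F : Finset (Sym2 (Fin I.n)) := Finset.map e.toEmbedding.sym2Map F'
  have hmem : ∀ i j, s(e i, e j) ∈ F ↔ s(i, j) ∈ F' := by
    intro i j
    exact Finset.mem_map' e.toEmbedding.sym2Map (a := s(i, j))
  have hcard : F.card ≤ I.k := (Finset.card_map _).trans_le hF
  have hfree' : ∀ a ∈ keptSet I.G I.core I.near, ∀ b ∈ keptSet I.G I.core I.near,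
      ∀ c ∈ keptSet I.G I.core I.near, ∀ d ∈ keptSet I.G I.core I.near,
      ¬ IsObstacle (I.G.deleteEdges (F : Set (Sym2 (Fin I.n)))) a b c d := by
    intro a ha b hb c hc d hd h
    obtain ⟨a, rfl⟩ := hrange a ha
    obtain ⟨b, rfl⟩ := hrange b hb
    obtain ⟨c, rfl⟩ := hrange c hc
    obtain ⟨d, rfl⟩ := hrange d hd
    exact hfree _ _ _ _ ((isObstacle_deleteEdges_comap I.G e.toEmbedding hmem a b c d).2 h)
  by_cases hX : Meets I.G I.core
  · have hsub : I.core ⊆ I.near := fun v hv => ⟨hX, subset_expand _ _ (subset_expand _ _ hv)⟩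
    refine ⟨F, ⟨?_, isFree_iff.2 (hX.free_of_keptSet hsub ?_ hfree')⟩, hcard⟩
    · intro x hx
      obtain ⟨y, hy, rfl⟩ := Finset.mem_map.1 hx
      have := hFG hy
      induction y with
      | h i j => exact this
    · intro x hx v hv
      obtain ⟨y, hy, rfl⟩ := Finset.mem_map.1 hx
      obtain ⟨i, hi, rfl⟩ := Sym2.mem_map.1 hv
      exact (Finset.mem_filter.1 (hS y hy i hi)).2
  · exact absurd hcard (lt_card_of_not_meets hX fun a ha b hb c hc d hd =>
      hfree' a (Or.inl ha) b (Or.inl hb) c (Or.inl hc) d (Or.inl hd)).not_ge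

/-- The core has at most 4(k + 1) vertices and each expansion multiplies by at most 7(k + 1), so the
annotated set is cubic in k + 1. The number of representatives is cubic in its size. -/
theorem card_kept_le : I.kept.card ≤ 484349128 * (I.k + 1) ^ 9 := by
  have h₀ : I.kept.card = (keptSet I.G I.core I.near).ncard := by
    rw [kept, Set.ncard_eq_toFinset_card']
  have h₁ := ncard_keptSet_le (G := I.G) (X := I.core) (S := I.near)
  have h₂ : I.core.ncard ≤ 4 * (I.k + 1) := ncard_greedy_le rfl (greedyStep_greedy I.G) _
  have h₃ : I.near.ncard ≤ 196 * (I.k + 1) ^ 3 := by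
    by_cases hX : Meets I.G I.core
    · have h₄ := hX.ncard_expand_le (k := I.k) (T := I.core)
      have h₅ := hX.ncard_expand_le (k := I.k) (T := expand I.G I.core I.k I.core)
      have h₆ : I.near = expand I.G I.core I.k (expand I.G I.core I.k I.core) := by
        ext v; exact and_iff_right hX
      have h₇ : 4 * I.k + 7 ≤ 7 * (I.k + 1) := by omega
      rw [h₆]
      calc _ ≤ _ := h₅
        _ ≤ (4 * (I.k + 1) * (7 * (I.k + 1))) * (7 * (I.k + 1)) := by
          gcongr
          refine h₄.trans ?_
          gcongr
        _ = _ := by ring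
    · have : I.near = ∅ := Set.eq_empty_iff_forall_notMem.2 fun v hv => hX hv.1
      rw [this]; simp
  have h₈ : 1 ≤ (I.k + 1) ^ 3 := Nat.one_le_pow _ _ (by omega)
  have h₉ : I.k + 1 ≤ (I.k + 1) ^ 9 := Nat.le_self_pow (by norm_num) _
  have h₁₀ : (I.k + 1) ^ 3 ≤ (I.k + 1) ^ 9 := Nat.pow_le_pow_right (by omega) (by norm_num)
  rw [h₀]
  calc _ ≤ _ := h₁
    _ ≤ 4 * (I.k + 1) + 196 * (I.k + 1) ^ 3 + 64 * ((196 * (I.k + 1) ^ 3) *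
        ((196 * (I.k + 1) ^ 3) * (197 * (I.k + 1) ^ 3))) := by
      gcongr
      omega
    -- The leading coefficient is 64 · 196 · 196 · 197, where 197 absorbs the summand 1; the lower
    -- terms add 4 + 196.
    _ = 4 * (I.k + 1) + 196 * (I.k + 1) ^ 3 + 484348928 * (I.k + 1) ^ 9 := by ring
    _ ≤ _ := by omega

theorem succ_pow_le (k : ℕ) {i j : ℕ} (h : i ≤ j) : (k + 1) ^ i ≤ 2 ^ i * (k ^ j + 1) := by
  rcases Nat.eq_zero_or_pos k with rfl | hk
  · rw [zero_add, one_pow]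
    exact Nat.mul_pos (Nat.two_pow_pos i) (Nat.succ_pos _)
  · calc (k + 1) ^ i ≤ (2 * k) ^ i := Nat.pow_le_pow_left (by omega) _
      _ = 2 ^ i * k ^ i := mul_pow _ _ _
      _ ≤ _ := Nat.mul_le_mul_left _ ((Nat.pow_le_pow_right hk h).trans (Nat.le_succ _))

end Instance

end EdgeDeletion

namespace EdgeDeletion

/-! ### The words of instances -/

/-- The letter at position `p` is a one. -/
def IsOne (w : List Bool) (p : ℕ) : Prop := w[p]? = some true

theorem IsOne.lt {w : List Bool} {p : ℕ} (h : IsOne w p) : p < w.length := by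
  by_contra hlt
  rw [IsOne, List.getElem?_eq_none (by omega)] at h
  cases h

theorem isOne_drop {w : List Bool} {a p : ℕ} : IsOne (w.drop a) p ↔ IsOne w (a + p) := by
  rw [IsOne, List.getElem?_drop, IsOne]

theorem eq_iff_isOne {l w : List Bool} :
    l = w ↔ w.length = l.length ∧ ∀ i < l.length, IsOne w i ↔ l[i]? = some true := by
  constructor
  · rintro rfl; exact ⟨rfl, fun _ _ => Iff.rfl⟩
  · rintro ⟨h, h'⟩
    refine List.ext_getElem h.symm fun i h₁ h₂ => ?_
    have := h' i h₁
    rw [IsOne, List.getElem?_eq_getElem h₁, List.getElem?_eq_getElem h₂, Option.some.injEq,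
      Option.some.injEq, ← Bool.eq_iff_iff] at this
    exact this.symm

/-- Peels off a prefix, so that the parts of an encoding can be read off position by position. -/
theorem append_eq_iff_isOne {l r w : List Bool} :
    l ++ r = w ↔ l.length ≤ w.length ∧ (∀ i < l.length, IsOne w i ↔ l[i]? = some true) ∧
      r = w.drop l.length := by
  constructor
  · rintro rfl
    refine ⟨by simp, fun i hi => ?_, by simp⟩
    rw [IsOne, List.getElem?_append_left hi]
  · rintro ⟨h₁, h₂, rfl⟩
    have : l = w.take l.length := by
      refine eq_iff_isOne.2 ⟨by simpa using h₁, fun i hi => ?_⟩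
      rw [← h₂ i hi, IsOne, IsOne, List.getElem?_take_of_lt hi]
    conv_rhs => rw [← List.take_append_drop l.length w]
    rw [← this]

theorem encodeNat_isOne {m i : ℕ} : (encodeNat m)[i]? = some true ↔ i < m := by
  rw [encodeNat]
  rcases lt_trichotomy i m with h | rfl | h
  · rw [List.getElem?_append_left (by simpa using h)]
    simp [h]
  · simp
  · rw [List.getElem?_eq_none (by simp; omega)]
    simp; omega

theorem length_encodeNat (m : ℕ) : (encodeNat m).length = m + 1 := by simp [encodeNat]

theorem forall_lt_succ_isOne {w : List Bool} {a m : ℕ} :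
    (∀ i < m + 1, IsOne w (a + i) ↔ i < m) ↔ (∀ i < m, IsOne w (a + i)) ∧ ¬ IsOne w (a + m) := by
  constructor
  · intro h
    exact ⟨fun i hi => (h i (by omega)).2 hi, fun h' => ((h m (by omega)).1 h').false⟩
  · rintro ⟨h₁, h₂⟩ i hi
    rcases (Nat.lt_succ_iff.1 hi).lt_or_eq with h | rfl
    · exact iff_of_true (h₁ i h) h
    · exact iff_of_false h₂ (lt_irrefl _)

open Classical in
theorem adjMatrix_word {n : ℕ} (G : SimpleGraph (Fin n)) :
    (List.ofFn fun i => List.ofFn fun j => decide (G.Adj i j)).flatten =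
      List.ofFn fun x : Fin (n * n) => decide (G.Adj x.divNat x.modNat) := by
  rw [List.ofFn_mul]
  congr 2
  funext i
  congr 1
  funext j
  have h : (⟨i * n + j, by
      calc (i : ℕ) * n + j < i * n + n := by omega
        _ = (i + 1) * n := by ring
        _ ≤ n * n := Nat.mul_le_mul_right _ i.2⟩ : Fin (n * n)) = finProdFinEquiv (i, j) := by
    ext; simp [finProdFinEquiv]; ring
  have h₁ := congrArg Prod.fst (finProdFinEquiv.symm_apply_apply (i, j))
  have h₂ := congrArg Prod.snd (finProdFinEquiv.symm_apply_apply (i, j))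
  simp only [finProdFinEquiv_symm_apply] at h₁ h₂
  rw [h, h₁, h₂]

theorem encodeGraph_append_eq_iff {n : ℕ} {G : SimpleGraph (Fin n)} {r w : List Bool} :
    encodeGraph G ++ r = w ↔ n + 1 + n * n ≤ w.length ∧ ((∀ i < n, IsOne w i) ∧ ¬ IsOne w n) ∧
      (∀ i j : Fin n, IsOne w (n + 1 + (i * n + j)) ↔ G.Adj i j) ∧
      r = w.drop (n + 1 + n * n) := by
  classical
  rw [encodeGraph, adjMatrix_word, List.append_assoc, append_eq_iff_isOne, append_eq_iff_isOne]
  simp only [length_encodeNat, encodeNat_isOne, List.length_ofFn, List.length_drop, List.drop_drop,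
    isOne_drop]
  have h₁ := forall_lt_succ_isOne (w := w) (a := 0) (m := n)
  simp only [zero_add] at h₁
  rw [h₁]
  have h₂ : (∀ i < n * n, (IsOne w (n + 1 + i) ↔
      (List.ofFn fun x : Fin (n * n) => decide (G.Adj x.divNat x.modNat))[i]? = some true)) ↔
      ∀ i j : Fin n, IsOne w (n + 1 + (i * n + j)) ↔ G.Adj i j := by
    have : ∀ x : Fin n × Fin n, (IsOne w (n + 1 + (x.1 * n + x.2)) ↔ G.Adj x.1 x.2) ↔
        (IsOne w (n + 1 + (finProdFinEquiv x : Fin (n * n))) ↔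
          G.Adj (finProdFinEquiv x).divNat (finProdFinEquiv x).modNat) := by
      intro x
      have h₁ := congrArg Prod.fst (finProdFinEquiv.symm_apply_apply x)
      have h₂ := congrArg Prod.snd (finProdFinEquiv.symm_apply_apply x)
      simp only [finProdFinEquiv_symm_apply] at h₁ h₂
      rw [h₁, h₂, finProdFinEquiv_apply_val, mul_comm n, add_comm (x.2 : ℕ)]
    rw [show (∀ i j : Fin n, IsOne w (n + 1 + (i * n + j)) ↔ G.Adj i j) ↔ ∀ x : Fin n × Fin n,
      (IsOne w (n + 1 + (x.1 * n + x.2)) ↔ G.Adj x.1 x.2) from ⟨fun h x => h _ _, fun h i j => h (i, j)⟩]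
    simp only [this]
    rw [finProdFinEquiv.forall_congr_right (q := fun x : Fin (n * n) =>
      IsOne w (n + 1 + x) ↔ G.Adj x.divNat x.modNat), Fin.forall_iff]
    refine forall₂_congr fun i hi => ?_
    rw [List.getElem?_eq_getElem (by simpa using hi)]
    simp
  rw [h₂]
  constructor
  · rintro ⟨a, b, c, d, e⟩; exact ⟨by omega, b, d, e⟩
  · rintro ⟨a, b, c, d⟩; exact ⟨by omega, b, by omega, c, d⟩

theorem length_encodeGraph {n : ℕ} (G : SimpleGraph (Fin n)) :
    (encodeGraph G).length = n + 1 + n * n := by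
  classical
  rw [encodeGraph, adjMatrix_word]
  simp [encodeNat]
  omega

theorem Instance.length_encode (I : Instance) :
    I.encode.length = I.n + 1 + I.n * I.n + (I.k + 1) := by
  rw [encode, List.length_append, length_encodeGraph, length_encodeNat]

theorem AnnotatedInstance.length_encode (J : AnnotatedInstance) :
    J.encode.length = J.n + 1 + J.n * J.n + J.n + (J.k + 1) := by
  rw [encode, List.length_append, List.length_append, length_encodeGraph, length_encodeNat,
    encodeVertexSet, List.length_ofFn]

theorem AnnotatedInstance.encode_eq_iff {J : AnnotatedInstance} {w : List Bool} :
    J.encode = w ↔ w.length = J.n + 1 + J.n * J.n + J.n + (J.k + 1) ∧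
      ((∀ i < J.n, IsOne w i) ∧ ¬ IsOne w J.n) ∧
      (∀ i j : Fin J.n, IsOne w (J.n + 1 + (i * J.n + j)) ↔ J.G.Adj i j) ∧
      (∀ i : Fin J.n, IsOne w (J.n + 1 + J.n * J.n + i) ↔ i ∈ J.S) ∧
      (∀ i < J.k, IsOne w (J.n + 1 + J.n * J.n + J.n + i)) ∧
      ¬ IsOne w (J.n + 1 + J.n * J.n + J.n + J.k) := by
  rw [encode, List.append_assoc, encodeGraph_append_eq_iff, append_eq_iff_isOne, eq_iff_isOne]
  simp only [length_encodeNat, encodeNat_isOne, List.length_drop, List.drop_drop,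
    isOne_drop, encodeVertexSet, List.length_ofFn]
  rw [show (∀ i < J.n, (IsOne w (J.n + 1 + J.n * J.n + i) ↔
      (List.ofFn fun i => decide (i ∈ J.S))[i]? = some true)) ↔
      ∀ i : Fin J.n, IsOne w (J.n + 1 + J.n * J.n + i) ↔ i ∈ J.S by
    rw [Fin.forall_iff]
    refine forall₂_congr fun i hi => ?_
    rw [List.getElem?_eq_getElem (by simpa using hi)]
    simp, forall_lt_succ_isOne]
  constructor
  · rintro ⟨a, b, c, d, e, f, g⟩; exact ⟨by omega, b, c, e, g⟩
  · rintro ⟨a, b, c, d, e⟩; exact ⟨by omega, b, c, by omega, d, by omega, e⟩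

/-- Lists the ones of the word block by block; in this form the letters of the output can be defined
by a formula. -/
theorem AnnotatedInstance.isOne_encode {J : AnnotatedInstance} {p : ℕ} :
    IsOne J.encode p ↔ p < J.n ∨
      (∃ i j : Fin J.n, p = J.n + 1 + (i * J.n + j) ∧ J.G.Adj i j) ∨
      (∃ i : Fin J.n, p = J.n + 1 + J.n * J.n + i ∧ i ∈ J.S) ∨
      (J.n + 1 + J.n * J.n + J.n ≤ p ∧ p < J.n + 1 + J.n * J.n + J.n + J.k) := by
  obtain ⟨h₀, ⟨h₁, h₁'⟩, h₂, h₃, h₄, h₅⟩ := (encode_eq_iff (J := J)).1 rfl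
  constructor
  · intro h
    have hp := h.lt
    rw [h₀] at hp
    by_cases hp₁ : p < J.n
    · exact Or.inl hp₁
    by_cases hp₂ : p = J.n
    · exact absurd (hp₂ ▸ h) h₁'
    by_cases hp₃ : p < J.n + 1 + J.n * J.n
    · obtain ⟨q, rfl⟩ : ∃ q, p = J.n + 1 + q := ⟨p - (J.n + 1), by omega⟩
      have hq : q < J.n * J.n := by omega
      have hn : 0 < J.n := Nat.pos_of_mul_pos_left (by omega : 0 < J.n * J.n)
      have hd : q / J.n * J.n + q % J.n = q := by rw [mul_comm]; exact Nat.div_add_mod q J.n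
      refine Or.inr (Or.inl ⟨⟨q / J.n, Nat.div_lt_of_lt_mul hq⟩, ⟨q % J.n, Nat.mod_lt _ hn⟩, ?_, ?_⟩)
      · simp only [hd]
      · rw [← h₂]
        simpa only [hd] using h
    by_cases hp₄ : p < J.n + 1 + J.n * J.n + J.n
    · obtain ⟨q, rfl⟩ : ∃ q, p = J.n + 1 + J.n * J.n + q := ⟨p - (J.n + 1 + J.n * J.n), by omega⟩
      refine Or.inr (Or.inr (Or.inl ⟨⟨q, by omega⟩, rfl, ?_⟩))
      rw [← h₃]
      exact h
    by_cases hp₅ : p = J.n + 1 + J.n * J.n + J.n + J.k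
    · exact absurd (hp₅ ▸ h) h₅
    exact Or.inr (Or.inr (Or.inr ⟨by omega, by omega⟩))
  · rintro (h | ⟨i, j, rfl, h⟩ | ⟨i, rfl, h⟩ | ⟨h, h'⟩)
    · exact h₁ p h
    · exact (h₂ i j).2 h
    · exact (h₃ i).2 h
    · have := h₄ (p - (J.n + 1 + J.n * J.n + J.n)) (by omega)
      rwa [Nat.add_sub_cancel' h] at this

/-- The number of vertices is the position of the first zero, and the parameter is then determined
by the length. -/
theorem AnnotatedInstance.encode_injective {J J' : AnnotatedInstance}
    (h : J.encode = J'.encode) : J = J' := by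
  obtain ⟨n, G, S, k⟩ := J
  obtain ⟨n', G', S', k'⟩ := J'
  obtain ⟨h₀, ⟨h₁, h₁'⟩, h₂, h₃, -⟩ := encode_eq_iff.1 h
  obtain ⟨i₀, ⟨i₁, i₁'⟩, i₂, i₃, -⟩ := encode_eq_iff.1 (rfl : (⟨n', G', S', k'⟩ :
    AnnotatedInstance).encode = _)
  have hn : n = n' := by
    rcases lt_trichotomy n n' with h | h | h
    · exact absurd (i₁ n h) h₁'
    · exact h
    · exact absurd (h₁ n' h) i₁'
  subst hn
  have hk : k = k' := by simp only at h₀ i₀; omega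
  subst hk
  congr 1
  · ext i j; exact (h₂ i j).symm.trans (i₂ i j)
  · ext i; exact (h₃ i).symm.trans (i₃ i)

end EdgeDeletion

namespace EdgeDeletion

/-! ### Definability of encoded words and graphs -/

section Words

variable {B : Type} {σ : Sys B} {γ : Type} [Ctx σ γ] {m : ℕ} {x : γ → ℕ}

/-- No bound on `x` is needed: beyond the word there are no ones, and the word is shorter than the
range of positions. -/
theorem Dfn.isOne {r : ℕ} (hr : r < m) (w : γ → List Bool)
    (hs : ∀ g p, σ.sets (Ctx.base g) r p ↔ IsOne (w g) p) (hw : ∀ g, (w g).length < size g)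
    [h : Trm m x] : Dfn m fun g => IsOne (w g) (x g) := by
  have := h.out
  have : Dfn m fun q : Σ g : γ, Fin (size g) => σ.sets (Ctx.base q) r q.2 := Dfn.rel hr
  refine Dfn.of_iff (p := fun g => ∃ a : Fin (size g), (a : ℕ) = x g ∧ σ.sets (Ctx.base g) r a)
    inferInstance fun g => ?_
  constructor
  · exact fun h => ⟨⟨x g, h.lt.trans (hw g)⟩, rfl, (hs _ _).2 h⟩
  · rintro ⟨a, h₁, h₂⟩; rwa [← h₁, ← hs]

theorem Trm.length {r : ℕ} (hr : r < m) (w : γ → List Bool)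
    (hs : ∀ g p, σ.sets (Ctx.base g) r p ↔ p < (w g).length) (hw : ∀ g, (w g).length < size g) :
    Trm m fun g => (w g).length := by
  have : Dfn m fun q : Σ g : γ, Fin (size g) => σ.sets (Ctx.base q) r q.2 := Dfn.rel hr
  have : Dfn m fun q : Σ q : Σ g : γ, Fin (size g), Fin (size q.1) =>
    σ.sets (Ctx.base q) r q.2 := Dfn.rel hr
  refine ⟨Dfn.of_iff (p := fun q : Σ g : γ, Fin (size g) => ¬ σ.sets (Ctx.base q) r q.2 ∧
    ∀ a : Fin (size q.1), a < q.2 → σ.sets (Ctx.base q) r a) inferInstance fun q => ?_⟩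
  have hs' : ∀ p, σ.sets (Ctx.base q) r p ↔ p < (w q.1).length := hs q.1
  simp only [hs', not_lt]
  constructor
  · intro h
    exact ⟨h.ge, fun a ha => h ▸ ha⟩
  · rintro ⟨h₁, h₂⟩
    refine le_antisymm ?_ h₁
    by_contra hlt
    exact (h₂ ⟨(w q.1).length, hw _⟩ (not_le.1 hlt)).false

/-- The unary prefix makes `n` the first position holding a zero. -/
theorem Trm.order (w : γ → List Bool) (n : γ → ℕ)
    [h : Dfn m fun q : Σ g : γ, Fin (size g) => IsOne (w q.1) q.2]
    [h' : Dfn m fun q : Σ q : Σ g : γ, Fin (size g), Fin (size q.1) => IsOne (w q.1.1) q.2]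
    (hn : ∀ g, (∀ i < n g, IsOne (w g) i) ∧ ¬ IsOne (w g) (n g)) (hlt : ∀ g, n g < size g) :
    Trm m n := by
  refine ⟨Dfn.of_iff (p := fun q : Σ g : γ, Fin (size g) => ¬ IsOne (w q.1) q.2 ∧
    ∀ a : Fin (size q.1), a < q.2 → IsOne (w q.1) a) inferInstance fun q => ?_⟩
  obtain ⟨h₁, h₂⟩ := hn q.1
  constructor
  · intro h
    rw [h]
    exact ⟨h₂, fun a ha => h₁ a (h ▸ ha)⟩
  · rintro ⟨h₃, h₄⟩
    refine le_antisymm (not_lt.1 fun h => h₂ (h₄ ⟨n q.1, hlt _⟩ h)) (not_lt.1 fun h => h₃ (h₁ _ h))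

end Words

section Graphs

variable {B : Type} {σ : Sys B} {γ : Type} [Ctx σ γ] {m : ℕ} {n : γ → ℕ}

/-- The adjacency relation of a family of graphs is definable. -/
class AdjDfn (m : ℕ) (G : ∀ g, SimpleGraph (Fin (n g))) : Prop where
  out : ∀ (u v : ∀ g, Fin (n g)) [Trm m fun g => (u g : ℕ)] [Trm m fun g => (v g : ℕ)],
    Dfn m fun g => (G g).Adj (u g) (v g)

variable [Below n] {G : ∀ g, SimpleGraph (Fin (n g))} [h : AdjDfn m G]
  {a b c d : ∀ g, Fin (n g)} [Trm m fun g => (a g : ℕ)] [Trm m fun g => (b g : ℕ)]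
  [Trm m fun g => (c g : ℕ)] [Trm m fun g => (d g : ℕ)]

instance dfn_adj : Dfn m fun g => (G g).Adj (a g) (b g) := h.out a b

instance dfn_isClaw : Dfn m fun g => IsClaw (G g) (a g) (b g) (c g) (d g) := by
  unfold IsClaw; infer_instance

instance dfn_isDiamond : Dfn m fun g => IsDiamond (G g) (a g) (b g) (c g) (d g) := by
  unfold IsDiamond; infer_instance

instance dfn_isObstacle : Dfn m fun g => IsObstacle (G g) (a g) (b g) (c g) (d g) := by
  unfold IsObstacle; infer_instance

end Graphs

end EdgeDeletion

namespace EdgeDeletion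

namespace Compression

/-! ### The compression as a program -/

/-- The inputs of the program, together with the number of rounds of the greedy procedure. -/
abbrev Stage : Type := Instance × ℕ

namespace Stage

variable (b : Stage)

/-- The greedy core after the given number of rounds, at most `k + 1`. -/
def core : Set (Fin b.1.n) := greedy b.1.G (min b.2 (b.1.k + 1))

/-- The core and the vertices joined to it by light edges. -/
def around : Set (Fin b.1.n) := expand b.1.G (core b) b.1.k (core b)

/-- The vertices that may be annotated. -/
def near : Set (Fin b.1.n) :=
  {v | Meets b.1.G (core b) ∧ v ∈ expand b.1.G (core b) b.1.k (around b)}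

/-- The vertices of the output. -/
def kept : Set (Fin b.1.n) := keptSet b.1.G (core b) (near b)

open Classical in
/-- The output. -/
noncomputable def out : AnnotatedInstance := b.1.restrict (kept b).toFinset (near b)

end Stage

/-- The set of natural numbers given by a set of vertices. -/
def positions {n : ℕ} (T : Set (Fin n)) (p : ℕ) : Prop := ∃ h : p < n, ⟨p, h⟩ ∈ T

/-- The sets computed by the program. -/
noncomputable def regs (b : Stage) : ℕ → ℕ → Prop
  | 0 => IsOne b.1.encode
  | 1 => fun p => p < b.1.encode.length
  | 2 => positions (Stage.core b)
  | 3 => positions (Stage.around b)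
  | 4 => positions (Stage.near b)
  | 5 => positions (Stage.kept b)
  | 6 => fun p => p < (Stage.out b).encode.length
  | 7 => IsOne (Stage.out b).encode
  | _ => fun _ => False

/-- The system of the compression: a number of rounds is the only variable. -/
noncomputable def sys : Sys Stage where
  size b := 2 * b.1.encode.length + 2
  two_le _ := by omega
  sets := regs
  env b := cons b.2 fun _ => 2 * b.1.encode.length + 2

noncomputable instance : Ctx sys Stage := sys.ctx

section

variable {γ : Type} [Ctx sys γ] {m : ℕ}

theorem size_eq (g : γ) : size g = 2 * (Ctx.base g).1.encode.length + 2 := rfl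

theorem lt_size (g : γ) : (Ctx.base g).1.n + 1 + (Ctx.base g).1.n * (Ctx.base g).1.n +
    ((Ctx.base g).1.k + 1) < size g := by
  rw [size_eq, ← Instance.length_encode]; omega

variable [hm : Fact (2 ≤ m)]

instance dfn_isOne {x : γ → ℕ} [Trm m x] : Dfn m fun g => IsOne (Ctx.base g).1.encode (x g) :=
  Dfn.isOne (r := 0) (by have := hm.out; omega) (fun g : γ => (Ctx.base g).1.encode)
    (fun _ _ => Iff.rfl) fun g => by rw [size_eq]; omega

instance trm_length : Trm m fun g : γ => (Ctx.base g).1.encode.length :=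
  Trm.length (r := 1) (by have := hm.out; omega) (fun g : γ => (Ctx.base g).1.encode)
    (fun _ _ => Iff.rfl) fun g => by rw [size_eq]; omega

theorem isOne_encode (I : Instance) : (∀ i < I.n, IsOne I.encode i) ∧ ¬ IsOne I.encode I.n :=
  (encodeGraph_append_eq_iff (G := I.G) (r := encodeNat I.k) (w := I.encode)).1 rfl |>.2.1

theorem isOne_encode_adj (I : Instance) (i j : Fin I.n) :
    IsOne I.encode (I.n + 1 + (i * I.n + j)) ↔ I.G.Adj i j :=
  (encodeGraph_append_eq_iff (G := I.G) (r := encodeNat I.k) (w := I.encode)).1 rfl |>.2.2.1 i j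

instance trm_n : Trm m fun g : γ => (Ctx.base g).1.n :=
  Trm.order (fun g : γ => (Ctx.base g).1.encode) _ (fun g => isOne_encode (Ctx.base g).1)
    fun g => by have := lt_size g; omega

instance below_n : Below fun g : γ => (Ctx.base g).1.n := ⟨fun g => by
  have := lt_size g; omega⟩

instance rng_n : Rng m fun g : γ => (Ctx.base g).1.n where
  dfn := inferInstance

instance adjDfn : AdjDfn m fun g : γ => (Ctx.base g).1.G where
  out u v _ _ := Dfn.of_iff (p := fun g => IsOne (Ctx.base g).1.encode ((Ctx.base g).1.n + 1 +
    (u g * (Ctx.base g).1.n + v g))) inferInstance fun g =>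
      (isOne_encode_adj (Ctx.base g).1 _ _).symm

/-- The parameter is recovered from the total length, once the number of vertices is known. -/
instance trm_k : Trm m fun g : γ => (Ctx.base g).1.k := by
  have : Bdd fun q : Σ g : γ, Fin (size g) => (Ctx.base q).1.encode.length :=
    ⟨fun q => by rw [size_eq]; omega⟩
  refine ⟨Dfn.of_iff (p := fun q : Σ g : γ, Fin (size g) => (Ctx.base q).1.encode.length =
    (Ctx.base q).1.n + 1 + (Ctx.base q).1.n * (Ctx.base q).1.n + (q.2 + 1)) inferInstance
    fun q => ?_⟩
  rw [Instance.length_encode]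
  change _ = (Ctx.base q).1.k ↔ _
  omega

end

section

variable {γ : Type} [Ctx sys γ] {m : ℕ}

theorem dfn_mem {r : ℕ} (hr : r < m) (T : ∀ b : Stage, Set (Fin b.1.n))
    (hT : ∀ b, regs b r = positions (T b)) {v : ∀ g : γ, Fin (Ctx.base g).1.n}
    [Trm m fun g => (v g : ℕ)] : Dfn m fun g => v g ∈ T (Ctx.base g) :=
  Dfn.of_iff (Dfn.rel hr (x := fun g => (v g : ℕ))) fun g => by
    change _ ↔ regs _ _ _
    rw [hT]
    exact ⟨fun h => ⟨(v g).2, h⟩, fun h => h.2⟩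

variable [hm : Fact (3 ≤ m)]

instance : Fact (2 ≤ m) := ⟨by have := hm.out; omega⟩

variable {a b c d a' b' c' d' : ∀ g : γ, Fin (Ctx.base g).1.n} [Trm m fun g => (a g : ℕ)]
  [Trm m fun g => (b g : ℕ)] [Trm m fun g => (c g : ℕ)] [Trm m fun g => (d g : ℕ)]
  [Trm m fun g => (a' g : ℕ)] [Trm m fun g => (b' g : ℕ)] [Trm m fun g => (c' g : ℕ)]
  [Trm m fun g => (d' g : ℕ)]

instance dfn_core : Dfn m fun g => a g ∈ Stage.core (Ctx.base g) :=
  dfn_mem (r := 2) hm.out Stage.core fun _ => rfl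

instance dfn_hasEdgeIn : Dfn m fun g =>
    HasEdgeIn (Ctx.base g).1.G (Stage.core (Ctx.base g)) (a g) (b g) (c g) (d g) := by
  unfold HasEdgeIn; infer_instance

instance dfn_isNewObstacle : Dfn m fun g =>
    IsNewObstacle (Ctx.base g).1.G (Stage.core (Ctx.base g)) (a g) (b g) (c g) (d g) := by
  unfold IsNewObstacle; infer_instance

instance dfn_lexLe : Dfn m fun g =>
    LexLe (a g) (b g) (c g) (d g) (a' g) (b' g) (c' g) (d' g) := by
  unfold LexLe; infer_instance

instance dfn_meets : Dfn m fun g : γ => Meets (Ctx.base g).1.G (Stage.core (Ctx.base g)) := by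
  unfold Meets; infer_instance

end

theorem positions_iff {n : ℕ} {T : Set (Fin n)} {p : ℕ} :
    positions T p ↔ ∃ v : Fin n, p = v ∧ v ∈ T := by
  constructor
  · rintro ⟨h, hT⟩; exact ⟨_, rfl, hT⟩
  · rintro ⟨v, rfl, hT⟩; exact ⟨v.2, hT⟩

instance fact_three : Fact (3 ≤ 3) := ⟨le_rfl⟩

/-- The set is frozen after `k + 1` rounds, so the program may loop over all positions without
exceeding the greedy core. -/
theorem core_succ (b : Stage) (v : Fin b.1.n) : v ∈ Stage.core (b.1, b.2 + 1) ↔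
    v ∈ Stage.core b ∨ (b.2 ≤ b.1.k ∧ v ∈ addObstacle b.1.G (Stage.core b)) := by
  unfold Stage.core
  rcases Nat.lt_or_ge b.1.k b.2 with h | h
  · simp only [min_eq_right (show b.1.k + 1 ≤ b.2 + 1 by omega),
      min_eq_right (show b.1.k + 1 ≤ b.2 by omega)]
    simp only [not_le_of_gt h, false_and, or_false]
  · simp only [min_eq_left (show b.2 + 1 ≤ b.1.k + 1 by omega),
      min_eq_left (show b.2 ≤ b.1.k + 1 by omega)]
    simp only [h, true_and]
    exact (or_iff_right_of_imp Or.inl).symm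

instance var_stage : Var fun b : Stage => b.2 := ⟨0, fun _ => rfl⟩

theorem core_lt {b : Stage} {p : ℕ} (T : Set (Fin b.1.n)) (h : positions T p) : p < sys.size b := by
  obtain ⟨h, -⟩ := h
  have : b.1.n ≤ b.1.encode.length := by rw [Instance.length_encode]; omega
  change p < 2 * _ + 2
  omega

instance trm_round (n : Stage → ℕ) (n' : (Σ b : Stage, Fin (n b)) → ℕ) :
    Trm 3 fun q : Σ q : Σ b : Stage, Fin (n b), Fin (n' q) => q.1.1.2 :=
  Trm.fst (Trm.fst inferInstance n) n'

/-- The input of the program. -/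
def input (I : Instance) : ℕ → ℕ → Prop :=
  inputSets (fun a r => (r = 0 ∧ a = true) ∨ r = 1) I.encode

set_option synthInstance.maxSize 10000 in
set_option synthInstance.maxHeartbeats 400000 in
theorem reach_three : Reach sys input 3 := by
  refine Reach.loop (fun _ _ => rfl) (fun _ _ => rfl) (fun _ _ _ h => core_lt _ h)
    (reach_init ?_) ?_ ?_ ?_
  · intro I t r hr
    funext p
    interval_cases r
    · simp [input, inputSets, sys, regs, IsOne]
    · simp only [input, inputSets, sys, regs, one_ne_zero, false_and, false_or, and_true]
      exact propext ⟨fun ⟨_, h⟩ => (List.getElem?_eq_some_iff.1 h).1,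
        fun h => ⟨_, List.getElem?_eq_getElem h⟩⟩
  · rintro I p ⟨h, h'⟩
    simp [Stage.core, greedy] at h'
  · intro I t r hr
    interval_cases r <;> rfl
  · have : Bdd fun q : Σ q : Σ b : Stage, Fin (size b), Fin (Ctx.base q).1.n => (Ctx.base q).1.k :=
      ⟨fun q => by have := lt_size q; omega⟩
    -- The next core is spelled out as a formula in the current one, with the round number deciding
    -- whether an obstacle may still be added.
    refine Dfn.of_iff (m := 3) (p := fun q : Σ b : Stage, Fin (size b) => ∃ v : Fin (Ctx.base q).1.n,
      (q.2 : ℕ) = v ∧ (v ∈ Stage.core (Ctx.base q) ∨ (¬ (Ctx.base q).1.k < q.1.2 ∧ (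
      v ∈ Stage.core (Ctx.base q) ∨ ∃ a b c d,
      IsNewObstacle (Ctx.base q).1.G (Stage.core (Ctx.base q)) a b c d ∧
      (∀ a' b' c' d', IsNewObstacle (Ctx.base q).1.G (Stage.core (Ctx.base q)) a' b' c' d' →
        LexLe a b c d a' b' c' d') ∧ (v = a ∨ v = b ∨ v = c ∨ v = d))))) inferInstance fun q => ?_
    refine positions_iff.trans (exists_congr fun v => and_congr_right fun _ => ?_)
    rw [not_lt]
    exact core_succ q.1 v

end Compression

end EdgeDeletion

namespace EdgeDeletion

namespace Compression

open Classical

/-! ### Light edges, layers and kept pairs as definable sets -/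

section

variable {γ : Type} [Ctx sys γ] {m : ℕ} [hm : Fact (3 ≤ m)]
  {a b : ∀ g : γ, Fin (Ctx.base g).1.n} [ha : Trm m fun g => (a g : ℕ)]
  [hb : Trm m fun g => (b g : ℕ)]

theorem bdd_card (T : ∀ g : γ, Finset (Fin (Ctx.base g).1.n)) : Bdd fun g : γ => (T g).card := by
  refine ⟨fun g => ?_⟩
  have h₁ := lt_size g
  have h₂ := Finset.card_le_univ (T g)
  rw [Fintype.card_fin] at h₂
  omega

/-- Lightness compares a number of common neighbors with `2 * k + 2`; counting formulas are required
here. -/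
instance dfn_isLight : Dfn m fun g =>
    IsLight (Ctx.base g).1.G (Stage.core (Ctx.base g)) (Ctx.base g).1.k (a g) (b g) := by
  have := ha.fst fun g => (Ctx.base g).1.n
  have := hb.fst fun g => (Ctx.base g).1.n
  have := bdd_card fun g : γ => common (Ctx.base g).1.G (Stage.core (Ctx.base g)) (a g) (b g)
  have h₂ : Trm m fun _ : γ => 2 := inferInstanceAs (Trm m fun _ : γ => 1 + 1)
  have : Trm m fun g : γ =>
      (common (Ctx.base g).1.G (Stage.core (Ctx.base g)) (a g) (b g)).card := by
    unfold common
    exact Trm.card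
  unfold IsLight
  infer_instance

end

theorem Reach.next {r : ℕ} (h : Reach sys input r) (hlt : ∀ b p, regs b r p → p < sys.size b)
    (hd : Dfn r fun q : Σ b : Stage, Fin (size b) => regs q.1 r q.2) :
    Reach sys input (r + 1) :=
  h.set (fun _ _ => rfl) (fun _ _ => rfl) (fun a t _ hp => hlt (a, t) _ hp) hd

theorem reach_four : Reach sys input 4 := by
  refine Reach.next reach_three (fun b p h => core_lt _ h) ?_
  refine Dfn.of_iff (p := fun q : Σ b : Stage, Fin (size b) => ∃ v : Fin (Ctx.base q).1.n,
    (q.2 : ℕ) = v ∧ (v ∈ Stage.core (Ctx.base q) ∨ (v ∉ Stage.core (Ctx.base q) ∧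
      ∃ u ∈ Stage.core (Ctx.base q), IsLight (Ctx.base q).1.G (Stage.core (Ctx.base q))
        (Ctx.base q).1.k u v))) inferInstance fun q => positions_iff

instance : Fact (3 ≤ 4) := ⟨by norm_num⟩

instance dfn_around {γ : Type} [Ctx sys γ] {a : ∀ g : γ, Fin (Ctx.base g).1.n}
    [Trm 4 fun g => (a g : ℕ)] : Dfn 4 fun g => a g ∈ Stage.around (Ctx.base g) :=
  dfn_mem (r := 3) (by norm_num) Stage.around fun _ => rfl

set_option synthInstance.maxSize 1000 in
theorem reach_five : Reach sys input 5 := by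
  refine Reach.next reach_four (fun b p h => core_lt _ h) ?_
  refine Dfn.of_iff (p := fun q : Σ b : Stage, Fin (size b) => ∃ v : Fin (Ctx.base q).1.n,
    (q.2 : ℕ) = v ∧ Meets (Ctx.base q).1.G (Stage.core (Ctx.base q)) ∧
      (v ∈ Stage.around (Ctx.base q) ∨ (v ∉ Stage.core (Ctx.base q) ∧
      ∃ u ∈ Stage.around (Ctx.base q), IsLight (Ctx.base q).1.G (Stage.core (Ctx.base q))
        (Ctx.base q).1.k u v))) inferInstance fun q => positions_iff

instance : Fact (3 ≤ 5) := ⟨by norm_num⟩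

section

variable {γ : Type} [Ctx sys γ] {m : ℕ} [hm : Fact (5 ≤ m)]

instance : Fact (3 ≤ m) := ⟨by have := hm.out; omega⟩

section

variable {a : ∀ g : γ, Fin (Ctx.base g).1.n} [ha : Trm m fun g => (a g : ℕ)]

instance dfn_near : Dfn m fun g => a g ∈ Stage.near (Ctx.base g) :=
  dfn_mem (r := 4) (by have := hm.out; omega) Stage.near fun _ => rfl

end

variable {a b u v u' v' : ∀ g : γ, Fin (Ctx.base g).1.n} [Trm m fun g => (a g : ℕ)]
  [Trm m fun g => (b g : ℕ)] [hu : Trm m fun g => (u g : ℕ)] [hv : Trm m fun g => (v g : ℕ)]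
  [Trm m fun g => (u' g : ℕ)] [Trm m fun g => (v' g : ℕ)]

instance dfn_sameType : Dfn m fun g => SameType (Ctx.base g).1.G (Stage.near (Ctx.base g)) (a g)
    (b g) (u g) (v g) (u' g) (v' g) := by
  unfold SameType; infer_instance

set_option synthInstance.maxSize 1000 in
instance dfn_kept : Dfn m fun g =>
    Kept (Ctx.base g).1.G (Stage.near (Ctx.base g)) (u g) (v g) := by
  have := ((((hu.fst fun g => (Ctx.base g).1.n).fst fun g => (Ctx.base g).1.n).fst
    fun g => (Ctx.base g).1.n).fst fun g => (Ctx.base g).1.n)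
  have := ((((hv.fst fun g => (Ctx.base g).1.n).fst fun g => (Ctx.base g).1.n).fst
    fun g => (Ctx.base g).1.n).fst fun g => (Ctx.base g).1.n)
  unfold Kept IsLeast'
  infer_instance

end

end Compression

end EdgeDeletion

/-! ### Ranks of kept vertices and the output word -/

namespace EdgeDeletion

-- The increasing enumeration gives a kept vertex as its new name the number of kept vertices before
-- it, which is a definable count.
open Classical in
theorem card_filter_lt_orderEmbOfFin {α : Type*} [LinearOrder α] [Fintype α] (K : Finset α)
    (i : Fin K.card) :
    (Finset.univ.filter fun x => x ∈ K ∧ x < K.orderEmbOfFin rfl i).card = i := by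
  rw [← Fin.card_Iio i, ← Finset.card_map (K.orderEmbOfFin rfl).toEmbedding]
  congr 1
  ext x
  simp only [Finset.mem_filter, Finset.mem_univ, true_and, Finset.mem_map, Finset.mem_Iio,
    RelEmbedding.coe_toEmbedding]
  constructor
  · rintro ⟨hx, hlt⟩
    have : x ∈ Set.range (K.orderEmbOfFin rfl) := by rwa [Finset.range_orderEmbOfFin]
    obtain ⟨j, rfl⟩ := this
    exact ⟨j, (K.orderEmbOfFin rfl).lt_iff_lt.1 hlt, rfl⟩
  · rintro ⟨j, hj, rfl⟩
    exact ⟨Finset.orderEmbOfFin_mem _ _ _, (K.orderEmbOfFin rfl).lt_iff_lt.2 hj⟩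

namespace Compression

open Classical

instance : Fact (5 ≤ 5) := ⟨le_rfl⟩

theorem reach_six : Reach sys input 6 := by
  refine Reach.next reach_five (fun b p h => core_lt _ h) ?_
  refine Dfn.of_iff (p := fun q : Σ b : Stage, Fin (size b) => ∃ v : Fin (Ctx.base q).1.n,
    (q.2 : ℕ) = v ∧ (v ∈ Stage.core (Ctx.base q) ∨ v ∈ Stage.near (Ctx.base q) ∨
      (∃ u, Kept (Ctx.base q).1.G (Stage.near (Ctx.base q)) u v) ∨
      ∃ u, Kept (Ctx.base q).1.G (Stage.near (Ctx.base q)) v u)) inferInstance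
    fun q => positions_iff

section

variable {γ : Type} [Ctx sys γ] {m : ℕ} [hm : Fact (6 ≤ m)]

instance : Fact (5 ≤ m) := ⟨by have := hm.out; omega⟩

instance dfn_mem_kept {a : ∀ g : γ, Fin (Ctx.base g).1.n} [ha : Trm m fun g => (a g : ℕ)] :
    Dfn m fun g => a g ∈ Stage.kept (Ctx.base g) :=
  dfn_mem (r := 5) (by have := hm.out; omega) Stage.kept fun _ => rfl

theorem out_n (b : Stage) : (Stage.out b).n = (Stage.kept b).toFinset.card := rfl

instance trm_out_n : Trm m fun g : γ => (Stage.out (Ctx.base g)).n := by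
  have h : ∀ b : Stage, (Stage.out b).n = (Finset.univ.filter fun v => v ∈ Stage.kept b).card := by
    intro b
    rw [out_n]
    congr 1
    ext; simp
  simp only [h]
  infer_instance

/-- The number of kept vertices before `v`. -/
noncomputable def rank (b : Stage) (v : Fin b.1.n) : ℕ :=
  (Finset.univ.filter fun x => x ∈ Stage.kept b ∧ x < v).card

instance trm_rank {a : ∀ g : γ, Fin (Ctx.base g).1.n} [ha : Trm m fun g => (a g : ℕ)] :
    Trm m fun g => rank (Ctx.base g) (a g) := by
  have := ha.fst fun g => (Ctx.base g).1.n
  unfold rank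
  infer_instance

end

instance : Fact (6 ≤ 6) := ⟨le_rfl⟩

/-- The output has no more vertices than the input and the same parameter, so its word fits into the
doubled range of positions. -/
theorem length_out_le (b : Stage) : (Stage.out b).encode.length < sys.size b := by
  have h₁ : (Stage.out b).n ≤ b.1.n := by
    rw [out_n]
    exact (Finset.card_le_univ _).trans (Fintype.card_fin _).le
  have h₂ : (Stage.out b).k = b.1.k := rfl
  have h₃ := Nat.mul_le_mul h₁ h₁
  change _ < 2 * _ + 2
  rw [AnnotatedInstance.length_encode, Instance.length_encode, h₂]
  omega

theorem reach_seven : Reach sys input 7 := by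
  refine Reach.next reach_six (fun b p h => lt_trans h (length_out_le b)) ?_
  refine Dfn.of_iff (p := fun q : Σ b : Stage, Fin (size b) => (q.2 : ℕ) <
    (Stage.out (Ctx.base q)).n + 1 + (Stage.out (Ctx.base q)).n * (Stage.out (Ctx.base q)).n +
    (Stage.out (Ctx.base q)).n + ((Ctx.base q).1.k + 1)) inferInstance fun q => ?_
  change (q.2 : ℕ) < (Stage.out q.1).encode.length ↔ _
  rw [AnnotatedInstance.length_encode]
  exact Iff.rfl

instance : Fact (6 ≤ 7) := ⟨by norm_num⟩

theorem exists_kept_iff (b : Stage) {q : Fin b.1.n → Prop} :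
    (∃ v, v ∈ Stage.kept b ∧ q v) ↔
      ∃ i, q ((Stage.kept b).toFinset.orderEmbOfFin rfl i) := by
  constructor
  · rintro ⟨v, hv, h⟩
    have : v ∈ Set.range ((Stage.kept b).toFinset.orderEmbOfFin rfl) := by
      rw [Finset.range_orderEmbOfFin]; simpa using hv
    obtain ⟨i, rfl⟩ := this
    exact ⟨i, h⟩
  · rintro ⟨i, h⟩
    exact ⟨_, Set.mem_toFinset.1 (Finset.orderEmbOfFin_mem (Stage.kept b).toFinset rfl i), h⟩

theorem rank_orderEmbOfFin (b : Stage) (i) :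
    rank b ((Stage.kept b).toFinset.orderEmbOfFin rfl i) = i := by
  rw [← card_filter_lt_orderEmbOfFin (Stage.kept b).toFinset i, rank]
  simp

/-- Quantification over the vertices of the output is replaced by quantification over kept vertices
of the input, addressed through their ranks. -/
theorem isOne_out (b : Stage) (p : ℕ) : IsOne (Stage.out b).encode p ↔ p < (Stage.out b).n ∨
    (∃ u, u ∈ Stage.kept b ∧ ∃ v, v ∈ Stage.kept b ∧
      p = (Stage.out b).n + 1 + (rank b u * (Stage.out b).n + rank b v) ∧ b.1.G.Adj u v) ∨
    (∃ u, u ∈ Stage.kept b ∧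
      p = (Stage.out b).n + 1 + (Stage.out b).n * (Stage.out b).n + rank b u ∧
        u ∈ Stage.near b) ∨
    ((Stage.out b).n + 1 + (Stage.out b).n * (Stage.out b).n + (Stage.out b).n ≤ p ∧
      p < (Stage.out b).n + 1 + (Stage.out b).n * (Stage.out b).n + (Stage.out b).n + b.1.k) := by
  rw [AnnotatedInstance.isOne_encode]
  simp only [exists_kept_iff, rank_orderEmbOfFin]
  refine or_congr Iff.rfl (or_congr Iff.rfl (or_congr (exists_congr fun i =>
    and_congr_right fun _ => ?_) Iff.rfl))
  exact Finset.mem_filter.trans (and_iff_right (Finset.mem_univ i))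

set_option synthInstance.maxSize 1000 in
theorem reach_eight : Reach sys input 8 := by
  refine Reach.next reach_seven (fun b p h => h.lt.trans (length_out_le b)) ?_
  have : Bdd fun q : Σ b : Stage, Fin (size b) => (Stage.out (Ctx.base q)).n + 1 +
      (Stage.out (Ctx.base q)).n * (Stage.out (Ctx.base q)).n + (Stage.out (Ctx.base q)).n :=
    ⟨fun q => by
      have := length_out_le q.1
      rw [AnnotatedInstance.length_encode] at this
      exact lt_of_le_of_lt (Nat.le_add_right _ _) this⟩
  exact Dfn.of_iff (p := fun q : Σ b : Stage, Fin (size b) =>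
    (q.2 : ℕ) < (Stage.out (Ctx.base q)).n ∨
    (∃ u, u ∈ Stage.kept (Ctx.base q) ∧ ∃ v, v ∈ Stage.kept (Ctx.base q) ∧
      (q.2 : ℕ) = (Stage.out (Ctx.base q)).n + 1 +
        (rank (Ctx.base q) u * (Stage.out (Ctx.base q)).n + rank (Ctx.base q) v) ∧
      (Ctx.base q).1.G.Adj u v) ∨
    (∃ u, u ∈ Stage.kept (Ctx.base q) ∧
      (q.2 : ℕ) = (Stage.out (Ctx.base q)).n + 1 +
        (Stage.out (Ctx.base q)).n * (Stage.out (Ctx.base q)).n + rank (Ctx.base q) u ∧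
        u ∈ Stage.near (Ctx.base q)) ∨
    ((Stage.out (Ctx.base q)).n + 1 + (Stage.out (Ctx.base q)).n * (Stage.out (Ctx.base q)).n +
      (Stage.out (Ctx.base q)).n ≤ q.2 ∧
      (q.2 : ℕ) < (Stage.out (Ctx.base q)).n + 1 + (Stage.out (Ctx.base q)).n *
        (Stage.out (Ctx.base q)).n + (Stage.out (Ctx.base q)).n + (Ctx.base q).1.k)) inferInstance
    fun q => isOne_out _ _

theorem out_eq_compress {I : Instance} {t : ℕ} (ht : I.k + 1 ≤ t) :
    Stage.out (I, t) = I.compress := by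
  have : Stage.core (I, t) = I.core := by
    unfold Stage.core Instance.core
    exact congrArg (greedy I.G) (min_eq_right ht)
  unfold Stage.out Stage.kept Stage.near Stage.around Instance.compress Instance.kept
    Instance.near
  rw [this]

theorem map_isOne_eq {w : List Bool} {N : ℕ} (h : w.length ≤ N) :
    (((List.range N).filter fun p => decide (p < w.length)).map fun p => decide (IsOne w p)) =
      w := by
  have : (List.range N).filter (fun p => decide (p < w.length)) = List.range w.length := by
    obtain ⟨d, rfl⟩ := Nat.exists_eq_add_of_le h
    rw [List.range_add, List.filter_append, List.filter_eq_self.2, List.filter_eq_nil_iff.2]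
    · simp
    · simp
    · simp
  rw [this]
  refine List.ext_getElem (by simp) fun i h₁ h₂ => ?_
  simp [IsOne, h₂]

/-- The compressed instance is computed in polynomial time. -/
theorem computable : Nonempty (Turing.TM2ComputableInPolyTime Instance.encode
    (id : List Bool → List Bool) fun I => I.compress.encode) := by
  obtain ⟨P, hP⟩ := reach_eight
  refine computableInPolyTime_of_prg (fun a r => (r = 0 ∧ a = true) ∨ r = 1) P 6 7 fun I => ?_
  -- The loop makes as many rounds as there are positions, which exceeds `k + 1`.
  have hout : Stage.out (I, sys.size (I, 0)) = I.compress :=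
    out_eq_compress (by
      change I.k + 1 ≤ 2 * I.encode.length + 2
      rw [Instance.length_encode]
      omega)
  have h₆ : P.run (2 * I.encode.length + 2) (fun _ => 2 * I.encode.length + 2) (input I) 6 =
      fun p => p < (Stage.out (I, sys.size (I, 0))).encode.length := hP I 6 (by norm_num)
  have h₇ : P.run (2 * I.encode.length + 2) (fun _ => 2 * I.encode.length + 2) (input I) 7 =
      IsOne (Stage.out (I, sys.size (I, 0))).encode := hP I 7 (by norm_num)
  have hlen : (Stage.out (I, sys.size (I, 0))).encode.length < 2 * I.encode.length + 2 :=
    length_out_le (I, sys.size (I, 0))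
  rw [hout] at hlen h₆ h₇
  unfold input at h₆ h₇
  simp only [h₆, h₇]
  exact map_isOne_eq hlen.le

end Compression

end EdgeDeletion

namespace EdgeDeletion

namespace Verifier

/-! ### Instance words, certificates and acceptance -/

open Classical

/-! ### The verifier as a program -/

/-- The words of annotated instances, up to the bounds for the sizes. -/
def IsWord (w : List Bool) (N : ℕ) : Prop :=
  ∃ n k : Fin N, w.length = n + 1 + n * n + n + (k + 1) ∧ (∀ i : Fin N, i < n → IsOne w i) ∧
    ¬ IsOne w n ∧
    (∀ i j : Fin N, i < n → j < n → IsOne w (n + 1 + (i * n + j)) →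
      IsOne w (n + 1 + (j * n + i))) ∧
    (∀ i : Fin N, i < n → ¬ IsOne w (n + 1 + (i * n + i))) ∧
    (∀ i : Fin N, i < k → IsOne w (n + 1 + n * n + n + i)) ∧ ¬ IsOne w (n + 1 + n * n + n + k)

theorem isWord_iff {w : List Bool} {N : ℕ} (hN : w.length < N) :
    IsWord w N ↔ ∃ J : AnnotatedInstance, J.encode = w := by
  constructor
  · rintro ⟨n, k, h₀, h₁, h₁', h₂, h₃, h₄, h₅⟩
    refine ⟨⟨n, ⟨fun i j => IsOne w (n + 1 + (i * n + j)), ⟨fun i j h => ?_⟩, ⟨fun i h => ?_⟩⟩,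
      Finset.univ.filter fun i => IsOne w (n + 1 + n * n + i), k⟩, ?_⟩
    · exact h₂ ⟨i, i.2.trans n.2⟩ ⟨j, j.2.trans n.2⟩ i.2 j.2 h
    · exact h₃ ⟨i, i.2.trans n.2⟩ i.2 h
    · refine AnnotatedInstance.encode_eq_iff.2 ⟨h₀, ⟨fun i hi => h₁ ⟨i, hi.trans n.2⟩ hi, h₁'⟩,
        fun i j => Iff.rfl, fun i => ?_, fun i hi => h₄ ⟨i, hi.trans k.2⟩ hi, h₅⟩
      simp only [Finset.mem_filter, Finset.mem_univ, true_and]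
  · rintro ⟨J, hJ⟩
    obtain ⟨h₀, ⟨h₁, h₁'⟩, h₂, h₃, h₄, h₅⟩ := AnnotatedInstance.encode_eq_iff.1 hJ
    refine ⟨⟨J.n, by omega⟩, ⟨J.k, by omega⟩, h₀, fun i hi => h₁ i hi, h₁', fun i j hi hj => ?_,
      fun i hi => ?_, fun i hi => h₄ i hi, h₅⟩
    · intro h
      exact (h₂ ⟨j, hj⟩ ⟨i, hi⟩).2 ((h₂ ⟨i, hi⟩ ⟨j, hj⟩).1 h).symm
    · intro h
      exact J.G.loopless.irrefl _ ((h₂ ⟨i, hi⟩ ⟨i, hi⟩).1 h)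

/-- The edges marked by a certificate. -/
noncomputable def marked (n : ℕ) (c : List Bool) : Finset (Sym2 (Fin n)) :=
  (Finset.univ.filter fun x : Fin (n * n) => IsOne c x).image fun x => s(x.divNat, x.modNat)

theorem val_eq {n : ℕ} (x : Fin (n * n)) : (x.divNat : ℕ) * n + x.modNat = x := by
  rw [Fin.coe_divNat, Fin.coe_modNat, mul_comm]
  exact Nat.div_add_mod _ _

theorem exists_val_eq {n : ℕ} (u v : Fin n) :
    ∃ x : Fin (n * n), x.divNat = u ∧ x.modNat = v ∧ (x : ℕ) = u * n + v := by
  refine ⟨finProdFinEquiv (u, v), ?_, ?_, ?_⟩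
  · exact congrArg Prod.fst (finProdFinEquiv.symm_apply_apply (u, v))
  · exact congrArg Prod.snd (finProdFinEquiv.symm_apply_apply (u, v))
  · rw [finProdFinEquiv_apply_val, mul_comm, add_comm]

/-- The certificate need not be symmetric: an edge counts as marked if either of its two matrix
positions is. -/
theorem mem_marked {n : ℕ} {c : List Bool} {u v : Fin n} :
    s(u, v) ∈ marked n c ↔ IsOne c (u * n + v) ∨ IsOne c (v * n + u) := by
  rw [marked, Finset.mem_image]
  constructor
  · rintro ⟨x, hx, h⟩
    rw [Finset.mem_filter, ← val_eq] at hx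
    rcases Sym2.eq_iff.1 h with ⟨rfl, rfl⟩ | ⟨rfl, rfl⟩
    exacts [Or.inl hx.2, Or.inr hx.2]
  · rintro (h | h)
    · obtain ⟨x, rfl, rfl, hx⟩ := exists_val_eq u v
      exact ⟨x, Finset.mem_filter.2 ⟨Finset.mem_univ _, hx ▸ h⟩, rfl⟩
    · obtain ⟨x, rfl, rfl, hx⟩ := exists_val_eq v u
      exact ⟨x, Finset.mem_filter.2 ⟨Finset.mem_univ _, hx ▸ h⟩, Sym2.eq_swap⟩

/-- The certificate marks a solution. -/
def Accepts (J : AnnotatedInstance) (c : List Bool) : Prop :=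
  (∀ u v : Fin J.n, IsOne c (u * J.n + v) → J.G.Adj u v ∧ u ∈ J.S ∧ v ∈ J.S) ∧
    ¬ J.k < (Finset.univ.filter fun x : Fin (J.n * J.n) => IsOne c x).card ∧
    ∀ a b d e : Fin J.n,
      ¬ IsObstacle (J.G.deleteEdges (marked J.n c : Set (Sym2 (Fin J.n)))) a b d e

theorem mem_of_accepts {J : AnnotatedInstance} {c : List Bool} (h : Accepts J c) :
    J ∈ annotatedEdgeDeletion clawDiamond := by
  obtain ⟨h₁, h₂, h₃⟩ := h
  refine ⟨marked J.n c, ⟨?_, isFree_iff.2 h₃⟩, Finset.card_image_le.trans (not_lt.1 h₂), ?_⟩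
  · intro e he
    induction e with
    | h u v =>
      rcases mem_marked.1 he with h | h
      exacts [(h₁ _ _ h).1, (h₁ _ _ h).1.symm]
  · intro e he v hv
    induction e with
    | h a b =>
      rcases mem_marked.1 he with h | h <;> rcases Sym2.mem_iff.1 hv with rfl | rfl
      exacts [(h₁ _ _ h).2.1, (h₁ _ _ h).2.2, (h₁ _ _ h).2.2, (h₁ _ _ h).2.1]

theorem exists_accepts {J : AnnotatedInstance} (h : J ∈ annotatedEdgeDeletion clawDiamond) :
    ∃ c : List Bool, c.length = J.n * J.n ∧ Accepts J c := by
  obtain ⟨F, ⟨hFG, hfree⟩, hF, hS⟩ := h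
  -- Only the entry above the diagonal is marked, so that the number of marked positions does not
  -- exceed the number of deleted edges.
  let c := List.ofFn fun x : Fin (J.n * J.n) =>
    decide (x.divNat < x.modNat ∧ s(x.divNat, x.modNat) ∈ F)
  have hc : ∀ x : Fin (J.n * J.n), IsOne c x ↔ x.divNat < x.modNat ∧ s(x.divNat, x.modNat) ∈ F := by
    intro x
    rw [IsOne, List.getElem?_eq_getElem (by simp [c])]
    simp [c]
  have hc' : ∀ u v : Fin J.n, IsOne c (u * J.n + v) ↔ u < v ∧ s(u, v) ∈ F := by
    intro u v
    obtain ⟨x, rfl, rfl, hx⟩ := exists_val_eq u v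
    rw [← hx, hc]
  have hm : marked J.n c = F := by
    ext e
    induction e with
    | h u v =>
      rw [mem_marked, hc', hc', Sym2.eq_swap (a := v), ← or_and_right, and_iff_right_iff_imp]
      intro h
      exact lt_or_gt_of_ne (hFG h).ne
  refine ⟨c, by simp [c], fun u v h => ?_, not_lt.2 ?_, ?_⟩
  · have := ((hc' u v).1 h).2
    exact ⟨hFG this, hS _ this _ (Sym2.mem_mk_left _ _), hS _ this _ (Sym2.mem_mk_right _ _)⟩
  · refine le_trans (Finset.card_le_card_of_injOn (t := F) (fun x => s(x.divNat, x.modNat))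
      (fun x hx => ?_) fun x hx y hy hxy => ?_) hF
    · exact ((hc x).1 (Finset.mem_filter.1 hx).2).2
    · have hx' := ((hc x).1 (Finset.mem_filter.1 hx).2).1
      have hy' := ((hc y).1 (Finset.mem_filter.1 hy).2).1
      rcases Sym2.eq_iff.1 hxy with ⟨h₁, h₂⟩ | ⟨h₁, h₂⟩
      · exact Fin.ext (by rw [← val_eq x, ← val_eq y, h₁, h₂])
      · rw [h₁, h₂] at hx'
        exact absurd hx' hy'.asymm
  · rw [hm]
    exact isFree_iff.1 hfree

/-! ### Definability -/

/-- The sets of positions that represent a word and a certificate. -/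
def regs (w c : List Bool) : ℕ → ℕ → Prop
  | 0 => IsOne w
  | 1 => fun p => p < w.length
  | 2 => fun p => w.length ≤ p ∧ IsOne c (p - w.length)
  | _ => fun _ => False

/-- The system of all inputs. -/
def inputs : Sys (List Bool × List Bool) where
  size b := 2 * (b.1.length + b.2.length) + 2
  two_le _ := by omega
  sets b := regs b.1 b.2
  env b := fun _ => 2 * (b.1.length + b.2.length) + 2

instance : Ctx inputs (List Bool × List Bool) := inputs.ctx

section

variable {γ : Type} [Ctx inputs γ]

theorem size_inputs (g : γ) :
    size g = 2 * ((Ctx.base g).1.length + (Ctx.base g).2.length) + 2 := rfl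

instance dfn_isOne_word {x : γ → ℕ} [Trm 3 x] : Dfn 3 fun g => IsOne (Ctx.base g).1 (x g) :=
  Dfn.isOne (r := 0) (by norm_num) (fun g : γ => (Ctx.base g).1) (fun _ _ => Iff.rfl)
    fun g => by rw [size_inputs]; omega

instance trm_length_word : Trm 3 fun g : γ => (Ctx.base g).1.length :=
  Trm.length (r := 1) (by norm_num) (fun g : γ => (Ctx.base g).1) (fun _ _ => Iff.rfl)
    fun g => by rw [size_inputs]; omega

instance bdd_length_word : Bdd fun g : γ => (Ctx.base g).1.length :=
  ⟨fun g => by rw [size_inputs]; omega⟩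

set_option synthInstance.maxSize 1000 in
theorem dfn_isWord : Dfn 3 fun g : γ => IsWord (Ctx.base g).1 (size g) := by
  unfold IsWord
  infer_instance

end

/-- The system of the instances with certificates. -/
noncomputable def instances : Sys (AnnotatedInstance × List Bool) where
  size b := 2 * (b.1.encode.length + b.2.length) + 2
  two_le _ := by omega
  sets b := regs b.1.encode b.2
  env b := fun _ => 2 * (b.1.encode.length + b.2.length) + 2

noncomputable instance : Ctx instances (AnnotatedInstance × List Bool) := instances.ctx

section

variable {γ : Type} [Ctx instances γ]

theorem size_instances (g : γ) :
    size g = 2 * ((Ctx.base g).1.encode.length + (Ctx.base g).2.length) + 2 := rfl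

theorem lt_size (g : γ) : (Ctx.base g).1.n + 1 + (Ctx.base g).1.n * (Ctx.base g).1.n +
    (Ctx.base g).1.n + ((Ctx.base g).1.k + 1) < size g := by
  rw [size_instances, ← AnnotatedInstance.length_encode]; omega

instance dfn_isOne {x : γ → ℕ} [Trm 3 x] : Dfn 3 fun g => IsOne (Ctx.base g).1.encode (x g) :=
  Dfn.isOne (r := 0) (by norm_num) (fun g : γ => (Ctx.base g).1.encode) (fun _ _ => Iff.rfl)
    fun g => by rw [size_instances]; omega

instance trm_length : Trm 3 fun g : γ => (Ctx.base g).1.encode.length :=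
  Trm.length (r := 1) (by norm_num) (fun g : γ => (Ctx.base g).1.encode) (fun _ _ => Iff.rfl)
    fun g => by rw [size_instances]; omega

/-- The certificate follows the word on the tape, so its positions are offset by the length of the
word. -/
instance dfn_isOne_cert {x : γ → ℕ} [hx : Trm 3 x] :
    Dfn 3 fun g => IsOne (Ctx.base g).2 (x g) := by
  have := hx.fst size
  have : Dfn 3 fun q : Σ g : γ, Fin (size g) => instances.sets (Ctx.base q) 2 q.2 :=
    Dfn.rel (by norm_num)
  refine Dfn.of_iff (p := fun g => ∃ a : Fin (size g), (a : ℕ) = (Ctx.base g).1.encode.length + x g ∧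
    instances.sets (Ctx.base g) 2 a) inferInstance fun g => ?_
  constructor
  · intro h
    have := h.lt
    refine ⟨⟨(Ctx.base g).1.encode.length + x g, by rw [size_instances]; omega⟩, rfl,
      Nat.le_add_right _ _, ?_⟩
    rwa [Nat.add_sub_cancel_left]
  · rintro ⟨a, h₁, -, h₂⟩
    rwa [h₁, Nat.add_sub_cancel_left] at h₂

instance trm_n : Trm 3 fun g : γ => (Ctx.base g).1.n :=
  Trm.order (fun g : γ => (Ctx.base g).1.encode) _
    (fun g => (AnnotatedInstance.encode_eq_iff.1 rfl).2.1) fun g => by have := lt_size g; omega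

instance below_n : Below fun g : γ => (Ctx.base g).1.n := ⟨fun g => by
  have := lt_size g; omega⟩

instance rng_n : Rng 3 fun g : γ => (Ctx.base g).1.n where
  dfn := inferInstance

instance rng_sq : Rng 3 fun g : γ => (Ctx.base g).1.n * (Ctx.base g).1.n where
  le g := by have := lt_size g; omega
  dfn := inferInstance

instance trm_k : Trm 3 fun g : γ => (Ctx.base g).1.k := by
  have : Bdd fun q : Σ g : γ, Fin (size g) => (Ctx.base q).1.encode.length :=
    ⟨fun q => by rw [size_instances]; omega⟩
  refine ⟨Dfn.of_iff (p := fun q : Σ g : γ, Fin (size g) => (Ctx.base q).1.encode.length =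
    (Ctx.base q).1.n + 1 + (Ctx.base q).1.n * (Ctx.base q).1.n + (Ctx.base q).1.n + (q.2 + 1))
    inferInstance fun q => ?_⟩
  rw [AnnotatedInstance.length_encode]
  change _ = (Ctx.base q).1.k ↔ _
  omega

instance bdd_k : Bdd fun g : γ => (Ctx.base g).1.k := ⟨fun g => by have := lt_size g; omega⟩

instance adjDfn : AdjDfn 3 fun g : γ => (Ctx.base g).1.G where
  out u v _ _ := Dfn.of_iff (p := fun g => IsOne (Ctx.base g).1.encode ((Ctx.base g).1.n + 1 +
    (u g * (Ctx.base g).1.n + v g))) inferInstance fun _ =>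
      ((AnnotatedInstance.encode_eq_iff.1 rfl).2.2.1 _ _).symm

instance dfn_mem {u : ∀ g : γ, Fin (Ctx.base g).1.n} [Trm 3 fun g => (u g : ℕ)] :
    Dfn 3 fun g => u g ∈ (Ctx.base g).1.S :=
  Dfn.of_iff (p := fun g => IsOne (Ctx.base g).1.encode ((Ctx.base g).1.n + 1 +
    (Ctx.base g).1.n * (Ctx.base g).1.n + u g)) inferInstance fun _ =>
      ((AnnotatedInstance.encode_eq_iff.1 rfl).2.2.2.1 _).symm

instance adjDfn_deleteEdges : AdjDfn 3 fun g : γ => (Ctx.base g).1.G.deleteEdges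
    (marked (Ctx.base g).1.n (Ctx.base g).2 : Set (Sym2 (Fin (Ctx.base g).1.n))) where
  out u v _ _ := Dfn.of_iff (p := fun g => (Ctx.base g).1.G.Adj (u g) (v g) ∧
    ¬ (IsOne (Ctx.base g).2 (u g * (Ctx.base g).1.n + v g) ∨
      IsOne (Ctx.base g).2 (v g * (Ctx.base g).1.n + u g))) inferInstance fun g => by
    rw [SimpleGraph.deleteEdges_adj, Finset.mem_coe, mem_marked]

theorem dfn_accepts : Dfn 3 fun g : γ => Accepts (Ctx.base g).1 (Ctx.base g).2 := by
  have : Trm 3 fun g : γ => (Finset.univ.filter fun x : Fin ((Ctx.base g).1.n * (Ctx.base g).1.n) =>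
      IsOne (Ctx.base g).2 x).card := Trm.card
  unfold Accepts
  infer_instance

end

/-- The verdict of the verifier. -/
noncomputable def verdict (p : List Bool × List Bool) : Bool :=
  decide (∃ J : AnnotatedInstance, J.encode = p.1 ∧ Accepts J p.2)

theorem computable : Nonempty (Turing.TM2ComputableInPolyTime encodePair Computability.encodeBool
    verdict) := by
  -- `φ` recognizes well-formed words among all inputs. `ψ` is only meaningful on encodings of
  -- instances, and its value elsewhere is overridden by the conjunction with `φ`.
  obtain ⟨φ, hφ⟩ := (dfn_isWord (γ := Σ b : List Bool × List Bool, Fin (size b))).out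
  obtain ⟨ψ, hψ⟩ :=
    (dfn_accepts (γ := Σ b : AnnotatedInstance × List Bool, Fin (size b))).out
  -- Set 3 consists of position 0 alone, the only solution of `v * v + v = v`, so that a single
  -- letter is output; set 4 holds the verdict at every position.
  refine computableInPolyTime_of_prg (fun a r => (r = 0 ∧ a = .inl true) ∨
    (r = 1 ∧ a.isLeft = true) ∨ (r = 2 ∧ a = .inr true))
    (.seq (.set 3 (.madd 0 0 0 0)) (.set 4 (.nand (.nand φ ψ) (.nand φ ψ)))) 3 4 fun p => ?_
  obtain ⟨w, t⟩ := p
  have hl : (encodePair (w, t)).length = w.length + t.length := by simp [encodePair]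
  rw [hl]
  set N := 2 * (w.length + t.length) + 2 with hN
  set R := inputSets (fun (a : Bool ⊕ Bool) r => (r = 0 ∧ a = .inl true) ∨
    (r = 1 ∧ a.isLeft = true) ∨ (r = 2 ∧ a = .inr true)) (encodePair (w, t)) with hR
  have hreg : ∀ r < 3, R r = regs w t r := by
    intro r hr
    funext p
    refine propext ?_
    by_cases hp : p < w.length
    · have : (encodePair (w, t))[p]? = some (.inl w[p]) := by
        rw [encodePair, List.getElem?_append_left (by simpa using hp)]
        simp [hp]
      interval_cases r <;> simp [hR, inputSets, this, regs, IsOne, hp]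
    · have : (encodePair (w, t))[p]? = (t[p - w.length]?).map .inr := by
        rw [encodePair, List.getElem?_append_right (by simpa using hp)]
        simp
      interval_cases r
      · simp [hR, inputSets, this, regs, IsOne, hp]
      · simp [hR, inputSets, this, regs, hp]
      · simp [hR, inputSets, this, regs, IsOne, not_lt.1 hp]
  have hrun : ∀ p < N, ((Prg.seq (.set 3 (.madd 0 0 0 0)) (.set 4 (.nand (.nand φ ψ)
      (.nand φ ψ)))).run N (fun _ => N) R 4 p ↔ verdict (w, t) = true) := by
    intro p hp
    rw [Prg.run, Prg.run, Prg.run, Function.update_self]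
    set R' := Function.update R 3 fun v => v < N ∧ (Fm.madd 0 0 0 0).eval N R (cons v fun _ => N)
    have hR' : ∀ r < 3, R' r = regs w t r := fun r hr => by
      rw [← hreg r hr]; exact Function.update_of_ne hr.ne _ _
    have h₁ : φ.eval N R' (cons p fun _ => N) ↔ IsWord w N :=
      hφ ⟨(w, t), p, hp⟩ R' hR'
    rw [isWord_iff (by omega)] at h₁
    by_cases hw : ∃ J : AnnotatedInstance, J.encode = w
    · obtain ⟨J, rfl⟩ := hw
      have h₂ : ψ.eval N R' (cons p fun _ => N) ↔ Accepts J t := hψ ⟨(J, t), p, hp⟩ R' hR'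
      have h₃ : (∃ J' : AnnotatedInstance, J'.encode = J.encode ∧ Accepts J' t) ↔ Accepts J t := by
        refine ⟨?_, fun h => ⟨J, rfl, h⟩⟩
        rintro ⟨J', h, h'⟩
        rwa [AnnotatedInstance.encode_injective h] at h'
      simp only [Fm.eval, h₁, h₂, hp, verdict, decide_eq_true_eq, h₃]
      have : ∃ J' : AnnotatedInstance, J'.encode = J.encode := ⟨J, rfl⟩
      tauto
    · have h₃ : ¬ ∃ J : AnnotatedInstance, J.encode = w ∧ Accepts J t :=
        fun ⟨J, h, _⟩ => hw ⟨J, h⟩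
      simp only [Fm.eval, h₁, verdict, decide_eq_true_eq]
      tauto
  have hlen : ∀ p < N, ((Prg.seq (.set 3 (.madd 0 0 0 0)) (.set 4 (.nand (.nand φ ψ)
      (.nand φ ψ)))).run N (fun _ => N) R 3 p ↔ p = 0) := by
    intro p hp
    rw [Prg.run, Prg.run, Prg.run, Function.update_of_ne (by norm_num), Function.update_self]
    simp [Fm.eval, hp]
  have hfilter : (List.range N).filter (fun p => decide ((Prg.seq (.set 3 (.madd 0 0 0 0))
      (.set 4 (.nand (.nand φ ψ) (.nand φ ψ)))).run N (fun _ => N) R 3 p)) = [0] := by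
    rw [List.filter_congr (q := fun p => decide (p = 0)) fun p hp => by
      rw [decide_eq_decide]; exact hlen p (List.mem_range.1 hp), hN, List.range_succ_eq_map]
    simp
  rw [hfilter, List.map_singleton]
  refine congrArg (fun b => [b]) ?_
  rw [Bool.eq_iff_iff, decide_eq_true_iff]
  exact hrun 0 (by omega)

end Verifier

end EdgeDeletion

/-! ### Membership in NP and the final bounds -/

namespace EdgeDeletion

/-- A certificate of length `n * n` suffices, which is less than the length of the word itself. The
converse holds for certificates of any length. -/
theorem inNP_annotatedLanguage : InNP (annotatedLanguage clawDiamond) := by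
  refine ⟨Polynomial.X, Verifier.verdict, Verifier.computable, fun w => ?_⟩
  unfold Verifier.verdict
  simp only [decide_eq_true_eq]
  constructor
  · rintro ⟨J, hJ, rfl⟩
    obtain ⟨c, hc, h⟩ := Verifier.exists_accepts hJ
    refine ⟨c, ?_, J, rfl, h⟩
    rw [Polynomial.eval_X, hc, AnnotatedInstance.length_encode]
    omega
  · rintro ⟨c, -, J, rfl, h⟩
    exact ⟨J, Verifier.mem_of_accepts h, rfl⟩

theorem Instance.mem_iff_compress (I : Instance) :
    I ∈ edgeDeletion clawDiamond ↔ I.compress.encode ∈ annotatedLanguage clawDiamond := by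
  constructor
  · exact fun h => ⟨_, compress_mem_of_mem h, rfl⟩
  · rintro ⟨J, hJ, h⟩
    rw [AnnotatedInstance.encode_injective h] at hJ
    exact mem_of_compress_mem hJ

/-- The construction gives a ninth power; only the weaker exponent 12 is needed. -/
theorem Instance.compress_n_le (I : Instance) :
    I.compress.n ≤ 484349128 * 2 ^ 9 * (I.k ^ 12 + 1) := by
  calc I.compress.n ≤ 484349128 * (I.k + 1) ^ 9 := card_kept_le (I := I)
    _ ≤ 484349128 * (2 ^ 9 * (I.k ^ 12 + 1)) :=
      Nat.mul_le_mul_left _ (succ_pow_le I.k (by norm_num))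
    _ = _ := (mul_assoc _ _ _).symm

theorem Instance.length_compress_le (I : Instance) :
    I.compress.encode.length ≤ (484349128 + 2) ^ 2 * 2 ^ 18 * (I.k ^ 24 + 1) := by
  have h₁ : I.compress.n ≤ 484349128 * (I.k + 1) ^ 9 := card_kept_le (I := I)
  have h₂ : I.compress.k = I.k := rfl
  have h₃ : I.k + 1 ≤ (I.k + 1) ^ 9 := Nat.le_self_pow (by norm_num) _
  rw [AnnotatedInstance.length_encode, h₂]
  generalize I.compress.n = n at h₁
  generalize ha : (I.k + 1) ^ 9 = a at h₁ h₃
  -- Since `a ≥ k + 1 ≥ 1`, the linear terms are absorbed by completing the square.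
  calc n + 1 + n * n + n + (I.k + 1) ≤ (n + 2 * a) * (n + 2 * a) := by nlinarith
    _ ≤ (484349128 * a + 2 * a) * (484349128 * a + 2 * a) := by gcongr
    _ = (484349128 + 2) ^ 2 * (I.k + 1) ^ 18 := by rw [← ha]; ring
    _ ≤ (484349128 + 2) ^ 2 * (2 ^ 18 * (I.k ^ 24 + 1)) :=
      Nat.mul_le_mul_left _ (succ_pow_le I.k (by norm_num))
    _ = _ := (mul_assoc _ _ _).symm

end EdgeDeletion
/-- The problem Annotated {claw, diamond}-free Edge Deletion is in NP, and {claw, diamond}-free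
Edge Deletion has a polynomial-time compression into it of size `O(k ^ 24)`, which outputs
instances with `O(k ^ 12)` vertices. -/
theorem theorem2 :
    EdgeDeletion.InNP (EdgeDeletion.annotatedLanguage EdgeDeletion.clawDiamond) ∧
    ∃ (C : ℕ) (f : EdgeDeletion.Instance → List Bool),
      EdgeDeletion.IsPolyTimeCompression EdgeDeletion.Instance.encode EdgeDeletion.Instance.k
        (EdgeDeletion.edgeDeletion EdgeDeletion.clawDiamond)
        (EdgeDeletion.annotatedLanguage EdgeDeletion.clawDiamond)
        (fun k => C * (k ^ 24 + 1)) f ∧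
      ∀ I : EdgeDeletion.Instance, ∃ J : EdgeDeletion.AnnotatedInstance,
        f I = J.encode ∧ J.n ≤ C * (I.k ^ 12 + 1) := by
  refine ⟨EdgeDeletion.inNP_annotatedLanguage, (484349128 + 2) ^ 2 * 2 ^ 18,
    fun I => I.compress.encode, ⟨EdgeDeletion.Compression.computable, fun I =>
      ⟨I.mem_iff_compress, I.length_compress_le⟩⟩, fun I => ⟨I.compress, rfl, ?_⟩⟩
  exact I.compress_n_le.trans (Nat.mul_le_mul_right _ (by norm_num))
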